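/- Let $d\in\{1,2,3\}$, and for $\sigma\ge 0$, $s\in\mathbb R$ let $G^{\sigma,s}(\mathbb R^d)$ be the Gevrey space with norm $\|f\|_{G^{\sigma,s}}=\|e^{\sigma\|D\|}\langle D\rangle^s f\|_{L^2(\mathbb R^d)}$, where $D=-i\nabla$, $\|\xi\|=\sum_{i=1}^d|\xi_i|$ and $\langle\xi\rangle=\sqrt{1+|\xi|^2}$. Consider the Cauchy problem for the Klein–Gordon–Schrödinger system $$ \begin{cases} i\partial_t u+\Delta u=-un, & u(0,x)=u_0(x),\\ \partial_t^2 n+(1-\Delta)n=|u|^2, & (n,\partial_t n)(0,x)=(n_0,n_1)(x), \end{cases} $$ for $u:\mathbb R^{1+d}\to\mathbb C$ and $n:\mathbb R^{1+d}\to\mathbb R$. Let $\sigma_0>0$ and $r,s\in\mathbb R$, let $(u_0,n_0,n_1)\in G^{\sigma_0,r}(\mathbb R^d)\times G^{\sigma_0,s}(\mathbb R^d)\times G^{\sigma_0,s-1}(\mathbb R^d)$, and let $(u,n)$ be the global $C^\infty$ solution of this problem, that is, $u$ and $n$ are $C^\infty$ on $\mathbb R^{1+d}$, solve the system, and $u,n,\partial_t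 n\in C(\mathbb R;H^k(\mathbb R^d))$ for every $k\in\mathbb N$. Put $p=\max\{8/(4-d),4\}$. Then for every $\varepsilon>0$ there is a function $\sigma:\mathbb R\to(0,\infty)$ such that $$ (u,n,\partial_t n)(t)\in G^{\sigma(t),r}(\mathbb R^d)\times G^{\sigma(t),s}(\mathbb R^d)\times G^{\sigma(t),s-1}(\mathbb R^d)\quad\text{for all } t\in\mathbb R $$ and $$ \sigma(t)\ \ge\ c\,|t|^{-(p+\varepsilon)}\quad\text{for all } |t|\ge T, $$ where the constants $c>0$ and $T>0$ depend only on $d$, $\varepsilon$, $\sigma_0$, $r$, $s$ and an upper bound for the norm $\|u_0\|_{G^{\sigma_0,r}}+\|n_0\|_{G^{\sigma_0,s}}+\|n_1\|_{G^{\sigma_0,s-1}}$ of the data. -/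

import Mathlib

open MeasureTheory Filter Topology
open scoped ENNReal NNReal ContDiff FourierTransform Laplacian

namespace KGS

noncomputable section

/-- The symbol `e^{σ‖η‖} ⟨η⟩^s`, with `‖η‖ = ∑ |η_i|` and `⟨η⟩ = √(1+|η|²)`, of the Fourier
multiplier `e^{σ‖D‖} ⟨D⟩^s`, `D = -i∇`. -/
def gevreySymbol {d : ℕ} (σ s : ℝ) (η : EuclideanSpace ℝ (Fin d)) : ℝ :=
  Real.exp (σ * ∑ i, |η i|) * Real.sqrt (1 + ‖η‖ ^ 2) ^ s

open Classical in
/-- The norm `‖f‖_{G^{σ,s}} = ‖e^{σ‖D‖} ⟨D⟩^s f‖_{L²}` of a function on `ℝ^d`, as an extended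
nonnegative number, computed on the Fourier side. The Fourier transform is the unitary one on
`L²` with kernel `e^{-2πi x·ξ}`, so that `D` is multiplication by `2πξ`.
Every element of `G^{σ,s}` with `σ > 0`, or with `σ = 0` and `s ≥ 0`, is an `L²` function; the
norm is infinite on functions outside `L²`. -/
def gevreyNorm {d : ℕ} (σ s : ℝ) (f : EuclideanSpace ℝ (Fin d) → ℂ) : ℝ≥0∞ :=
  if hf : MemLp f 2 volume then
    eLpNorm (fun ξ => (gevreySymbol σ s ((2 * Real.pi) • ξ) : ℂ) *
      (𝓕 (hf.toLp f) : Lp ℂ 2 (volume : Measure (EuclideanSpace ℝ (Fin d)))) ξ) 2 volume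
  else ⊤

/-- Membership in the Gevrey space `G^{σ,s}(ℝ^d)` (for `σ > 0`, or `σ = 0` and `s ≥ 0`). -/
def MemGevrey {d : ℕ} (σ s : ℝ) (f : EuclideanSpace ℝ (Fin d) → ℂ) : Prop :=
  gevreyNorm σ s f < ⊤

/-- `t ↦ f t` is a continuous curve in the Sobolev space `H^k(ℝ^d) = G^{0,k}(ℝ^d)`. -/
def ContinuousInSobolev {d : ℕ} (k : ℕ) (f : ℝ → EuclideanSpace ℝ (Fin d) → ℂ) : Prop :=
  (∀ t, MemGevrey 0 k (f t)) ∧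
    ∀ t₀, Tendsto (fun t => gevreyNorm 0 k (fun x => f t x - f t₀ x)) (𝓝 t₀) (𝓝 0)

/-- `(u, n)` is the global `C^∞` solution of the Klein–Gordon–Schrödinger Cauchy problem
`i ∂ₜu + Δu = -un`, `∂ₜ²n + (1-Δ)n = |u|²`, `(u, n, ∂ₜn)(0) = (u₀, n₀, n₁)`:
`u` and `n` are smooth on space-time and solve the system pointwise, and `u`, `n`, `∂ₜn` are
continuous in time with values in every Sobolev space `H^k` (the class given by the
well-posedness theory in Sobolev spaces; the solution is unique in it).
The data are elements of `L²`-based spaces, hence attained up to null sets. -/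
structure IsGlobalSmoothSolution {d : ℕ}
    (u₀ : EuclideanSpace ℝ (Fin d) → ℂ) (n₀ n₁ : EuclideanSpace ℝ (Fin d) → ℝ)
    (u : ℝ → EuclideanSpace ℝ (Fin d) → ℂ) (n : ℝ → EuclideanSpace ℝ (Fin d) → ℝ) : Prop where
  smooth_u : ContDiff ℝ ∞ (fun p : ℝ × EuclideanSpace ℝ (Fin d) => u p.1 p.2)
  smooth_n : ContDiff ℝ ∞ (fun p : ℝ × EuclideanSpace ℝ (Fin d) => n p.1 p.2)
  sobolev_u : ∀ k : ℕ, ContinuousInSobolev k u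
  sobolev_n : ∀ k : ℕ, ContinuousInSobolev k (fun t x => (n t x : ℂ))
  sobolev_dn : ∀ k : ℕ, ContinuousInSobolev k (fun t x => ((deriv (fun τ => n τ x) t : ℝ) : ℂ))
  schrodinger : ∀ t x,
    Complex.I * deriv (fun τ => u τ x) t + Δ (u t) x = -(u t x * (n t x : ℂ))
  kleinGordon : ∀ t x,
    iteratedDeriv 2 (fun τ => n τ x) t + (n t x - Δ (n t) x) = ‖u t x‖ ^ 2
  init_u : u 0 =ᵐ[volume] u₀
  init_n : n 0 =ᵐ[volume] n₀
  init_dn : (fun x => deriv (fun τ => n τ x) 0) =ᵐ[volume] n₁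

end

end KGS

namespace KGS

/-!
On the Fourier side the system is an ODE for curves in `L²`. Multiply them by the weight
`w(ξ) = exp (min (σ‖ξ‖) M)`; the truncation keeps all quantities finite, and every bound is uniform
in `M`. The exponent is subadditive, so the weighted nonlinearities are convolutions with a factor
`w(ξ) / (w(ξ - η) w(η)) ∈ (0, 1]`, which differs from `1` by `O((σ min(⟨ξ - η⟩, ⟨η⟩))^θ)` for
`0 < θ ≤ 1`. Hence the weighted mass and energy are conserved up to errors with a factor `σ^θ`, at
the cost of `θ` derivatives; the bilinear estimates have this much room as long as
`d < 2 (2 - θ)`.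

The lost derivatives are measured by the time derivative of the weighted `û` and by the wave energy
of the weighted `n̂`, one order higher. While mass and energy are bounded, interpolation makes the
growth rate of a norm `L` of these quantities `O(L^(1 - θ))`, so that `L = O(T^(1/θ))` for
`|t| ≤ T`. The total error in the conservation laws is then `O(σ^θ T^(1 + 1/θ))`, and a continuity
argument keeps mass and energy bounded for `σ ~ T^(-(1 + 1/θ) / θ)`.
-/

noncomputable section

open scoped ComplexConjugate

variable {d : ℕ}

/-- The Euclidean space `ℝ^d`, used both for positions and for frequencies. -/
abbrev Space (d : ℕ) := EuclideanSpace ℝ (Fin d)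

/-- Square integrable functions on `ℝ^d`. -/
abbrev L2 (d : ℕ) := Lp ℂ 2 (volume : Measure (Space d))

/-- The symbol of `⟨D⟩` in the normalisation of the Fourier transform with kernel
`e^{-2πi x·ξ}`. -/
def bracket (ξ : Space d) : ℝ := √(1 + ‖(2 * Real.pi) • ξ‖ ^ 2)

lemma one_le_bracket (ξ : Space d) : 1 ≤ bracket ξ :=
  Real.one_le_sqrt.2 (le_add_of_nonneg_right (sq_nonneg _))

lemma bracket_pos (ξ : Space d) : 0 < bracket ξ := one_pos.trans_le (one_le_bracket ξ)

lemma bracket_ne_zero (ξ : Space d) : bracket ξ ≠ 0 := (bracket_pos ξ).ne'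

@[fun_prop]
lemma continuous_bracket : Continuous (bracket : Space d → ℝ) := by
  unfold bracket; fun_prop

@[fun_prop]
lemma measurable_bracket : Measurable (bracket : Space d → ℝ) := continuous_bracket.measurable

lemma bracket_neg (ξ : Space d) : bracket (-ξ) = bracket ξ := by simp [bracket]

lemma bracket_sq (ξ : Space d) : bracket ξ ^ 2 = 1 + ‖(2 * Real.pi) • ξ‖ ^ 2 :=
  Real.sq_sqrt (by positivity)

lemma norm_le_bracket (ξ : Space d) : ‖(2 * Real.pi) • ξ‖ ≤ bracket ξ :=
  Real.le_sqrt_of_sq_le (by linarith)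

lemma bracket_le_add (ξ η : Space d) : bracket ξ ≤ bracket (ξ - η) + bracket η := by
  have triangle : ‖(2 * Real.pi) • ξ‖ ≤ ‖(2 * Real.pi) • (ξ - η)‖ + ‖(2 * Real.pi) • η‖ := by
    simpa [← smul_add] using norm_add_le ((2 * Real.pi) • (ξ - η)) ((2 * Real.pi) • η)
  have cross := mul_le_mul (norm_le_bracket (ξ - η)) (norm_le_bracket η) (norm_nonneg _)
    (bracket_pos _).le
  have sq_triangle := pow_le_pow_left₀ (norm_nonneg _) triangle 2
  refine le_of_sq_le_sq ?_ (add_pos (bracket_pos _) (bracket_pos _)).le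
  linarith [bracket_sq ξ, bracket_sq (ξ - η), bracket_sq η,
    add_sq (bracket (ξ - η)) (bracket η),
    add_sq ‖(2 * Real.pi) • (ξ - η)‖ ‖(2 * Real.pi) • η‖]

lemma rpow_neg_bracket_le_one (ξ : Space d) {s : ℝ} (hs : 0 ≤ s) : bracket ξ ^ (-s) ≤ 1 :=
  Real.rpow_le_one_of_one_le_of_nonpos (one_le_bracket ξ) (neg_nonpos.2 hs)

lemma sq_rpow_neg_bracket_le (ξ : Space d) {s : ℝ} (hs : 0 ≤ s) :
    (bracket ξ ^ (-s)) ^ 2 ≤ (1 + ‖ξ‖ ^ 2) ^ (-(2 * s) / 2) := by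
  have norm_le : ‖ξ‖ ≤ ‖(2 * Real.pi) • ξ‖ := by
    rw [norm_smul, Real.norm_of_nonneg (by positivity)]
    exact le_mul_of_one_le_left (norm_nonneg ξ) (by linarith [Real.pi_gt_three])
  calc (bracket ξ ^ (-s)) ^ 2 = (bracket ξ ^ 2) ^ (-s) := Real.rpow_pow_comm (bracket_pos ξ).le _ _
    _ ≤ (1 + ‖ξ‖ ^ 2) ^ (-s) := by
      refine Real.rpow_le_rpow_of_nonpos (by positivity) ?_ (neg_nonpos.2 hs)
      rw [bracket_sq]
      gcongr
    _ = (1 + ‖ξ‖ ^ 2) ^ (-(2 * s) / 2) := by ring_nf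

/-- The square of the `L²` norm of `⟨ξ⟩^{-s}`. -/
def decayConst (d : ℕ) (s : ℝ) : ℝ≥0∞ := ∫⁻ ξ : Space d, ENNReal.ofReal (bracket ξ ^ (-s)) ^ 2

lemma decayConst_lt_top {s : ℝ} (hs : (d : ℝ) < 2 * s) : decayConst d s < ⊤ := by
  have hs0 : 0 ≤ s := by linarith [(Nat.cast_nonneg d : (0 : ℝ) ≤ d)]
  have integrable : Integrable (fun ξ : Space d => (1 + ‖ξ‖ ^ 2) ^ (-(2 * s) / 2)) volume :=
    integrable_rpow_neg_one_add_norm_sq (by simpa using hs)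
  refine lt_of_le_of_lt (lintegral_mono fun ξ => ?_) integrable.lintegral_lt_top
  rw [← ENNReal.ofReal_pow (Real.rpow_nonneg (bracket_pos ξ).le _)]
  exact ENNReal.ofReal_le_ofReal (sq_rpow_neg_bracket_le ξ hs0)

/-! ### Bilinear operators with smoothing kernels -/

lemma ennreal_add_sq_le (a b : ℝ≥0∞) : (a + b) ^ 2 ≤ 2 * a ^ 2 + 2 * b ^ 2 := by
  have := ENNReal.rpow_add_le_mul_rpow_add_rpow a b (p := 2) (by norm_num)
  norm_num at this
  simpa [mul_add] using this

lemma sq_lintegral_mul_le {α : Type*} [MeasurableSpace α] {μ : Measure α} {f g : α → ℝ≥0∞}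
    (hf : AEMeasurable f μ) (hg : AEMeasurable g μ) :
    (∫⁻ a, f a * g a ∂μ) ^ 2 ≤ (∫⁻ a, f a ^ 2 ∂μ) * ∫⁻ a, g a ^ 2 ∂μ := by
  refine (pow_le_pow_left' (ENNReal.lintegral_mul_le_Lp_mul_Lq μ Real.HolderConjugate.two_two
    hf hg) 2).trans_eq ?_
  simp only [mul_pow, ENNReal.rpow_ofNat, ← ENNReal.rpow_natCast, ← ENNReal.rpow_mul]
  norm_num

/-- The function `⟨ξ - η⟩^{-s} + ⟨η⟩^{-s}`, by which kernels are dominated. -/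
def decayKernel (s : ℝ) (ξ η : Space d) : ℝ := bracket (ξ - η) ^ (-s) + bracket η ^ (-s)

lemma lintegral_decayKernel_sq_le (s : ℝ) (ξ : Space d) :
    ∫⁻ η, ENNReal.ofReal (decayKernel s ξ η) ^ 2 ≤ 4 * decayConst d s := by
  calc ∫⁻ η, ENNReal.ofReal (decayKernel s ξ η) ^ 2
      ≤ ∫⁻ η, (2 * ENNReal.ofReal (bracket (ξ - η) ^ (-s)) ^ 2 +
          2 * ENNReal.ofReal (bracket η ^ (-s)) ^ 2) := by
        refine lintegral_mono fun η => ?_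
        unfold decayKernel
        rw [ENNReal.ofReal_add (Real.rpow_nonneg (bracket_pos _).le _)
          (Real.rpow_nonneg (bracket_pos _).le _)]
        exact ennreal_add_sq_le _ _
    _ = 2 * decayConst d s + 2 * decayConst d s := by
        rw [lintegral_add_right _ (by fun_prop), lintegral_const_mul _ (by fun_prop),
          lintegral_const_mul _ (by fun_prop),
          lintegral_sub_left_eq_self (fun η => ENNReal.ofReal (bracket η ^ (-s)) ^ 2) ξ, decayConst]
    _ = 4 * decayConst d s := by rw [← add_mul]; norm_num

lemma lintegral_sq_convolution (f g : Space d → ℝ≥0∞) (hf : Measurable f) (hg : Measurable g) :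
    ∫⁻ ξ, ∫⁻ η, (f (ξ - η) * g η) ^ 2 = (∫⁻ ξ, f ξ ^ 2) * ∫⁻ ξ, g ξ ^ 2 := by
  have inner (η : Space d) :
      ∫⁻ ξ, f (ξ - η) ^ 2 * g η ^ 2 = (∫⁻ ξ, f ξ ^ 2) * g η ^ 2 := by
    rw [lintegral_mul_const _ (by fun_prop), lintegral_sub_right_eq_self (fun ξ => f ξ ^ 2) η]
  have measurable :
      Measurable (fun p : Space d × Space d => (f (p.1 - p.2) * g p.2) ^ 2) := by fun_prop
  rw [lintegral_lintegral_swap measurable.aemeasurable]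
  simp_rw [mul_pow, inner]
  rw [lintegral_const_mul _ (by fun_prop)]

lemma lintegral_sq_lintegral_decayKernel_le (s : ℝ) {f g : Space d → ℝ≥0∞} (hf : Measurable f)
    (hg : Measurable g) :
    ∫⁻ ξ, (∫⁻ η, ENNReal.ofReal (decayKernel s ξ η) * (f (ξ - η) * g η)) ^ 2 ≤
      4 * decayConst d s * ((∫⁻ ξ, f ξ ^ 2) * ∫⁻ ξ, g ξ ^ 2) := by
  calc ∫⁻ ξ, (∫⁻ η, ENNReal.ofReal (decayKernel s ξ η) * (f (ξ - η) * g η)) ^ 2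
      ≤ ∫⁻ ξ, 4 * decayConst d s * ∫⁻ η, (f (ξ - η) * g η) ^ 2 := by
        refine lintegral_mono fun ξ => ?_
        refine (sq_lintegral_mul_le (by unfold decayKernel; fun_prop) (by fun_prop)).trans ?_
        gcongr
        exact lintegral_decayKernel_sq_le s ξ
    _ = 4 * decayConst d s * ((∫⁻ ξ, f ξ ^ 2) * ∫⁻ ξ, g ξ ^ 2) := by
        rw [lintegral_const_mul, lintegral_sq_convolution f g hf hg]
        exact Measurable.lintegral_prod_right'
          (f := fun p : Space d × Space d => (f (p.1 - p.2) * g p.2) ^ 2) (by fun_prop)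

lemma eLpNorm_two_sq {f : Space d → ℂ} : eLpNorm f 2 volume ^ 2 = ∫⁻ ξ, ‖f ξ‖ₑ ^ 2 := by
  simpa using eLpNorm_nnreal_pow_eq_lintegral (f := f) (μ := volume) (p := 2) two_ne_zero

lemma lintegral_enorm_sq (f : L2 d) : ∫⁻ ξ, ‖f ξ‖ₑ ^ 2 = ENNReal.ofReal (‖f‖ ^ 2) := by
  rw [← eLpNorm_two_sq, ENNReal.ofReal_pow (norm_nonneg _), Lp.norm_def,
    ENNReal.ofReal_toReal (Lp.eLpNorm_ne_top f)]

lemma L2.measurable (f : L2 d) : Measurable (f : Space d → ℂ) :=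
  (Lp.stronglyMeasurable f).measurable

/-- A real kernel `K(ξ, η)` dominated by a multiple of `⟨ξ - η⟩^{-s} + ⟨η⟩^{-s}`, with `s > d/2`. -/
structure SmoothingKernel (d : ℕ) (s : ℝ) where
  /-- the kernel -/
  toFun : Space d → Space d → ℝ
  measurable : Measurable (fun p : Space d × Space d => toFun p.1 p.2)
  /-- the factor in the bound -/
  const : ℝ
  const_nonneg : 0 ≤ const
  bound : ∀ ξ η, |toFun ξ η| ≤ const * decayKernel s ξ η
  decay : (d : ℝ) < 2 * s

/-- The integral `∫ K(ξ, η) f(ξ - η) g(η) dη`. -/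
def kernelConv (K : Space d → Space d → ℝ) (f g : Space d → ℂ) (ξ : Space d) : ℂ :=
  ∫ η, (K ξ η : ℂ) * (f (ξ - η) * g η)

lemma ae_comp_sub_left {p : Space d → Prop} (h : ∀ᵐ η, p η) (ξ : Space d) : ∀ᵐ η, p (ξ - η) :=
  (quasiMeasurePreserving_sub_left_of_right_invariant volume ξ).ae h

lemma mul_kernelConv_congr {K K' : Space d → Space d → ℝ} {f f' g g' : Space d → ℂ}
    {χ ψ : Space d → ℝ} (hf : f' =ᵐ[volume] fun ξ => (χ ξ : ℂ) * f ξ)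
    (hg : g' =ᵐ[volume] fun ξ => (ψ ξ : ℂ) * g ξ) {ξ : Space d} {c : ℝ}
    (hK : ∀ η, c * K ξ η = K' ξ η * χ (ξ - η) * ψ η) :
    (c : ℂ) * kernelConv K f g ξ = kernelConv K' f' g' ξ := by
  unfold kernelConv
  rw [← integral_const_mul]
  refine integral_congr_ae ?_
  filter_upwards [ae_comp_sub_left hf ξ, hg] with η hfη hgη
  have hKη : (c : ℂ) * K ξ η = K' ξ η * χ (ξ - η) * ψ η := mod_cast hK η
  rw [hfη, hgη]
  linear_combination (f (ξ - η) * g η) * hKη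

/-- An upper bound, up to the factor of its kernel, for the norm of a bilinear operator with a
smoothing kernel of decay `s`. -/
def convConst (d : ℕ) (s : ℝ) : ℝ := 2 * √(decayConst d s).toReal

lemma convConst_nonneg (d : ℕ) (s : ℝ) : 0 ≤ convConst d s := by unfold convConst; positivity

namespace SmoothingKernel

variable {s : ℝ} (K : SmoothingKernel d s) (f g : L2 d)

lemma enorm_le (ξ η : Space d) (z : ℂ) :
    ‖(K.toFun ξ η : ℂ) * z‖ₑ ≤
      ENNReal.ofReal K.const * (ENNReal.ofReal (decayKernel s ξ η) * ‖z‖ₑ) := by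
  rw [enorm_mul, ← mul_assoc, ← ENNReal.ofReal_mul K.const_nonneg]
  gcongr
  rw [← ofReal_norm, Complex.norm_real]
  exact ENNReal.ofReal_le_ofReal (K.bound ξ η)

lemma lintegral_sq_le :
    ∫⁻ ξ, (∫⁻ η, ‖(K.toFun ξ η : ℂ) * (f (ξ - η) * g η)‖ₑ) ^ 2 ≤
      ENNReal.ofReal ((convConst d s * K.const * ‖f‖ * ‖g‖) ^ 2) := by
  calc ∫⁻ ξ, (∫⁻ η, ‖(K.toFun ξ η : ℂ) * (f (ξ - η) * g η)‖ₑ) ^ 2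
      ≤ ∫⁻ ξ, ENNReal.ofReal K.const ^ 2 * (∫⁻ η, ENNReal.ofReal (decayKernel s ξ η) *
          (‖f (ξ - η)‖ₑ * ‖g η‖ₑ)) ^ 2 := by
        refine lintegral_mono fun ξ => ?_
        rw [← mul_pow, ← lintegral_const_mul' _ _ ENNReal.ofReal_ne_top]
        gcongr with η
        simpa only [enorm_mul] using K.enorm_le ξ η (f (ξ - η) * g η)
    _ ≤ ENNReal.ofReal K.const ^ 2 * (4 * decayConst d s *
          ((∫⁻ ξ, ‖f ξ‖ₑ ^ 2) * ∫⁻ ξ, ‖g ξ‖ₑ ^ 2)) := by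
        rw [lintegral_const_mul' _ _ (by finiteness)]
        gcongr
        exact lintegral_sq_lintegral_decayKernel_le s (L2.measurable f).enorm
          (L2.measurable g).enorm
    _ = ENNReal.ofReal (K.const ^ 2 * (4 * (decayConst d s).toReal * (‖f‖ ^ 2 * ‖g‖ ^ 2))) := by
        rw [lintegral_enorm_sq, lintegral_enorm_sq, ENNReal.ofReal_mul (by positivity),
          ENNReal.ofReal_mul (by positivity), ENNReal.ofReal_mul (by positivity),
          ENNReal.ofReal_mul (by positivity), ENNReal.ofReal_pow K.const_nonneg,
          ENNReal.ofReal_toReal (decayConst_lt_top K.decay).ne, ENNReal.ofReal_ofNat]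
    _ = ENNReal.ofReal ((convConst d s * K.const * ‖f‖ * ‖g‖) ^ 2) := by
        simp only [convConst, mul_pow, Real.sq_sqrt ENNReal.toReal_nonneg]
        ring_nf

lemma measurable_integrand :
    Measurable (fun p : Space d × Space d => (K.toFun p.1 p.2 : ℂ) * (f (p.1 - p.2) * g p.2)) := by
  have hf := L2.measurable f
  have hg := L2.measurable g
  have hK := K.measurable
  fun_prop

lemma ae_integrable :
    ∀ᵐ ξ, Integrable (fun η => (K.toFun ξ η : ℂ) * (f (ξ - η) * g η)) := by
  have measurable := K.measurable_integrand f g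
  have finite := (K.lintegral_sq_le f g).trans_lt ENNReal.ofReal_lt_top
  filter_upwards [ae_lt_top (measurable.enorm.lintegral_prod_right'.pow_const 2) finite.ne]
    with ξ hξ
  refine ⟨(measurable.comp measurable_prodMk_left).aestronglyMeasurable, ?_⟩
  rw [hasFiniteIntegral_iff_enorm]
  exact (ENNReal.pow_lt_top_iff.1 hξ).resolve_right two_ne_zero

lemma eLpNorm_le :
    eLpNorm (kernelConv K.toFun f g) 2 volume ≤
      ENNReal.ofReal (convConst d s * K.const * ‖f‖ * ‖g‖) := by
  have := K.const_nonneg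
  have := convConst_nonneg d s
  refine (ENNReal.pow_le_pow_left_iff two_ne_zero).1 ?_
  rw [eLpNorm_two_sq, ← ENNReal.ofReal_pow (by positivity)]
  exact (lintegral_mono fun ξ => pow_le_pow_left' (enorm_integral_le_lintegral_enorm _) 2).trans
    (K.lintegral_sq_le f g)

lemma memLp : MemLp (kernelConv K.toFun f g) 2 volume :=
  ⟨((K.measurable_integrand f g).stronglyMeasurable.integral_prod_right).aestronglyMeasurable,
    (K.eLpNorm_le f g).trans_lt ENNReal.ofReal_lt_top⟩

lemma norm_toLp_le : ‖(K.memLp f g).toLp _‖ ≤ convConst d s * K.const * ‖f‖ * ‖g‖ := by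
  have := K.const_nonneg
  have := convConst_nonneg d s
  rw [Lp.norm_toLp]
  exact ENNReal.toReal_le_of_le_ofReal (by positivity) (K.eLpNorm_le f g)

lemma kernelConv_add_left (f' : L2 d) :
    kernelConv K.toFun (f + f' : L2 d) g =ᵐ[volume]
      kernelConv K.toFun f g + kernelConv K.toFun f' g := by
  filter_upwards [K.ae_integrable f g, K.ae_integrable f' g] with ξ hf hf'
  simp only [kernelConv, Pi.add_apply]
  rw [← integral_add hf hf']
  refine integral_congr_ae ?_
  filter_upwards [ae_comp_sub_left (Lp.coeFn_add f f') ξ] with η hη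
  rw [hη, Pi.add_apply]; ring

lemma kernelConv_add_right (g' : L2 d) :
    kernelConv K.toFun f (g + g' : L2 d) =ᵐ[volume]
      kernelConv K.toFun f g + kernelConv K.toFun f g' := by
  filter_upwards [K.ae_integrable f g, K.ae_integrable f g'] with ξ hg hg'
  simp only [kernelConv, Pi.add_apply]
  rw [← integral_add hg hg']
  refine integral_congr_ae ?_
  filter_upwards [Lp.coeFn_add g g'] with η hη
  rw [hη, Pi.add_apply]; ring

lemma kernelConv_smul_left (c : ℂ) :
    kernelConv K.toFun (c • f : L2 d) g = c • kernelConv K.toFun f g := by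
  funext ξ
  simp only [kernelConv, Pi.smul_apply, smul_eq_mul, ← integral_const_mul]
  refine integral_congr_ae ?_
  filter_upwards [ae_comp_sub_left (Lp.coeFn_smul c f) ξ] with η hη
  rw [hη, Pi.smul_apply, smul_eq_mul]; ring

lemma kernelConv_smul_right (c : ℂ) :
    kernelConv K.toFun f (c • g : L2 d) = c • kernelConv K.toFun f g := by
  funext ξ
  simp only [kernelConv, Pi.smul_apply, smul_eq_mul, ← integral_const_mul]
  refine integral_congr_ae ?_
  filter_upwards [Lp.coeFn_smul c g] with η hη
  rw [hη, Pi.smul_apply, smul_eq_mul]; ring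

/-- The bilinear operator `L² × L² → L²` with a smoothing kernel. -/
def op : L2 d →L[ℂ] L2 d →L[ℂ] L2 d :=
  LinearMap.mkContinuous₂
    (LinearMap.mk₂ ℂ (fun f g => (K.memLp f g).toLp _)
      (fun f f' g => by
        rw [← MemLp.toLp_add, MemLp.toLp_eq_toLp_iff]
        exact K.kernelConv_add_left f g f')
      (fun c f g => by
        simp_rw [K.kernelConv_smul_left f g c]
        exact MemLp.toLp_const_smul c (K.memLp f g))
      (fun f g g' => by
        rw [← MemLp.toLp_add, MemLp.toLp_eq_toLp_iff]
        exact K.kernelConv_add_right f g g')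
      (fun c f g => by
        simp_rw [K.kernelConv_smul_right f g c]
        exact MemLp.toLp_const_smul c (K.memLp f g)))
    (convConst d s * K.const) K.norm_toLp_le

lemma coeFn_op : (K.op f g : Space d → ℂ) =ᵐ[volume] kernelConv K.toFun f g :=
  (K.memLp f g).coeFn_toLp

lemma norm_op_le : ‖K.op f g‖ ≤ convConst d s * K.const * ‖f‖ * ‖g‖ := K.norm_toLp_le f g

end SmoothingKernel

namespace SmoothingKernel

variable {s : ℝ} (K : SmoothingKernel d s)

lemma norm_le_of_weights {f g f' g' q : L2 d} {χ ψ τ : Space d → ℝ}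
    (hχm : Measurable χ) (hψm : Measurable ψ) (hτm : Measurable τ)
    (hχ : ∀ ξ, 0 < χ ξ) (hψ : ∀ ξ, 0 < ψ ξ)
    (hf : (f' : Space d → ℂ) =ᵐ[volume] fun ξ => (χ ξ : ℂ) * f ξ)
    (hg : (g' : Space d → ℂ) =ᵐ[volume] fun ξ => (ψ ξ : ℂ) * g ξ)
    (hq : (q : Space d → ℂ) =ᵐ[volume] fun ξ => (τ ξ : ℂ) * K.op f g ξ)
    {C : ℝ} (hC : 0 ≤ C)
    (hK : ∀ ξ η, |τ ξ * K.toFun ξ η| ≤ C * decayKernel s ξ η * χ (ξ - η) * ψ η) :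
    ‖q‖ ≤ convConst d s * C * ‖f'‖ * ‖g'‖ := by
  have hKm := K.measurable
  let K' : SmoothingKernel d s :=
    { toFun := fun ξ η => τ ξ * K.toFun ξ η / (χ (ξ - η) * ψ η)
      measurable := by fun_prop
      const := C
      const_nonneg := hC
      bound := fun ξ η => by
        rw [abs_div, abs_of_pos (mul_pos (hχ _) (hψ _)), div_le_iff₀ (mul_pos (hχ _) (hψ _))]
        linarith [hK ξ η]
      decay := K.decay }
  have eq_op : q = K'.op f' g' := by
    apply Lp.ext
    filter_upwards [hq, K.coeFn_op f g, K'.coeFn_op f' g'] with ξ hqξ hKξ hK'ξ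
    rw [hqξ, hKξ, hK'ξ]
    refine mul_kernelConv_congr hf hg fun η => ?_
    have := (hχ (ξ - η)).ne'
    have := (hψ η).ne'
    simp only [K']
    field_simp
  rw [eq_op]
  exact K'.norm_op_le f' g'

lemma norm_op_le_of_weights {f g f' g' : L2 d} {χ ψ : Space d → ℝ}
    (hχm : Measurable χ) (hψm : Measurable ψ) (hχ : ∀ ξ, 0 < χ ξ) (hψ : ∀ ξ, 0 < ψ ξ)
    (hf : (f' : Space d → ℂ) =ᵐ[volume] fun ξ => (χ ξ : ℂ) * f ξ)
    (hg : (g' : Space d → ℂ) =ᵐ[volume] fun ξ => (ψ ξ : ℂ) * g ξ) {C : ℝ} (hC : 0 ≤ C)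
    (hK : ∀ ξ η, |K.toFun ξ η| ≤ C * decayKernel s ξ η * χ (ξ - η) * ψ η) :
    ‖K.op f g‖ ≤ convConst d s * C * ‖f'‖ * ‖g'‖ :=
  K.norm_le_of_weights (τ := fun _ => 1) hχm hψm measurable_const hχ hψ hf hg
    (.of_forall fun ξ => by simp only [Complex.ofReal_one, one_mul]) hC
    (by simpa only [one_mul] using hK)

variable (f g h : L2 d)

lemma integrable_trilinear :
    Integrable (fun p : Space d × Space d =>
      (K.toFun p.1 p.2 : ℂ) * (g (p.1 - p.2) * h p.2) * conj (f p.1)) (volume.prod volume) := by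
  have bilinear_measurable := K.measurable_integrand g h
  have f_measurable := L2.measurable f
  have measurable : Measurable (fun p : Space d × Space d =>
      (K.toFun p.1 p.2 : ℂ) * (g (p.1 - p.2) * h p.2) * conj (f p.1)) :=
    bilinear_measurable.mul
      (Complex.continuous_conj.measurable.comp (f_measurable.comp measurable_fst))
  refine ⟨measurable.aestronglyMeasurable, ?_⟩
  rw [hasFiniteIntegral_iff_enorm, lintegral_prod _ measurable.enorm.aemeasurable]
  have pull_out (ξ : Space d) :
      ∫⁻ η, ‖(K.toFun ξ η : ℂ) * (g (ξ - η) * h η) * conj (f ξ)‖ₑ =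
        (∫⁻ η, ‖(K.toFun ξ η : ℂ) * (g (ξ - η) * h η)‖ₑ) * ‖f ξ‖ₑ := by
    rw [← lintegral_mul_const' _ _ enorm_ne_top]
    simp only [enorm_mul, RCLike.enorm_conj]
  simp_rw [pull_out]
  have cauchy_schwarz := sq_lintegral_mul_le (μ := volume)
    (Measurable.lintegral_prod_right' (ν := volume) bilinear_measurable.enorm).aemeasurable
    f_measurable.enorm.aemeasurable
  have finite := cauchy_schwarz.trans_lt (ENNReal.mul_lt_top
    ((K.lintegral_sq_le g h).trans_lt ENNReal.ofReal_lt_top)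
    ((lintegral_enorm_sq f).trans_lt ENNReal.ofReal_lt_top))
  exact (ENNReal.pow_lt_top_iff.1 finite).resolve_right two_ne_zero

lemma inner_op :
    inner ℂ f (K.op g h) = ∫ ξ, ∫ η, (K.toFun ξ η : ℂ) * (g (ξ - η) * h η) * conj (f ξ) := by
  rw [L2.inner_def]
  refine integral_congr_ae ?_
  filter_upwards [K.coeFn_op g h] with ξ hξ
  rw [RCLike.inner_apply, hξ, kernelConv, integral_mul_const]

lemma inner_op_left_of_hermitian {k : Space d → ℝ} (hk : ∀ ξ η, K.toFun ξ η = k η)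
    (even : ∀ η, k (-η) = k η) (hermitian : ∀ᵐ η, h (-η) = conj (h η)) :
    inner ℂ (K.op g h) f = inner ℂ g (K.op f h) := by
  have reflect (ξ : Space d) :
      ∫ η, conj ((K.toFun ξ η : ℂ) * (g (ξ - η) * h η) * conj (f ξ)) =
        ∫ η, (k η : ℂ) * (conj (g (ξ + η)) * h η) * f ξ := by
    rw [← integral_neg_eq_self]
    refine integral_congr_ae ?_
    filter_upwards [hermitian] with η hη
    simp only [map_mul, Complex.conj_conj, Complex.conj_ofReal, hη, sub_neg_eq_add, hk, even]
  have integrable_reflected : Integrable (fun p : Space d × Space d =>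
      (k p.2 : ℂ) * (conj (g (p.1 + p.2)) * h p.2) * f p.1) (volume.prod volume) := by
    refine ((measurePreserving_add_prod volume volume).integrable_comp_of_integrable
      (K.integrable_trilinear g f h)).congr (.of_forall fun p => ?_)
    simp only [Function.comp, add_sub_cancel_right, hk]
    ring
  have shift (η : Space d) :
      ∫ ξ, (k η : ℂ) * (conj (g (ξ + η)) * h η) * f ξ =
        ∫ ξ, (K.toFun ξ η : ℂ) * (f (ξ - η) * h η) * conj (g ξ) := by
    rw [← integral_sub_right_eq_self (fun ξ => (k η : ℂ) * (conj (g (ξ + η)) * h η) * f ξ) η]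
    refine integral_congr_ae (.of_forall fun ξ => ?_)
    simp only [sub_add_cancel, hk]
    ring
  rw [← inner_conj_symm, K.inner_op, K.inner_op, ← integral_conj]
  simp_rw [← integral_conj, reflect]
  rw [integral_integral_swap integrable_reflected]
  simp_rw [shift]
  exact (integral_integral_swap (K.integrable_trilinear g f h)).symm

/-- The adjoint of a convolution is a correlation. The kernel weights the second argument of
`K.op`, so it has to be divided out of `conjReflect g`, and put on `h`. -/
lemma inner_op_eq_inner_op_corr {k : Space d → ℝ} (hk : ∀ ξ η, K.toFun ξ η = k η) (h₀ g' : L2 d)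
    (hh : (h₀ : Space d → ℂ) =ᵐ[volume] fun η => (k η : ℂ) * h η)
    (hg : ∀ᵐ ζ, (k ζ : ℂ) * g' ζ = conj (g (-ζ))) :
    inner ℂ f (K.op g h) = inner ℂ (K.op f g') h₀ := by
  rw [K.inner_op, integral_integral_swap (K.integrable_trilinear f g h), L2.inner_def]
  refine integral_congr_ae ?_
  filter_upwards [K.coeFn_op f g', hh] with η hη hhη
  rw [RCLike.inner_apply, hη, kernelConv, ← integral_conj, ← integral_const_mul,
    ← integral_sub_left_eq_self _ volume η]
  refine integral_congr_ae ?_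
  filter_upwards [hg] with ζ hζ
  have conj_hζ : (k ζ : ℂ) * conj (g' ζ) = g (-ζ) := by
    simpa only [map_mul, Complex.conj_conj, Complex.conj_ofReal] using congrArg conj hζ
  simp only [sub_sub_cancel_left, hk, hhη, map_mul, Complex.conj_ofReal, ← conj_hζ]
  ring

end SmoothingKernel

/-! ### Fourier multipliers and conjugate reflection on the frequency side -/

/-- The symbol of a bounded Fourier multiplier: a bounded measurable real function. -/
structure Multiplier (d : ℕ) where
  /-- the function -/
  toFun : Space d → ℝ
  measurable : Measurable toFun
  /-- the bound -/
  const : ℝ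
  bound : ∀ ξ, |toFun ξ| ≤ const

namespace Multiplier

variable (χ : Multiplier d) (f : L2 d)

lemma norm_mul_le (ξ : Space d) : ‖(χ.toFun ξ : ℂ) * f ξ‖ ≤ χ.const * ‖f ξ‖ := by
  rw [norm_mul, Complex.norm_real]
  gcongr
  exact χ.bound ξ

lemma memLp : MemLp (fun ξ => (χ.toFun ξ : ℂ) * f ξ) 2 volume := by
  have := χ.measurable
  have := L2.measurable f
  exact (Lp.memLp f).of_le_mul (Measurable.aestronglyMeasurable (by fun_prop))
    (.of_forall (χ.norm_mul_le f))

/-- Multiplication by a bounded function on `L²`. -/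
def op : L2 d →L[ℂ] L2 d :=
  LinearMap.mkContinuous
    { toFun := fun f => (χ.memLp f).toLp _
      map_add' := fun f g => by
        rw [← MemLp.toLp_add, MemLp.toLp_eq_toLp_iff]
        filter_upwards [Lp.coeFn_add f g] with ξ hξ
        rw [hξ, Pi.add_apply, Pi.add_apply, mul_add]
      map_smul' := fun c f => by
        rw [RingHom.id_apply, ← MemLp.toLp_const_smul, MemLp.toLp_eq_toLp_iff]
        filter_upwards [Lp.coeFn_smul c f] with ξ hξ
        rw [hξ, Pi.smul_apply, Pi.smul_apply, mul_smul_comm] }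
    χ.const
    (fun f => by
      refine Lp.norm_le_mul_norm_of_ae_le_mul ?_
      filter_upwards [(χ.memLp f).coeFn_toLp] with ξ hξ
      rw [LinearMap.coe_mk, AddHom.coe_mk, hξ]
      exact χ.norm_mul_le f ξ)

lemma coeFn_op : (χ.op f : Space d → ℂ) =ᵐ[volume] fun ξ => (χ.toFun ξ : ℂ) * f ξ :=
  (χ.memLp f).coeFn_toLp

end Multiplier

lemma memLp_conjReflect (f : L2 d) : MemLp (fun ξ => conj (f (-ξ))) 2 volume :=
  ((Lp.memLp f).comp_measurePreserving (Measure.measurePreserving_neg volume)).star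

/-- The function `ξ ↦ conj (f (-ξ))`, the Fourier transform of the complex conjugate. -/
def conjReflect (f : L2 d) : L2 d := (memLp_conjReflect f).toLp _

lemma coeFn_conjReflect (f : L2 d) :
    (conjReflect f : Space d → ℂ) =ᵐ[volume] fun ξ => conj (f (-ξ)) :=
  (memLp_conjReflect f).coeFn_toLp

lemma ae_comp_neg {p : Space d → Prop} (h : ∀ᵐ ξ, p ξ) : ∀ᵐ ξ, p (-ξ) :=
  (Measure.measurePreserving_neg volume).quasiMeasurePreserving.ae h

lemma conjReflect_sub (f g : L2 d) : conjReflect (f - g) = conjReflect f - conjReflect g := by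
  apply Lp.ext
  filter_upwards [coeFn_conjReflect (f - g), coeFn_conjReflect f, coeFn_conjReflect g,
    Lp.coeFn_sub (conjReflect f) (conjReflect g), ae_comp_neg (Lp.coeFn_sub f g)]
    with ξ hfg hf hg hsub hsub'
  rw [hfg, hsub, Pi.sub_apply, hf, hg, hsub', Pi.sub_apply, map_sub]

lemma norm_conjReflect (f : L2 d) : ‖conjReflect f‖ = ‖f‖ := by
  rw [conjReflect, Lp.norm_toLp, Lp.norm_def, ← eLpNorm_comp_measurePreserving
    (Lp.aestronglyMeasurable f) (Measure.measurePreserving_neg volume)]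
  congr 1
  exact eLpNorm_congr_norm_ae (.of_forall fun ξ => RCLike.norm_conj _)

lemma continuous_conjReflect : Continuous (conjReflect : L2 d → L2 d) :=
  (Isometry.of_dist_eq fun f g => by
    rw [dist_eq_norm, dist_eq_norm, ← conjReflect_sub, norm_conjReflect]).continuous


namespace Multiplier

variable (χ : Multiplier d) (even : ∀ ξ, χ.toFun (-ξ) = χ.toFun ξ)

include even

lemma conjReflect_op_of_even (f : L2 d) : conjReflect (χ.op f) = χ.op (conjReflect f) := by
  apply Lp.ext
  filter_upwards [coeFn_conjReflect (χ.op f), χ.coeFn_op (conjReflect f), coeFn_conjReflect f,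
    ae_comp_neg (χ.coeFn_op f)] with ξ reflect_op op_reflect reflect op_neg
  rw [reflect_op, op_reflect, reflect, op_neg, even, map_mul, Complex.conj_ofReal]

lemma op_neg_of_even {f : L2 d} (hf : ∀ᵐ ξ, f (-ξ) = conj (f ξ)) :
    ∀ᵐ ξ, χ.op f (-ξ) = conj (χ.op f ξ) := by
  filter_upwards [χ.coeFn_op f, ae_comp_neg (χ.coeFn_op f), hf] with ξ op_ξ op_neg hfξ
  rw [op_neg, op_ξ, hfξ, even, map_mul, Complex.conj_ofReal]

end Multiplier

lemma integral_fourierInv_mul_eq {f g : Space d → ℂ} (hf : Integrable f) (hg : Integrable g) :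
    ∫ x, 𝓕⁻ f x * g x = ∫ x, f x * 𝓕⁻ g x := by
  have fourier_self_adjoint := VectorFourier.integral_fourierIntegral_smul_eq_flip
    (μ := (volume : Measure (Space d))) (ν := (volume : Measure (Space d)))
    (L := innerₗ (Space d)) Real.continuous_fourierChar continuous_inner hf.comp_neg hg
  have left_eq (x : Space d) : VectorFourier.fourierIntegral Real.fourierChar volume
      (innerₗ (Space d)) (fun x => f (-x)) x = 𝓕⁻ f x := by
    rw [Real.fourierInv_eq_fourier_comp_neg]; rfl
  have right_eq (x : Space d) : VectorFourier.fourierIntegral Real.fourierChar volume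
      (innerₗ (Space d)).flip g x = 𝓕⁻ g (-x) := by
    rw [Real.fourierInv_eq_fourier_neg, neg_neg, flip_innerₗ]; rfl
  simp only [left_eq, right_eq, smul_eq_mul] at fourier_self_adjoint
  rw [fourier_self_adjoint, ← integral_neg_eq_self]
  simp only [neg_neg]

lemma continuous_fourierInv {f : Space d → ℂ} (hf : Integrable f) : Continuous (𝓕⁻ f) := by
  rw [Real.fourierInv_eq_fourier_comp_neg]
  exact VectorFourier.fourierIntegral_continuous Real.continuous_fourierChar
    (by exact continuous_inner) hf.comp_neg

-- Both sides define the same tempered distribution.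
lemma coeFn_fourierInv_ae_eq (g : L2 d) (hg : Integrable (g : Space d → ℂ)) :
    ((𝓕⁻ g : L2 d) : Space d → ℂ) =ᵐ[volume] 𝓕⁻ (g : Space d → ℂ) := by
  have hc := continuous_fourierInv hg
  suffices tested : ∀ φ : Space d → ℝ, ContDiff ℝ ∞ φ → HasCompactSupport φ →
      ∫ x, φ x • ((𝓕⁻ g : L2 d) x - 𝓕⁻ (g : Space d → ℂ) x) = 0 by
    filter_upwards [ae_eq_zero_of_integral_contDiff_smul_eq_zero
      (((Lp.memLp (𝓕⁻ g : L2 d)).locallyIntegrable (by norm_num)).sub hc.locallyIntegrable)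
      tested] with x hx
    exact sub_eq_zero.1 hx
  intro φ hφ hφc
  have compact_support : HasCompactSupport (Complex.ofRealCLM ∘ φ) := hφc.comp_left rfl
  have smooth : ContDiff ℝ ∞ (Complex.ofRealCLM ∘ φ) := by fun_prop
  let Φ := compact_support.toSchwartzMap smooth
  have Φ_apply (x : Space d) : Φ x = (φ x : ℂ) := rfl
  have distributional : ∫ x, Φ x • (𝓕⁻ g : L2 d) x = ∫ x, (𝓕⁻ Φ) x • g x := by
    rw [← Lp.toTemperedDistribution_apply, ← Lp.toTemperedDistribution_apply,
      ← Lp.fourierInv_toTemperedDistribution_eq, TemperedDistribution.fourierInv_apply]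
  have pointwise : ∫ x, (𝓕⁻ Φ) x • g x = ∫ x, Φ x • 𝓕⁻ (g : Space d → ℂ) x := by
    simpa only [smul_eq_mul, SchwartzMap.fourierInv_coe] using
      integral_fourierInv_mul_eq Φ.integrable hg
  have integrable_distributional : Integrable (fun x => Φ x • (𝓕⁻ g : L2 d) x) :=
    (Φ.memLp 2 volume).integrable_mul (Lp.memLp (𝓕⁻ g : L2 d))
  have integrable_pointwise : Integrable (fun x => Φ x • 𝓕⁻ (g : Space d → ℂ) x) :=
    Continuous.integrable_of_hasCompactSupport (by fun_prop) compact_support.smul_right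
  have split (x : Space d) : φ x • ((𝓕⁻ g : L2 d) x - 𝓕⁻ (g : Space d → ℂ) x) =
      Φ x • (𝓕⁻ g : L2 d) x - Φ x • 𝓕⁻ (g : Space d → ℂ) x := by
    rw [Φ_apply, ← smul_sub, Complex.real_smul, smul_eq_mul]
  simp_rw [split]
  rw [integral_sub integrable_distributional integrable_pointwise, distributional, pointwise,
    sub_self]

lemma eq_fourierInv_of_continuous {f : Space d → ℂ} (hc : Continuous f) (hf : MemLp f 2 volume)
    (hi : Integrable ((𝓕 (hf.toLp f) : L2 d) : Space d → ℂ)) :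
    f = 𝓕⁻ ((𝓕 (hf.toLp f) : L2 d) : Space d → ℂ) := by
  refine (Continuous.ae_eq_iff_eq volume hc (continuous_fourierInv hi)).1 ?_
  have inversion := coeFn_fourierInv_ae_eq _ hi
  rw [FourierTransform.fourierInv_fourier_eq] at inversion
  exact (MemLp.coeFn_toLp hf).symm.trans inversion

lemma eq_zero_of_fourierInv_eq_zero (h : L2 d) (hi : Integrable (h : Space d → ℂ))
    (h0 : ∀ x, 𝓕⁻ (h : Space d → ℂ) x = 0) : h = 0 := by
  have fourierInv_eq_zero : (𝓕⁻ h : L2 d) = 0 := by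
    apply Lp.ext
    filter_upwards [coeFn_fourierInv_ae_eq h hi, Lp.coeFn_zero ℂ 2 (volume : Measure (Space d))]
      with x hx zero_apply
    rw [hx, h0, zero_apply, Pi.zero_apply]
  have inversion : (𝓕 (𝓕⁻ h : L2 d) : L2 d) = h := FourierTransform.fourier_fourierInv_eq h
  rw [← inversion, fourierInv_eq_zero]
  exact (Lp.fourierTransformₗᵢ (Space d) ℂ).map_zero

lemma fourierInv_mul_eq {f g : Space d → ℂ} (hf : Integrable f) (hg : Integrable g) (x : Space d) :
    𝓕⁻ f x * 𝓕⁻ g x = 𝓕⁻ (kernelConv (fun _ _ => 1) f g) x := by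
  rw [Real.fourierInv_eq_fourier_neg, Real.fourierInv_eq_fourier_neg,
    Real.fourierInv_eq_fourier_neg, mul_comm, ← Real.fourier_mul_convolution_eq hg hf]
  refine congrArg (fun F : Space d → ℂ => 𝓕 F (-x)) (funext fun ξ => ?_)
  simp only [convolution, kernelConv, ContinuousLinearMap.mul_apply']
  congr 1
  ext η
  push_cast
  ring

lemma conj_fourierInv (f : Space d → ℂ) (x : Space d) :
    conj (𝓕⁻ f x) = 𝓕⁻ (fun ξ => conj (f (-ξ))) x := by
  rw [Real.fourierInv_eq', Real.fourierInv_eq', ← integral_conj, ← integral_neg_eq_self]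
  congr 1
  ext ξ
  simp only [smul_eq_mul, map_mul, ← Complex.exp_conj, inner_neg_left]
  congr 2
  simp [Complex.conj_ofNat]

lemma integrable_pow_mul {f : Space d → ℂ} (hf : AEStronglyMeasurable f volume)
    (hi : Integrable (fun ξ => ((bracket ξ : ℂ) ^ 2) * f ξ)) {n : ℕ} (hn : n ≤ 2) :
    Integrable (fun ξ => ‖ξ‖ ^ n * ‖f ξ‖) := by
  refine hi.norm.mono' (by fun_prop) (Eventually.of_forall fun ξ => ?_)
  have norm_le : ‖ξ‖ ≤ bracket ξ := by
    refine le_trans ?_ (norm_le_bracket ξ)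
    rw [norm_smul, Real.norm_of_nonneg (by positivity)]
    nlinarith [Real.pi_gt_three, norm_nonneg ξ]
  have pow_le : ‖ξ‖ ^ n ≤ bracket ξ ^ 2 :=
    (pow_le_pow_left₀ (norm_nonneg _) norm_le n).trans
      (pow_le_pow_right₀ (one_le_bracket ξ) hn)
  rw [norm_mul, norm_mul, norm_pow, norm_norm, norm_norm, norm_pow, Complex.norm_real,
    Real.norm_of_nonneg (bracket_pos ξ).le]
  gcongr

lemma sum_inner_basisFun_sq_smul (ξ : Space d) (z : ℂ) :
    (-(2 * Real.pi * Complex.I)) ^ 2 • ∑ i : Fin d,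
        (inner ℝ ξ (EuclideanSpace.basisFun (Fin d) ℝ i) *
          inner ℝ ξ (EuclideanSpace.basisFun (Fin d) ℝ i)) • z =
      (1 - (bracket ξ : ℂ) ^ 2) * z := by
  have sum_sq : ∑ i, inner ℝ ξ (EuclideanSpace.basisFun (Fin d) ℝ i) *
      inner ℝ ξ (EuclideanSpace.basisFun (Fin d) ℝ i) = ‖ξ‖ ^ 2 := by
    rw [EuclideanSpace.norm_sq_eq]
    simp [EuclideanSpace.inner_single_right, sq]
  have symbol : (bracket ξ : ℂ) ^ 2 = 1 + (2 * Real.pi) ^ 2 * ‖ξ‖ ^ 2 := by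
    have := bracket_sq ξ
    rw [norm_smul, Real.norm_of_nonneg (by positivity), mul_pow] at this
    exact_mod_cast this
  rw [← Finset.sum_smul, sum_sq, symbol, Complex.real_smul, smul_eq_mul, neg_sq, mul_pow,
    Complex.I_sq]
  push_cast
  ring

lemma laplacian_fourier {h : Space d → ℂ} (hm : AEStronglyMeasurable h volume)
    (hi : Integrable (fun ξ => ((bracket ξ : ℂ) ^ 2) * h ξ)) (x : Space d) :
    Δ (𝓕 h) x = 𝓕 (fun ξ => (1 - (bracket ξ : ℂ) ^ 2) * h ξ : Space d → ℂ) x := by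
  have moments (n : ℕ) (hn : (n : ℕ∞) ≤ (2 : ℕ∞)) : Integrable (fun v => ‖v‖ ^ n * ‖h v‖) :=
    integrable_pow_mul hm hi (by exact_mod_cast hn)
  have integrable_hessian := VectorFourier.integrable_fourierPowSMulRight
    (μ := (volume : Measure (Space d))) (innerSL ℝ) (moments 2 le_rfl) hm
  rw [InnerProductSpace.laplacian_eq_iteratedFDeriv_orthonormalBasis _
    (EuclideanSpace.basisFun (Fin d) ℝ),
    Real.iteratedFDeriv_fourier (N := 2) moments hm (n := 2) (by norm_num)]
  simp_rw [Real.fourier_continuousMultilinearMap_apply integrable_hessian]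
  simp only [Real.fourier_eq]
  rw [← integral_finsetSum]
  · refine integral_congr_ae (Eventually.of_forall fun ξ => ?_)
    simp only [← Finset.smul_sum, VectorFourier.fourierPowSMulRight_apply, Fin.prod_univ_two,
      Matrix.cons_val_zero, Matrix.cons_val_one, Matrix.cons_val_fin_one]
    exact congrArg _ (sum_inner_basisFun_sq_smul ξ (h ξ))
  · intro i _
    rw [Real.fourierIntegral_convergent_iff]
    exact ContinuousLinearMap.integrable_comp
      (ContinuousMultilinearMap.apply ℝ (fun _ : Fin 2 => Space d) ℂ _) integrable_hessian

lemma laplacian_fourierInv {f : Space d → ℂ} (hf : AEStronglyMeasurable f volume)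
    (hi : Integrable (fun ξ => ((bracket ξ : ℂ) ^ 2) * f ξ)) (x : Space d) :
    Δ (𝓕⁻ f) x = 𝓕⁻ (fun ξ => (1 - (bracket ξ : ℂ) ^ 2) * f ξ : Space d → ℂ) x := by
  rw [Real.fourierInv_eq_fourier_comp_neg, Real.fourierInv_eq_fourier_comp_neg,
    laplacian_fourier (h := fun ξ => f (-ξ))
      (hf.comp_measurePreserving (Measure.measurePreserving_neg volume))
      (by simpa only [bracket_neg] using hi.comp_neg)]
  simp only [bracket_neg]

lemma integrable_fourierChar_smul {f : Space d → ℂ} (hf : Integrable f) (x : Space d) :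
    Integrable (fun ξ => Real.fourierChar (inner ℝ ξ x) • f ξ) := by
  simpa only [inner_neg_right, neg_neg, innerₗ_apply_apply] using
    (Real.fourierIntegral_convergent_iff (-x)).2 hf

lemma fourierInv_add {f g : L2 d} (hf : Integrable (f : Space d → ℂ))
    (hg : Integrable (g : Space d → ℂ)) (x : Space d) :
    𝓕⁻ ((f + g : L2 d) : Space d → ℂ) x =
      𝓕⁻ (f : Space d → ℂ) x + 𝓕⁻ (g : Space d → ℂ) x := by
  rw [Real.fourierInv_eq, Real.fourierInv_eq, Real.fourierInv_eq,
    ← integral_add (integrable_fourierChar_smul hf x) (integrable_fourierChar_smul hg x)]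
  refine integral_congr_ae ?_
  filter_upwards [Lp.coeFn_add f g] with ξ hξ
  rw [hξ, Pi.add_apply, smul_add]

lemma fourierInv_sub {f g : L2 d} (hf : Integrable (f : Space d → ℂ))
    (hg : Integrable (g : Space d → ℂ)) (x : Space d) :
    𝓕⁻ ((f - g : L2 d) : Space d → ℂ) x =
      𝓕⁻ (f : Space d → ℂ) x - 𝓕⁻ (g : Space d → ℂ) x := by
  rw [Real.fourierInv_eq, Real.fourierInv_eq, Real.fourierInv_eq,
    ← integral_sub (integrable_fourierChar_smul hf x) (integrable_fourierChar_smul hg x)]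
  refine integral_congr_ae ?_
  filter_upwards [Lp.coeFn_sub f g] with ξ hξ
  rw [hξ, Pi.sub_apply, smul_sub]

lemma fourierInv_smul (c : ℂ) (f : L2 d) (x : Space d) :
    𝓕⁻ ((c • f : L2 d) : Space d → ℂ) x = c * 𝓕⁻ (f : Space d → ℂ) x := by
  rw [Real.fourierInv_eq, Real.fourierInv_eq, ← integral_const_mul]
  refine integral_congr_ae ?_
  filter_upwards [Lp.coeFn_smul c f] with ξ hξ
  rw [hξ, Pi.smul_apply, smul_eq_mul, Circle.smul_def, Circle.smul_def, smul_eq_mul, smul_eq_mul]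
  ring

lemma fourierInv_neg (f : L2 d) (x : Space d) :
    𝓕⁻ ((-f : L2 d) : Space d → ℂ) x = -𝓕⁻ (f : Space d → ℂ) x := by
  rw [← neg_one_smul ℂ f, fourierInv_smul, neg_one_mul]

/-- A family of curves in `L²` of the frequency space with `a k t = ⟨ξ⟩^k a 0 t`. -/
def IsScale (a : ℕ → ℝ → L2 d) : Prop :=
  ∀ k t, (a k t : Space d → ℂ) =ᵐ[volume] fun ξ => (bracket ξ : ℂ) ^ k * a 0 t ξ

lemma ofReal_bracket_ne_zero (ξ : Space d) : (bracket ξ : ℂ) ≠ 0 :=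
  Complex.ofReal_ne_zero.2 (bracket_ne_zero ξ)

lemma IsScale.ae_eq {a : ℕ → ℝ → L2 d} (ha : IsScale a) (j k : ℕ) (t : ℝ) :
    (a (j + k) t : Space d → ℂ) =ᵐ[volume] fun ξ => (bracket ξ : ℂ) ^ k * a j t ξ := by
  filter_upwards [ha (j + k) t, ha j t] with ξ high low
  rw [high, low]; ring

lemma IsScale.conjReflect {a : ℕ → ℝ → L2 d} (ha : IsScale a) :
    IsScale (fun k t => conjReflect (a k t)) := by
  intro k t
  filter_upwards [coeFn_conjReflect (a k t), coeFn_conjReflect (a 0 t), ae_comp_neg (ha k t)]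
    with ξ reflect_k reflect_0 hk
  rw [reflect_k, reflect_0, hk, bracket_neg, map_mul, map_pow, Complex.conj_ofReal]

/-- Multiplication by `⟨ξ⟩^{-k}`. -/
def bracketInv (d k : ℕ) : Multiplier d where
  toFun ξ := (bracket ξ ^ k)⁻¹
  measurable := by fun_prop
  const := 1
  bound ξ := by
    rw [abs_of_pos (inv_pos.2 (pow_pos (bracket_pos ξ) k))]
    exact inv_le_one_of_one_le₀ (one_le_pow₀ (one_le_bracket ξ))

lemma coeFn_bracketInv_op (k : ℕ) (f : L2 d) :
    ((bracketInv d k).op f : Space d → ℂ) =ᵐ[volume] fun ξ => ((bracket ξ : ℂ) ^ k)⁻¹ * f ξ := by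
  filter_upwards [(bracketInv d k).coeFn_op f] with ξ hξ
  rw [hξ, bracketInv]
  push_cast
  rfl

lemma eq_zero_of_bracketInv_op_eq_zero {k : ℕ} {f : L2 d} (h : (bracketInv d k).op f = 0) :
    f = 0 := by
  have product_eq_zero := coeFn_bracketInv_op k f
  rw [h] at product_eq_zero
  apply Lp.ext
  filter_upwards [product_eq_zero, Lp.coeFn_zero ℂ 2 (volume : Measure (Space d))] with ξ hξ hzero
  rw [hzero, Pi.zero_apply, eq_comm, mul_eq_zero] at hξ
  rw [hzero, Pi.zero_apply]
  exact hξ.resolve_left (inv_ne_zero (pow_ne_zero _ (ofReal_bracket_ne_zero ξ)))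

lemma IsScale.bracketInv_op {a : ℕ → ℝ → L2 d} (ha : IsScale a) (j k : ℕ) (t : ℝ) :
    (bracketInv d k).op (a (j + k) t) = a j t := by
  apply Lp.ext
  filter_upwards [coeFn_bracketInv_op k (a (j + k) t), ha.ae_eq j k t] with ξ hop hscale
  rw [hop, hscale, inv_mul_cancel_left₀ (pow_ne_zero _ (ofReal_bracket_ne_zero ξ))]

lemma memLp_bracket_inv_sq (hd : d ≤ 3) :
    MemLp (fun ξ : Space d => ((bracket ξ : ℂ) ^ 2)⁻¹) 2 volume := by
  have measurable : Measurable (fun ξ : Space d => ((bracket ξ : ℂ) ^ 2)⁻¹) := by fun_prop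
  refine ⟨measurable.aestronglyMeasurable, ?_⟩
  have subcritical : (d : ℝ) < 2 * 2 := by
    have : (d : ℝ) ≤ 3 := by exact_mod_cast hd
    linarith
  have eLpNorm_sq :
      eLpNorm (fun ξ : Space d => ((bracket ξ : ℂ) ^ 2)⁻¹) 2 volume ^ 2 = decayConst d 2 := by
    rw [eLpNorm_two_sq, decayConst]
    refine lintegral_congr fun ξ => ?_
    rw [← ofReal_norm]
    congr 2
    rw [norm_inv, norm_pow, Complex.norm_real, Real.norm_of_nonneg (bracket_pos ξ).le,
      Real.rpow_neg (bracket_pos ξ).le, Real.rpow_two]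
  have finite := decayConst_lt_top (d := d) subcritical
  rw [← eLpNorm_sq] at finite
  exact (ENNReal.pow_lt_top_iff.1 finite).resolve_right two_ne_zero

lemma integrable_bracket_inv_sq_mul (hd : d ≤ 3) (f : L2 d) :
    Integrable (fun ξ => ((bracket ξ : ℂ) ^ 2)⁻¹ * f ξ) :=
  (memLp_bracket_inv_sq hd).integrable_mul (Lp.memLp f)

lemma IsScale.integrable {a : ℕ → ℝ → L2 d} (ha : IsScale a) (hd : d ≤ 3) (k : ℕ) (t : ℝ) :
    Integrable (a k t : Space d → ℂ) := by
  refine (integrable_bracket_inv_sq_mul hd (a (k + 2) t)).congr ?_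
  filter_upwards [ha.ae_eq k 2 t] with ξ hξ
  rw [hξ, inv_mul_cancel_left₀ (pow_ne_zero _ (ofReal_bracket_ne_zero ξ))]

lemma memLp_fourierChar_mul_bracket_inv_sq (hd : d ≤ 3) (x : Space d) :
    MemLp (fun ξ : Space d => (Real.fourierChar (-inner ℝ ξ x) : ℂ) * ((bracket ξ : ℂ) ^ 2)⁻¹) 2
      volume := by
  refine (memLp_bracket_inv_sq hd).of_le ?_ (Eventually.of_forall fun ξ => ?_)
  · refine Continuous.aestronglyMeasurable (Continuous.mul ?_ ?_)
    · exact continuous_subtype_val.comp (Real.continuous_fourierChar.comp (by fun_prop))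
    · exact Continuous.inv₀ (by fun_prop) fun ξ => pow_ne_zero _ (ofReal_bracket_ne_zero ξ)
  · rw [norm_mul, Circle.norm_coe, one_mul]

/-- The functional `f ↦ (⟨D⟩^{-2} f^∨)(x)` on `L²` of the frequency space. -/
def evalFun (hd : d ≤ 3) (x : Space d) : L2 d →L[ℂ] ℂ :=
  innerSL ℂ ((memLp_fourierChar_mul_bracket_inv_sq hd x).toLp _)

lemma evalFun_apply (hd : d ≤ 3) (x : Space d) (f : L2 d) :
    evalFun hd x f = 𝓕⁻ (fun ξ => ((bracket ξ : ℂ) ^ 2)⁻¹ * f ξ : Space d → ℂ) x := by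
  rw [evalFun, innerSL_apply_apply, L2.inner_def, Real.fourierInv_eq]
  refine integral_congr_ae ?_
  filter_upwards [MemLp.coeFn_toLp (memLp_fourierChar_mul_bracket_inv_sq hd x)] with ξ hξ
  rw [RCLike.inner_apply, hξ, Circle.smul_def]
  simp only [map_mul, map_inv₀, map_pow, AddChar.map_neg_eq_inv, smul_eq_mul]
  rw [Circle.coe_inv_eq_conj, Complex.conj_conj, Complex.conj_ofReal]
  ring

lemma eq_zero_of_evalFun_eq_zero (hd : d ≤ 3) (f : L2 d) (h : ∀ x, evalFun hd x f = 0) :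
    f = 0 := by
  refine eq_zero_of_bracketInv_op_eq_zero (k := 2) (eq_zero_of_fourierInv_eq_zero _
    ((integrable_bracket_inv_sq_mul hd f).congr (coeFn_bracketInv_op 2 f).symm) fun x => ?_)
  rw [← h x, evalFun_apply]
  exact Real.fourierInv_congr_ae (coeFn_bracketInv_op 2 f) x

lemma IsScale.evalFun_comp_bracketInv {c : ℕ → ℝ → L2 d} (hc : IsScale c) (hd : d ≤ 3) (k : ℕ)
    (x : Space d) (τ : ℝ) :
    (evalFun hd x ∘L (bracketInv d k).op) (c (k + 2) τ) = 𝓕⁻ (c 0 τ : Space d → ℂ) x := by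
  rw [ContinuousLinearMap.comp_apply, add_comm k 2, hc.bracketInv_op 2 k τ, evalFun_apply]
  refine Real.fourierInv_congr_ae ?_ x
  filter_upwards [hc 2 τ] with ξ hξ
  rw [hξ, inv_mul_cancel_left₀ (pow_ne_zero _ (ofReal_bracket_ne_zero ξ))]

-- The functionals identify `f` with a primitive of `g`, up to a constant.
lemma hasDerivAt_of_separating {ι F : Type*} [NormedAddCommGroup F] [NormedSpace ℂ F]
    [CompleteSpace F] (l : ι → F →L[ℂ] ℂ) (hl : ∀ f, (∀ i, l i f = 0) → f = 0) {f g : ℝ → F}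
    (hg : Continuous g) (h : ∀ i t, HasDerivAt (fun τ => l i (f τ)) (l i (g t)) t) (t : ℝ) :
    HasDerivAt f (g t) t := by
  have primitive (t : ℝ) : HasDerivAt (fun τ => ∫ r in (0 : ℝ)..τ, g r) (g t) t :=
    intervalIntegral.integral_hasDerivAt_right (hg.intervalIntegrable _ _)
      (hg.stronglyMeasurableAtFilter _ _) hg.continuousAt
  have eq_primitive (t : ℝ) : f t = (∫ r in (0 : ℝ)..t, g r) + f 0 := by
    rw [← sub_eq_zero]
    refine hl _ fun i => ?_
    have deriv_eq_zero (τ : ℝ) :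
        HasDerivAt (fun τ => l i (f τ) - l i (∫ r in (0 : ℝ)..τ, g r)) 0 τ := by
      rw [← sub_self (l i (g τ))]
      exact (h i τ).sub
        (((l i).restrictScalars ℝ).hasFDerivAt.comp_hasDerivAt τ (primitive τ))
    have constant := is_const_of_deriv_eq_zero (fun τ => (deriv_eq_zero τ).differentiableAt)
      (fun τ => (deriv_eq_zero τ).deriv) t 0
    simp only [intervalIntegral.integral_same, map_zero, sub_zero] at constant
    rw [map_sub, map_add, ← constant]
    ring
  exact ((primitive t).add_const (f 0)).congr_of_eventuallyEq (Eventually.of_forall eq_primitive)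

lemma hasDerivAt_of_fourierInv (hd : d ≤ 3) {a g : ℕ → ℝ → L2 d} (ha : IsScale a)
    (hg : IsScale g) (hgc : ∀ k, Continuous (g k))
    (h : ∀ t x, HasDerivAt (fun τ => 𝓕⁻ (a 0 τ : Space d → ℂ) x) (𝓕⁻ (g 0 t : Space d → ℂ) x) t)
    (k : ℕ) (t : ℝ) : HasDerivAt (a k) (g k t) t := by
  have deriv_high : HasDerivAt (a (k + 2)) (g (k + 2) t) t := by
    refine hasDerivAt_of_separating (fun x => evalFun hd x ∘L (bracketInv d k).op) ?_ (hgc _) ?_ t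
    · exact fun f hf => eq_zero_of_bracketInv_op_eq_zero (eq_zero_of_evalFun_eq_zero hd _ hf)
    · intro x τ
      simp only [ha.evalFun_comp_bracketInv hd, hg.evalFun_comp_bracketInv hd]
      exact h τ x
  have deriv_low :=
    (((bracketInv d 2).op).restrictScalars ℝ).hasFDerivAt.comp_hasDerivAt t deriv_high
  rw [← hg.bracketInv_op k 2 t]
  exact deriv_low.congr_of_eventuallyEq
    (Eventually.of_forall fun τ => (ha.bracketInv_op k 2 τ).symm)

/-- The weighted curves `a k t = ⟨ξ⟩^k û(t)` of a continuous curve in every Sobolev space. -/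
structure IsProfile (f : ℝ → Space d → ℂ) (a : ℕ → ℝ → L2 d) : Prop where
  scale : IsScale a
  continuous : ∀ k, Continuous (a k)
  fourier : ∀ t, ∃ hf : MemLp (f t) 2 volume, a 0 t = 𝓕 (hf.toLp (f t))

lemma gevreySymbol_zero_nat (k : ℕ) (ξ : Space d) :
    gevreySymbol 0 k ((2 * Real.pi) • ξ) = bracket ξ ^ k := by
  simp [gevreySymbol, bracket]

lemma gevreyNorm_zero_nat (k : ℕ) {f : Space d → ℂ} (hf : MemLp f 2 volume) :
    gevreyNorm 0 k f = eLpNorm (fun ξ => (bracket ξ : ℂ) ^ k * (𝓕 (hf.toLp f) : L2 d) ξ) 2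
      volume := by
  rw [gevreyNorm, dif_pos hf]
  simp_rw [gevreySymbol_zero_nat]
  push_cast
  rfl

lemma MemGevrey.memLp {σ r : ℝ} {f : Space d → ℂ} (h : MemGevrey σ r f) : MemLp f 2 volume := by
  by_contra not_memLp
  rw [MemGevrey, gevreyNorm, dif_neg not_memLp] at h
  exact lt_irrefl _ h

lemma MemGevrey.memLp_bracket_pow_mul {k : ℕ} {f : Space d → ℂ} (h : MemGevrey 0 k f)
    (hf : MemLp f 2 volume) :
    MemLp (fun ξ => (bracket ξ : ℂ) ^ k * (𝓕 (hf.toLp f) : L2 d) ξ) 2 volume := by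
  rw [MemGevrey, gevreyNorm_zero_nat k hf] at h
  have := L2.measurable (𝓕 (hf.toLp f) : L2 d)
  exact ⟨Measurable.aestronglyMeasurable (by fun_prop), h⟩

lemma gevreyNorm_zero_sub {k : ℕ} {f g : Space d → ℂ} (hf : MemLp f 2 volume)
    (hg : MemLp g 2 volume)
    (hf' : MemLp (fun ξ => (bracket ξ : ℂ) ^ k * (𝓕 (hf.toLp f) : L2 d) ξ) 2 volume)
    (hg' : MemLp (fun ξ => (bracket ξ : ℂ) ^ k * (𝓕 (hg.toLp g) : L2 d) ξ) 2 volume) :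
    gevreyNorm 0 k (f - g) = ENNReal.ofReal ‖hf'.toLp _ - hg'.toLp _‖ := by
  rw [gevreyNorm_zero_nat k (hf.sub hg), ← MemLp.toLp_sub, Lp.norm_toLp,
    ENNReal.ofReal_toReal (hf'.sub hg').2.ne]
  have fourier_sub : (𝓕 ((hf.sub hg).toLp (f - g)) : L2 d) = 𝓕 (hf.toLp f) - 𝓕 (hg.toLp g) := by
    rw [MemLp.toLp_sub]
    exact (Lp.fourierTransformₗᵢ (Space d) ℂ).map_sub _ _
  have coeFn_sub := Lp.coeFn_sub (𝓕 (hf.toLp f) : L2 d) (𝓕 (hg.toLp g) : L2 d)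
  rw [← fourier_sub] at coeFn_sub
  refine eLpNorm_congr_ae ?_
  filter_upwards [coeFn_sub] with ξ hξ
  rw [hξ, Pi.sub_apply, Pi.sub_apply, mul_sub]

lemma exists_isProfile {f : ℝ → Space d → ℂ} (h : ∀ k : ℕ, ContinuousInSobolev k f) :
    ∃ a, IsProfile f a := by
  have hf (t : ℝ) : MemLp (f t) 2 volume := ((h 0).1 t).memLp
  have weighted_memLp (k : ℕ) (t : ℝ) := ((h k).1 t).memLp_bracket_pow_mul (hf t)
  have weighted_zero (t : ℝ) : (weighted_memLp 0 t).toLp _ = 𝓕 ((hf t).toLp (f t)) := by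
    apply Lp.ext
    filter_upwards [MemLp.coeFn_toLp (weighted_memLp 0 t)] with ξ hξ
    rw [hξ, pow_zero, one_mul]
  refine ⟨fun k t => (weighted_memLp k t).toLp _, ?_, ?_, fun t => ⟨hf t, weighted_zero t⟩⟩
  · intro k t
    simp only [weighted_zero]
    exact MemLp.coeFn_toLp (weighted_memLp k t)
  · intro k
    rw [continuous_iff_continuousAt]
    intro t₀
    rw [ContinuousAt, tendsto_iff_norm_sub_tendsto_zero]
    have norm_eq (t : ℝ) : gevreyNorm 0 k (fun x => f t x - f t₀ x) = _ :=
      gevreyNorm_zero_sub (hf t) (hf t₀) (weighted_memLp k t) (weighted_memLp k t₀)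
    have tendsto_norm := (h k).2 t₀
    simp only [norm_eq] at tendsto_norm
    simpa [Function.comp_def] using
      (ENNReal.tendsto_toReal ENNReal.zero_ne_top).comp tendsto_norm

lemma IsProfile.eq_fourierInv {f : ℝ → Space d → ℂ} {a : ℕ → ℝ → L2 d} (h : IsProfile f a)
    (hd : d ≤ 3) {t : ℝ} (hc : Continuous (f t)) : f t = 𝓕⁻ (a 0 t : Space d → ℂ) := by
  obtain ⟨hf, transform_eq⟩ := h.fourier t
  have hi := h.scale.integrable hd 0 t
  rw [transform_eq] at hi ⊢
  exact eq_fourierInv_of_continuous hc hf hi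

lemma IsProfile.laplacian {f : ℝ → Space d → ℂ} {a : ℕ → ℝ → L2 d} (h : IsProfile f a)
    (hd : d ≤ 3) {t : ℝ} (hc : Continuous (f t)) (x : Space d) :
    Δ (f t) x = 𝓕⁻ (a 0 t : Space d → ℂ) x - 𝓕⁻ (a 2 t : Space d → ℂ) x := by
  conv_lhs => rw [h.eq_fourierInv hd hc]
  rw [laplacian_fourierInv (Lp.aestronglyMeasurable _)
      ((h.scale.integrable hd 2 t).congr (h.scale 2 t)),
    ← fourierInv_sub (h.scale.integrable hd 0 t) (h.scale.integrable hd 2 t)]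
  refine Real.fourierInv_congr_ae ?_ x
  filter_upwards [h.scale 2 t, Lp.coeFn_sub (a 0 t) (a 2 t)] with ξ hξ hsub
  rw [hsub, Pi.sub_apply, hξ]
  ring

/-- The kernel by which `⟨D⟩^k (f g)` is computed from `⟨D⟩^k f` and `⟨D⟩^{k+2} g`. -/
def prodKernel (hd : d ≤ 3) (k : ℕ) : SmoothingKernel d 2 where
  toFun ξ η := bracket ξ ^ k * ((bracket (ξ - η) ^ k)⁻¹ * (bracket η ^ (k + 2))⁻¹)
  measurable := by fun_prop
  const := 2 ^ k
  const_nonneg := by positivity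
  bound ξ η := by
    have difference_pos := bracket_pos (ξ - η)
    have η_pos := bracket_pos η
    have ξ_pos := bracket_pos ξ
    have bracket_le : bracket ξ ≤ 2 * (bracket (ξ - η) * bracket η) := by
      nlinarith [bracket_le_add ξ η, one_le_bracket (ξ - η), one_le_bracket η]
    have kernel_ge : (bracket η ^ 2)⁻¹ ≤ decayKernel 2 ξ η := by
      rw [← Real.rpow_two, ← Real.rpow_neg η_pos.le]
      exact le_add_of_nonneg_left (Real.rpow_nonneg difference_pos.le _)
    rw [abs_of_pos (by positivity)]
    calc bracket ξ ^ k * ((bracket (ξ - η) ^ k)⁻¹ * (bracket η ^ (k + 2))⁻¹)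
        ≤ (2 * (bracket (ξ - η) * bracket η)) ^ k *
            ((bracket (ξ - η) ^ k)⁻¹ * (bracket η ^ (k + 2))⁻¹) := by gcongr
      _ = 2 ^ k * (bracket η ^ 2)⁻¹ := by
          rw [mul_pow, mul_pow, pow_add]
          field_simp
      _ ≤ 2 ^ k * decayKernel 2 ξ η := by gcongr
  decay := by
    have : (d : ℝ) ≤ 3 := by exact_mod_cast hd
    linarith

lemma isScale_prodKernel (hd : d ≤ 3) {a b : ℕ → ℝ → L2 d} (ha : IsScale a) (hb : IsScale b) :
    IsScale (fun k t => (prodKernel hd k).op (a k t) (b (k + 2) t)) := by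
  intro k t
  filter_upwards [(prodKernel hd k).coeFn_op (a k t) (b (k + 2) t),
    (prodKernel hd 0).coeFn_op (a 0 t) (b (0 + 2) t)] with ξ op_k op_0
  rw [op_k, op_0, ← Complex.ofReal_pow]
  refine (mul_kernelConv_congr (χ := fun ξ => bracket ξ ^ k) (ψ := fun ξ => bracket ξ ^ k) ?_ ?_
    fun η => ?_).symm
  · simpa only [Complex.ofReal_pow] using ha k t
  · simpa only [Complex.ofReal_pow, zero_add, add_comm 2 k] using hb.ae_eq 2 k t
  · simp only [prodKernel]
    have := bracket_ne_zero (ξ - η)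
    have := bracket_ne_zero η
    field_simp
    ring

lemma continuous_prodKernel (hd : d ≤ 3) (k : ℕ) {f g : ℝ → L2 d} (hf : Continuous f)
    (hg : Continuous g) : Continuous (fun t => (prodKernel hd k).op (f t) (g t)) :=
  ((prodKernel hd k).op.continuous.comp hf).clm_apply hg

lemma fourierInv_prodKernel (hd : d ≤ 3) {a b : ℕ → ℝ → L2 d} (ha : IsScale a) (hb : IsScale b)
    (t : ℝ) (x : Space d) :
    𝓕⁻ ((prodKernel hd 0).op (a 0 t) (b 2 t) : Space d → ℂ) x =
      𝓕⁻ (a 0 t : Space d → ℂ) x * 𝓕⁻ (b 0 t : Space d → ℂ) x := by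
  rw [fourierInv_mul_eq (ha.integrable hd 0 t) (hb.integrable hd 0 t)]
  refine Real.fourierInv_congr_ae ?_ x
  filter_upwards [(prodKernel hd 0).coeFn_op (a 0 t) (b 2 t)] with ξ hξ
  have kernel_eq := mul_kernelConv_congr (K := fun _ _ => 1) (K' := (prodKernel hd 0).toFun)
    (ξ := ξ) (c := 1) (χ := fun _ => 1) (ψ := fun ξ => bracket ξ ^ 2) (f := a 0 t) (f' := a 0 t)
    (g := b 0 t) (g' := b 2 t) (by simp) (by simpa using hb 2 t)
    (fun η => by simp [prodKernel, bracket_ne_zero η])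
  rw [hξ, ← kernel_eq, Complex.ofReal_one, one_mul]

section IsScale

variable {a b : ℕ → ℝ → L2 d}

lemma IsScale.add (ha : IsScale a) (hb : IsScale b) : IsScale (fun k t => a k t + b k t) := by
  intro k t
  filter_upwards [Lp.coeFn_add (a k t) (b k t), Lp.coeFn_add (a 0 t) (b 0 t), ha k t, hb k t]
    with ξ add_k add_0 hak hbk
  rw [add_k, add_0, Pi.add_apply, Pi.add_apply, hak, hbk, mul_add]

lemma IsScale.smul (ha : IsScale a) (c : ℂ) : IsScale (fun k t => c • a k t) := by
  intro k t
  filter_upwards [Lp.coeFn_smul c (a k t), Lp.coeFn_smul c (a 0 t), ha k t]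
    with ξ smul_k smul_0 hak
  rw [smul_k, smul_0, Pi.smul_apply, Pi.smul_apply, hak, smul_eq_mul, smul_eq_mul, mul_left_comm]

lemma IsScale.neg (ha : IsScale a) : IsScale (fun k t => -a k t) := by
  simpa only [neg_one_smul] using ha.smul (-1)

lemma IsScale.sub (ha : IsScale a) (hb : IsScale b) : IsScale (fun k t => a k t - b k t) := by
  simpa only [sub_eq_add_neg] using ha.add hb.neg

lemma IsScale.shift (ha : IsScale a) (j : ℕ) : IsScale (fun k t => a (k + j) t) := by
  intro k t
  simpa only [add_comm, add_zero, zero_add] using ha.ae_eq j k t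

end IsScale

/-- The scales `a`, `b`, `c` of the Fourier transforms of `u`, `n`, `∂ₜn` solve the
Klein–Gordon–Schrödinger system on the frequency side. -/
structure FrequencySolution (hd : d ≤ 3) (a b c : ℕ → ℝ → L2 d) : Prop where
  scale_a : IsScale a
  scale_b : IsScale b
  scale_c : IsScale c
  deriv_a : ∀ k t, HasDerivAt (a k) (-Complex.I • (a (k + 2) t - a k t) +
    Complex.I • (prodKernel hd k).op (a k t) (b (k + 2) t)) t
  deriv_b : ∀ k t, HasDerivAt (b k) (c k t) t
  deriv_c : ∀ k t, HasDerivAt (c k) (-b (k + 2) t +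
    (prodKernel hd k).op (a k t) (conjReflect (a (k + 2) t))) t
  hermitian_b : ∀ k t, ∀ᵐ ξ, b k t (-ξ) = conj (b k t ξ)

lemma IsProfile.hermitian {f : ℝ → Space d → ℝ} {b : ℕ → ℝ → L2 d}
    (h : IsProfile (fun t x => (f t x : ℂ)) b) (hd : d ≤ 3) (hc : ∀ t, Continuous (f t)) (k : ℕ)
    (t : ℝ) : ∀ᵐ ξ, b k t (-ξ) = conj (b k t ξ) := by
  have inversion := h.eq_fourierInv hd (Complex.continuous_ofReal.comp (hc t))
  have sub_conjReflect_eq_zero : b 0 t - conjReflect (b 0 t) = 0 := by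
    refine eq_zero_of_fourierInv_eq_zero _
      ((h.scale.sub h.scale.conjReflect).integrable hd 0 t) fun x => ?_
    rw [fourierInv_sub (h.scale.integrable hd 0 t) (h.scale.conjReflect.integrable hd 0 t),
      Real.fourierInv_congr_ae (coeFn_conjReflect (b 0 t)) x, ← conj_fourierInv, ← inversion,
      Complex.conj_ofReal, sub_self]
  have reflect := coeFn_conjReflect (b 0 t)
  rw [← sub_eq_zero.1 sub_conjReflect_eq_zero] at reflect
  filter_upwards [reflect, h.scale k t, ae_comp_neg (h.scale k t)] with ξ hξ scale_ξ scale_neg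
  rw [scale_neg, scale_ξ, hξ, bracket_neg, map_mul, map_pow, Complex.conj_ofReal,
    Complex.conj_conj]

namespace IsGlobalSmoothSolution

variable {u₀ : Space d → ℂ} {n₀ n₁ : Space d → ℝ} {u : ℝ → Space d → ℂ} {n : ℝ → Space d → ℝ}
  (h : IsGlobalSmoothSolution u₀ n₀ n₁ u n) {a b c : ℕ → ℝ → L2 d}

include h

lemma continuous_u (t : ℝ) : Continuous (u t) :=
  h.smooth_u.continuous.comp (Continuous.prodMk continuous_const continuous_id)

lemma contDiff_n (t : ℝ) : ContDiff ℝ ∞ (n t) :=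
  h.smooth_n.comp (contDiff_const.prodMk contDiff_id)

lemma continuous_ofReal_n (t : ℝ) : Continuous (fun x => (n t x : ℂ)) :=
  Complex.continuous_ofReal.comp (h.contDiff_n t).continuous

lemma contDiff_u_time (x : Space d) : ContDiff ℝ ∞ (fun t => u t x) :=
  h.smooth_u.comp (contDiff_id.prodMk contDiff_const)

lemma contDiff_n_time (x : Space d) : ContDiff ℝ ∞ (fun t => n t x) :=
  h.smooth_n.comp (contDiff_id.prodMk contDiff_const)

lemma continuous_deriv_n (t : ℝ) :
    Continuous (fun x => ((deriv (fun τ => n τ x) t : ℝ) : ℂ)) := by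
  have deriv_eq_fderiv (x : Space d) : deriv (fun τ => n τ x) t =
      fderiv ℝ (fun p : ℝ × Space d => n p.1 p.2) (t, x) (1, 0) := by
    have deriv_line : HasDerivAt (fun τ : ℝ => (τ, x)) ((1 : ℝ), (0 : Space d)) t :=
      (hasDerivAt_id t).prodMk (hasDerivAt_const t x)
    exact (((h.smooth_n.differentiable (by simp)) (t, x)).hasFDerivAt.comp_hasDerivAt t
      deriv_line).deriv
  simp_rw [deriv_eq_fderiv]
  exact Complex.continuous_ofReal.comp
    (((h.smooth_n.continuous_fderiv (by simp)).comp (by fun_prop)).clm_apply continuous_const)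

lemma hasDerivAt_profile_u (hd : d ≤ 3) (ha : IsProfile u a)
    (hb : IsProfile (fun t x => (n t x : ℂ)) b) (k : ℕ) (t : ℝ) :
    HasDerivAt (a k) (-Complex.I • (a (k + 2) t - a k t) +
      Complex.I • (prodKernel hd k).op (a k t) (b (k + 2) t)) t := by
  have linear_scale := ((ha.scale.shift 2).sub ha.scale).smul (-Complex.I)
  have product_scale := (isScale_prodKernel hd ha.scale hb.scale).smul Complex.I
  refine hasDerivAt_of_fourierInv hd (g := fun k t => -Complex.I • (a (k + 2) t - a k t) +
    Complex.I • (prodKernel hd k).op (a k t) (b (k + 2) t)) ha.scale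
    (linear_scale.add product_scale) (fun k => ?_) (fun t x => ?_) k t
  · exact (((ha.continuous (k + 2)).sub (ha.continuous k)).const_smul (-Complex.I)).add
      ((continuous_prodKernel hd k (ha.continuous k) (hb.continuous (k + 2))).const_smul
        Complex.I)
  have fourierInv_a (τ : ℝ) : 𝓕⁻ (a 0 τ : Space d → ℂ) x = u τ x := by
    rw [← ha.eq_fourierInv hd (h.continuous_u τ)]
  have fourierInv_b : 𝓕⁻ (b 0 t : Space d → ℂ) x = n t x := by
    rw [← hb.eq_fourierInv hd (h.continuous_ofReal_n t)]
  have deriv_u : HasDerivAt (fun τ => u τ x) (deriv (fun τ => u τ x) t) t :=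
    ((h.contDiff_u_time x).differentiable (by simp) t).hasDerivAt
  simp_rw [fourierInv_a]
  convert deriv_u using 1
  rw [fourierInv_add (linear_scale.integrable hd 0 t) (product_scale.integrable hd 0 t),
    fourierInv_smul, fourierInv_smul, fourierInv_prodKernel hd ha.scale hb.scale,
    fourierInv_sub (ha.scale.integrable hd 2 t) (ha.scale.integrable hd 0 t), fourierInv_a,
    fourierInv_b]
  have schrodinger := h.schrodinger t x
  rw [ha.laplacian hd (h.continuous_u t) x, fourierInv_a] at schrodinger
  linear_combination Complex.I * schrodinger - (deriv (fun τ => u τ x) t) * Complex.I_sq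

lemma hasDerivAt_profile_n (hd : d ≤ 3) (hb : IsProfile (fun t x => (n t x : ℂ)) b)
    (hc : IsProfile (fun t x => ((deriv (fun τ => n τ x) t : ℝ) : ℂ)) c) (k : ℕ) (t : ℝ) :
    HasDerivAt (b k) (c k t) t := by
  refine hasDerivAt_of_fourierInv hd hb.scale hc.scale hc.continuous (fun t x => ?_) k t
  have fourierInv_b (τ : ℝ) : 𝓕⁻ (b 0 τ : Space d → ℂ) x = n τ x := by
    rw [← hb.eq_fourierInv hd (h.continuous_ofReal_n τ)]
  have deriv_n : HasDerivAt (fun τ => n τ x) (deriv (fun τ => n τ x) t) t :=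
    ((h.contDiff_n_time x).differentiable (by simp) t).hasDerivAt
  simp_rw [fourierInv_b, ← hc.eq_fourierInv hd (h.continuous_deriv_n t)]
  exact deriv_n.ofReal_comp

lemma hasDerivAt_profile_deriv_n (hd : d ≤ 3) (ha : IsProfile u a)
    (hb : IsProfile (fun t x => (n t x : ℂ)) b)
    (hc : IsProfile (fun t x => ((deriv (fun τ => n τ x) t : ℝ) : ℂ)) c) (k : ℕ) (t : ℝ) :
    HasDerivAt (c k) (-b (k + 2) t +
      (prodKernel hd k).op (a k t) (conjReflect (a (k + 2) t))) t := by
  have linear_scale : IsScale (fun k t => -b (k + 2) t) := (hb.scale.shift 2).neg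
  have product_scale := isScale_prodKernel hd ha.scale ha.scale.conjReflect
  refine hasDerivAt_of_fourierInv hd (g := fun k t => -b (k + 2) t +
    (prodKernel hd k).op (a k t) (conjReflect (a (k + 2) t))) hc.scale
    (linear_scale.add product_scale) (fun k => ?_) (fun t x => ?_) k t
  · exact (hb.continuous (k + 2)).neg.add (continuous_prodKernel hd k (ha.continuous k)
      (continuous_conjReflect.comp (ha.continuous (k + 2))))
  have fourierInv_c (τ : ℝ) :
      𝓕⁻ (c 0 τ : Space d → ℂ) x = ((deriv (fun τ => n τ x) τ : ℝ) : ℂ) := by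
    rw [← hc.eq_fourierInv hd (h.continuous_deriv_n τ)]
  have deriv_deriv_n : HasDerivAt (fun τ => ((deriv (fun τ => n τ x) τ : ℝ) : ℂ))
      ((iteratedDeriv 2 (fun τ => n τ x) t : ℝ) : ℂ) t := by
    have differentiable : Differentiable ℝ (deriv (fun τ => n τ x)) :=
      ((contDiff_infty_iff_deriv.1 (h.contDiff_n_time x)).2).differentiable (by simp)
    rw [iteratedDeriv_succ, iteratedDeriv_one]
    exact (differentiable t).hasDerivAt.ofReal_comp
  simp_rw [fourierInv_c]
  convert deriv_deriv_n using 1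
  rw [fourierInv_add (linear_scale.integrable hd 0 t) (product_scale.integrable hd 0 t),
    fourierInv_neg, fourierInv_prodKernel hd (b := fun k t => conjReflect (a k t)) ha.scale
      ha.scale.conjReflect,
    Real.fourierInv_congr_ae (coeFn_conjReflect (a 0 t)) x, ← conj_fourierInv,
    ← ha.eq_fourierInv hd (h.continuous_u t), Complex.mul_conj, Complex.normSq_eq_norm_sq]
  have laplacian_n := hb.laplacian hd (h.continuous_ofReal_n t) x
  rw [← hb.eq_fourierInv hd (h.continuous_ofReal_n t)] at laplacian_n
  have laplacian_ofReal : Δ (fun x => (n t x : ℂ)) x = ((Δ (n t) x : ℝ) : ℂ) :=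
    ContDiffAt.laplacian_CLM_comp_left (l := Complex.ofRealCLM) (f := n t) (x := x)
      ((h.contDiff_n t).contDiffAt.of_le (WithTop.coe_le_coe.2 le_top))
  rw [laplacian_ofReal] at laplacian_n
  have kleinGordon := congrArg (fun r : ℝ => (r : ℂ)) (h.kleinGordon t x)
  push_cast at kleinGordon ⊢
  linear_combination -laplacian_n - kleinGordon

theorem exists_frequencySolution (hd : d ≤ 3) :
    ∃ a b c : ℕ → ℝ → L2 d, FrequencySolution hd a b c ∧ IsProfile u a ∧
      IsProfile (fun t x => (n t x : ℂ)) b ∧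
      IsProfile (fun t x => ((deriv (fun τ => n τ x) t : ℝ) : ℂ)) c := by
  obtain ⟨a, ha⟩ := exists_isProfile h.sobolev_u
  obtain ⟨b, hb⟩ := exists_isProfile h.sobolev_n
  obtain ⟨c, hc⟩ := exists_isProfile h.sobolev_dn
  exact ⟨a, b, c, ⟨ha.scale, hb.scale, hc.scale, h.hasDerivAt_profile_u hd ha hb,
    h.hasDerivAt_profile_n hd hb hc, h.hasDerivAt_profile_deriv_n hd ha hb hc,
    hb.hermitian hd fun t => (h.contDiff_n t).continuous⟩, ha, hb, hc⟩

end IsGlobalSmoothSolution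

/-! ### Truncated exponential weights -/

/-- The norm `∑ |ξ_i|` of the frequency `2πξ`. -/
def taxicab (ξ : Space d) : ℝ := ∑ i, |((2 * Real.pi) • ξ) i|

lemma taxicab_nonneg (ξ : Space d) : 0 ≤ taxicab ξ := Finset.sum_nonneg fun _ _ => abs_nonneg _

lemma taxicab_neg (ξ : Space d) : taxicab (-ξ) = taxicab ξ := by simp [taxicab]

lemma taxicab_le_add (ξ η : Space d) : taxicab ξ ≤ taxicab (ξ - η) + taxicab η := by
  unfold taxicab
  rw [← Finset.sum_add_distrib]
  refine Finset.sum_le_sum fun i _ => ?_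
  simpa [← mul_add] using
    abs_add_le (((2 * Real.pi) • (ξ - η)) i) (((2 * Real.pi) • η) i)

@[fun_prop]
lemma continuous_taxicab : Continuous (taxicab : Space d → ℝ) := by
  unfold taxicab; fun_prop

lemma taxicab_le_bracket (ξ : Space d) : taxicab ξ ≤ d * bracket ξ := by
  have coordinate_le (i : Fin d) : |((2 * Real.pi) • ξ) i| ≤ bracket ξ :=
    (PiLp.norm_apply_le ((2 * Real.pi) • ξ) i).trans (norm_le_bracket ξ)
  simpa [taxicab] using Finset.sum_le_sum (s := Finset.univ) fun i _ => coordinate_le i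

/-- Parameters of the truncated weight `exp (min (σ‖2πξ‖₁) M)`. The power `θ` of `σ` is gained in
the commutator estimates; it is limited by the decay `⟨ξ⟩^{-(2-θ)}` that is left for the kernels,
which has to be square integrable. -/
structure GevreyParams (d : ℕ) (θ : ℝ) where
  θ_pos : 0 < θ
  θ_le_one : θ ≤ 1
  decay : (d : ℝ) < 2 * (2 - θ)
  /-- the radius of analyticity -/
  σ : ℝ
  σ_nonneg : 0 ≤ σ
  /-- the truncation -/
  M : ℝ
  M_nonneg : 0 ≤ M

lemma one_sub_exp_neg_le_rpow {x θ : ℝ} (hx : 0 ≤ x) (hθ₀ : 0 ≤ θ) (hθ₁ : θ ≤ 1) :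
    1 - Real.exp (-x) ≤ x ^ θ := by
  rcases le_total x 1 with hx₁ | hx₁
  · have x_le_rpow : x ≤ x ^ θ := Real.self_le_rpow_of_le_one hx hx₁ hθ₁
    linarith [Real.add_one_le_exp (-x)]
  · linarith [Real.one_le_rpow hx₁ hθ₀, Real.exp_pos (-x)]

lemma min_le_min_add_min {x y z M : ℝ} (hy : 0 ≤ y) (hz : 0 ≤ z) (hM : 0 ≤ M) (h : x ≤ y + z) :
    min x M ≤ min y M + min z M := by
  grind

lemma inv_sq_eq_rpow {b : ℝ} (hb : 0 < b) : (b ^ 2)⁻¹ = b ^ (-(2 : ℝ)) := by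
  rw [Real.rpow_neg hb.le, Real.rpow_two]

namespace GevreyParams

variable {θ : ℝ} (p : GevreyParams d θ)

include p in
lemma dim_le : d ≤ 3 := by
  have := p.decay
  have := p.θ_pos
  have : (d : ℝ) < 4 := by linarith
  exact Nat.lt_succ_iff.1 (by exact_mod_cast this)

/-- The exponent of the weight. -/
def phase (ξ : Space d) : ℝ := min (p.σ * taxicab ξ) p.M

lemma phase_neg (ξ : Space d) : p.phase (-ξ) = p.phase ξ := by simp only [phase, taxicab_neg]

lemma phase_le_add (ξ η : Space d) : p.phase ξ ≤ p.phase (ξ - η) + p.phase η :=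
  min_le_min_add_min (mul_nonneg p.σ_nonneg (taxicab_nonneg _))
    (mul_nonneg p.σ_nonneg (taxicab_nonneg _)) p.M_nonneg
    ((mul_le_mul_of_nonneg_left (taxicab_le_add ξ η) p.σ_nonneg).trans_eq (mul_add _ _ _))

lemma phase_le_bracket (ξ : Space d) : p.phase ξ ≤ d * p.σ * bracket ξ := by
  refine (min_le_left _ _).trans ?_
  linarith [mul_le_mul_of_nonneg_left (taxicab_le_bracket ξ) p.σ_nonneg]

@[fun_prop]
lemma continuous_phase : Continuous p.phase := by unfold phase; fun_prop

@[fun_prop]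
lemma measurable_phase : Measurable p.phase := p.continuous_phase.measurable

/-- The weight `exp (min (σ‖2πξ‖₁) M)` as a multiplier. -/
def weight : Multiplier d where
  toFun ξ := Real.exp (p.phase ξ)
  measurable := by fun_prop
  const := Real.exp p.M
  bound ξ := by
    rw [abs_of_pos (Real.exp_pos _)]
    exact Real.exp_le_exp.2 (min_le_right _ _)

lemma even_weight (ξ : Space d) : p.weight.toFun (-ξ) = p.weight.toFun ξ := by
  simp only [weight, p.phase_neg]

/-- The quotient `w(ξ) / (w(ξ - η) w(η))` of weights. -/
def ratio (ξ η : Space d) : ℝ := Real.exp (p.phase ξ - p.phase (ξ - η) - p.phase η)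

lemma ratio_pos (ξ η : Space d) : 0 < p.ratio ξ η := Real.exp_pos _

lemma ratio_le_one (ξ η : Space d) : p.ratio ξ η ≤ 1 :=
  Real.exp_le_one_iff.2 (by linarith [p.phase_le_add ξ η])

@[fun_prop]
lemma measurable_ratio : Measurable (fun q : Space d × Space d => p.ratio q.1 q.2) := by
  unfold ratio; fun_prop

lemma ratio_mul (ξ η : Space d) :
    p.ratio ξ η * Real.exp (p.phase (ξ - η)) * Real.exp (p.phase η) = Real.exp (p.phase ξ) := by
  rw [ratio, ← Real.exp_add, ← Real.exp_add]
  ring_nf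

/-- The small factor gained in the commutator estimates. -/
def gain : ℝ := (2 * d * p.σ) ^ θ

lemma gain_nonneg : 0 ≤ p.gain :=
  Real.rpow_nonneg (mul_nonneg (by positivity) p.σ_nonneg) _

lemma one_sub_ratio_le_of_phase_le {ξ η ζ : Space d}
    (h : p.phase (ξ - η) + p.phase η - p.phase ξ ≤ 2 * p.phase ζ) :
    1 - p.ratio ξ η ≤ p.gain * bracket ζ ^ θ := by
  have defect_nonneg : 0 ≤ p.phase (ξ - η) + p.phase η - p.phase ξ := by
    linarith [p.phase_le_add ξ η]
  have defect_le : p.phase (ξ - η) + p.phase η - p.phase ξ ≤ 2 * d * p.σ * bracket ζ := by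
    linarith [p.phase_le_bracket ζ]
  calc 1 - p.ratio ξ η = 1 - Real.exp (-(p.phase (ξ - η) + p.phase η - p.phase ξ)) := by
        rw [ratio]; ring_nf
    _ ≤ (p.phase (ξ - η) + p.phase η - p.phase ξ) ^ θ :=
        one_sub_exp_neg_le_rpow defect_nonneg p.θ_pos.le p.θ_le_one
    _ ≤ (2 * d * p.σ * bracket ζ) ^ θ := Real.rpow_le_rpow defect_nonneg defect_le p.θ_pos.le
    _ = p.gain * bracket ζ ^ θ :=
        Real.mul_rpow (mul_nonneg (by positivity) p.σ_nonneg) (bracket_pos ζ).le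

lemma one_sub_ratio_le_right (ξ η : Space d) :
    1 - p.ratio ξ η ≤ p.gain * bracket η ^ θ := by
  refine p.one_sub_ratio_le_of_phase_le ?_
  have := p.phase_le_add (ξ - η) (-η)
  rw [sub_neg_eq_add, sub_add_cancel, phase_neg] at this
  linarith

lemma one_sub_ratio_le_left (ξ η : Space d) :
    1 - p.ratio ξ η ≤ p.gain * bracket (ξ - η) ^ θ := by
  refine p.one_sub_ratio_le_of_phase_le ?_
  have := p.phase_le_add η (-(ξ - η))
  rw [sub_neg_eq_add, add_sub_cancel, phase_neg] at this
  linarith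

include p in
lemma inv_sq_le_decayKernel (ξ η : Space d) :
    (bracket η ^ 2)⁻¹ ≤ decayKernel (2 - θ) ξ η := by
  rw [inv_sq_eq_rpow (bracket_pos η)]
  refine le_trans ?_ (le_add_of_nonneg_left (Real.rpow_nonneg (bracket_pos _).le _))
  exact Real.rpow_le_rpow_of_exponent_le (one_le_bracket η) (by linarith [p.θ_pos])

/-- The kernel of `(f, g) ↦ f * (⟨η⟩^{-2} g)`. -/
def plainKernel : SmoothingKernel d (2 - θ) where
  toFun _ η := (bracket η ^ 2)⁻¹
  measurable := by fun_prop
  const := 1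
  const_nonneg := zero_le_one
  bound ξ η := by
    have := bracket_pos η
    rw [abs_of_pos (by positivity), one_mul]
    exact p.inv_sq_le_decayKernel ξ η
  decay := p.decay

/-- The kernel of the conjugation of `f * (⟨η⟩^{-2} g)` by the weight. -/
def weightedKernel : SmoothingKernel d (2 - θ) where
  toFun ξ η := p.ratio ξ η * (bracket η ^ 2)⁻¹
  measurable := by fun_prop
  const := 1
  const_nonneg := zero_le_one
  bound ξ η := by
    have := bracket_pos η
    have := p.ratio_pos ξ η
    rw [abs_of_pos (by positivity), one_mul]
    exact (mul_le_of_le_one_left (by positivity) (p.ratio_le_one ξ η)).trans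
      (p.inv_sq_le_decayKernel ξ η)
  decay := p.decay

/-- The difference of `plainKernel` and `weightedKernel`. -/
def errorKernel : SmoothingKernel d (2 - θ) where
  toFun ξ η := (1 - p.ratio ξ η) * (bracket η ^ 2)⁻¹
  measurable := by fun_prop
  const := p.gain
  const_nonneg := p.gain_nonneg
  bound ξ η := by
    have η_pos := bracket_pos η
    have one_sub_nonneg : 0 ≤ 1 - p.ratio ξ η := by linarith [p.ratio_le_one ξ η]
    rw [abs_of_nonneg (by positivity)]
    calc (1 - p.ratio ξ η) * (bracket η ^ 2)⁻¹
        ≤ p.gain * bracket η ^ θ * (bracket η ^ 2)⁻¹ := by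
          gcongr; exact p.one_sub_ratio_le_right ξ η
      _ = p.gain * bracket η ^ (-(2 - θ)) := by
          rw [inv_sq_eq_rpow η_pos, mul_assoc, ← Real.rpow_add η_pos]
          ring_nf
      _ ≤ p.gain * decayKernel (2 - θ) ξ η := by
          refine mul_le_mul_of_nonneg_left ?_ p.gain_nonneg
          exact le_add_of_nonneg_left (Real.rpow_nonneg (bracket_pos _).le _)
  decay := p.decay

lemma plainKernel_op_eq (f g : L2 d) :
    p.plainKernel.op f g = p.weightedKernel.op f g + p.errorKernel.op f g := by
  apply Lp.ext
  filter_upwards [p.plainKernel.coeFn_op f g, p.weightedKernel.coeFn_op f g,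
    p.errorKernel.coeFn_op f g, Lp.coeFn_add (p.weightedKernel.op f g) (p.errorKernel.op f g),
    p.weightedKernel.ae_integrable f g, p.errorKernel.ae_integrable f g]
    with ξ plain weighted error add weighted_integrable error_integrable
  rw [plain, add, Pi.add_apply, weighted, error, kernelConv, kernelConv, kernelConv,
    ← integral_add weighted_integrable error_integrable]
  refine integral_congr_ae (.of_forall fun η => ?_)
  simp only [plainKernel, weightedKernel, errorKernel]
  push_cast
  ring

lemma weight_op_prodKernel (f g : L2 d) :
    p.weight.op ((prodKernel p.dim_le 0).op f g) =
      p.weightedKernel.op (p.weight.op f) (p.weight.op g) := by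
  apply Lp.ext
  filter_upwards [p.weight.coeFn_op ((prodKernel p.dim_le 0).op f g),
    (prodKernel p.dim_le 0).coeFn_op f g,
    p.weightedKernel.coeFn_op (p.weight.op f) (p.weight.op g)] with ξ weight_ξ prod_ξ weighted_ξ
  rw [weight_ξ, prod_ξ, weighted_ξ]
  refine mul_kernelConv_congr (p.weight.coeFn_op f) (p.weight.coeFn_op g) fun η => ?_
  simp only [weight, prodKernel, weightedKernel, ← p.ratio_mul ξ η]
  simp only [pow_zero, inv_one, zero_add, one_mul]
  ring

end GevreyParams

/-! ### The weighted system -/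

/-- The weighted scales `A`, `B`, `D` of `û`, `n̂`, `(∂ₜn)^` with the time derivatives `V` of `A`
and `W` of `D`. -/
structure WeightedSolution {θ : ℝ} (p : GevreyParams d θ) (A B D V W : ℕ → ℝ → L2 d) : Prop where
  scale_A : IsScale A
  scale_B : IsScale B
  scale_D : IsScale D
  scale_V : IsScale V
  scale_W : IsScale W
  deriv_A : ∀ k t, HasDerivAt (A k) (V k t) t
  deriv_B : ∀ k t, HasDerivAt (B k) (D k t) t
  deriv_D : ∀ k t, HasDerivAt (D k) (W k t) t
  V_eq : ∀ t, V 0 t = -Complex.I • (A 2 t - A 0 t) +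
    Complex.I • p.weightedKernel.op (A 0 t) (B 2 t)
  W_eq : ∀ t, W 0 t = -B 2 t + p.weightedKernel.op (A 0 t) (conjReflect (A 2 t))
  hermitian_B : ∀ k t, ∀ᵐ ξ, B k t (-ξ) = conj (B k t ξ)

lemma IsScale.multiplier_op {a : ℕ → ℝ → L2 d} (ha : IsScale a) (χ : Multiplier d) :
    IsScale (fun k t => χ.op (a k t)) := by
  intro k t
  filter_upwards [χ.coeFn_op (a k t), χ.coeFn_op (a 0 t), ha k t] with ξ op_k op_0 hak
  rw [op_k, op_0, hak, mul_left_comm]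

lemma Multiplier.hasDerivAt_op (χ : Multiplier d) {f : ℝ → L2 d} {f' : L2 d} {t : ℝ}
    (hf : HasDerivAt f f' t) : HasDerivAt (fun τ => χ.op (f τ)) (χ.op f') t :=
  (χ.op.restrictScalars ℝ).hasFDerivAt.comp_hasDerivAt _ hf

theorem FrequencySolution.weighted {θ : ℝ} (p : GevreyParams d θ) {a b c : ℕ → ℝ → L2 d}
    (h : FrequencySolution p.dim_le a b c) :
    ∃ V W, WeightedSolution p (fun k t => p.weight.op (a k t)) (fun k t => p.weight.op (b k t))
      (fun k t => p.weight.op (c k t)) V W := by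
  have scale_nonlinearity_a := (isScale_prodKernel p.dim_le h.scale_a h.scale_b).smul Complex.I
  have scale_nonlinearity_c := isScale_prodKernel p.dim_le h.scale_a h.scale_a.conjReflect
  exact ⟨_, _,
    { scale_A := h.scale_a.multiplier_op _
      scale_B := h.scale_b.multiplier_op _
      scale_D := h.scale_c.multiplier_op _
      scale_V := ((((h.scale_a.shift 2).sub h.scale_a).smul _).add
        scale_nonlinearity_a).multiplier_op _
      scale_W := ((h.scale_b.shift 2).neg.add scale_nonlinearity_c).multiplier_op _
      deriv_A := fun k t => p.weight.hasDerivAt_op (h.deriv_a k t)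
      deriv_B := fun k t => p.weight.hasDerivAt_op (h.deriv_b k t)
      deriv_D := fun k t => p.weight.hasDerivAt_op (h.deriv_c k t)
      V_eq := fun t => by
        simp only [map_add, map_smul, map_sub, p.weight_op_prodKernel]
      W_eq := fun t => by
        simp only [map_add, map_neg, p.weight_op_prodKernel,
          p.weight.conjReflect_op_of_even p.even_weight]
      hermitian_B := fun k t => p.weight.op_neg_of_even p.even_weight (h.hermitian_b k t) }⟩

/-! ### Bilinear estimates -/

lemma rpow_mul_rpow_le_add_rpow {a b q r s : ℝ} (ha : 1 ≤ a) (hb : 1 ≤ b) (hq : 0 ≤ q)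
    (hr : 0 ≤ r) (hs : s ≤ q + r) : a ^ (-q) * b ^ (-r) ≤ a ^ (-s) + b ^ (-s) := by
  have a_pos : 0 < a := by linarith
  have b_pos : 0 < b := by linarith
  rcases le_total a b with hab | hba
  · calc a ^ (-q) * b ^ (-r) ≤ a ^ (-q) * a ^ (-r) :=
          mul_le_mul_of_nonneg_left (Real.rpow_le_rpow_of_nonpos a_pos hab (by linarith))
            (by positivity)
      _ = a ^ (-q + -r) := (Real.rpow_add a_pos _ _).symm
      _ ≤ a ^ (-s) := Real.rpow_le_rpow_of_exponent_le ha (by linarith)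
      _ ≤ _ := le_add_of_nonneg_right (by positivity)
  · calc a ^ (-q) * b ^ (-r) ≤ b ^ (-q) * b ^ (-r) :=
          mul_le_mul_of_nonneg_right (Real.rpow_le_rpow_of_nonpos b_pos hba (by linarith))
            (by positivity)
      _ = b ^ (-q + -r) := (Real.rpow_add b_pos _ _).symm
      _ ≤ b ^ (-s) := Real.rpow_le_rpow_of_exponent_le hb (by linarith)
      _ ≤ _ := le_add_of_nonneg_left (by positivity)

lemma rpow_mul_rpow_le_decayKernel {q r s : ℝ} (hq : 0 ≤ q) (hr : 0 ≤ r) (h : s ≤ q + r)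
    (ξ η : Space d) : bracket (ξ - η) ^ (-q) * bracket η ^ (-r) ≤ decayKernel s ξ η :=
  rpow_mul_rpow_le_add_rpow (one_le_bracket _) (one_le_bracket _) hq hr h

lemma rpow_neg_mul_self_le {b L θ : ℝ} (hb : 0 < b) (hL : 0 < L) (hθ₀ : 0 ≤ θ)
    (hθ₁ : θ ≤ 1) : b ^ (-θ) * b ≤ L ^ (1 - θ) + L ^ (-θ) * b := by
  rcases le_total b L with hbL | hLb
  · calc b ^ (-θ) * b = b ^ (1 - θ) := by
          rw [sub_eq_neg_add, Real.rpow_add hb, Real.rpow_one]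
      _ ≤ L ^ (1 - θ) := Real.rpow_le_rpow hb.le hbL (by linarith)
      _ ≤ L ^ (1 - θ) + L ^ (-θ) * b := le_add_of_nonneg_right (by positivity)
  · calc b ^ (-θ) * b ≤ L ^ (-θ) * b :=
          mul_le_mul_of_nonneg_right (Real.rpow_le_rpow_of_nonpos hL hLb (by linarith)) hb.le
      _ ≤ L ^ (1 - θ) + L ^ (-θ) * b := le_add_of_nonneg_left (by positivity)

section IsScale

variable {f g : ℕ → ℝ → L2 d}

lemma IsScale.ae_eq_inv_one (hg : IsScale g) (t : ℝ) :
    (g 1 t : Space d → ℂ) =ᵐ[volume] fun ξ => (((bracket ξ)⁻¹ : ℝ) : ℂ) * g 2 t ξ := by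
  filter_upwards [hg.ae_eq 1 1 t] with ξ hξ
  have := ofReal_bracket_ne_zero ξ
  rw [hξ]; push_cast; field_simp

lemma IsScale.ae_eq_inv_zero (hg : IsScale g) (t : ℝ) :
    (g 0 t : Space d → ℂ) =ᵐ[volume] fun ξ => (((bracket ξ ^ 2)⁻¹ : ℝ) : ℂ) * g 2 t ξ := by
  filter_upwards [hg 2 t] with ξ hξ
  have := ofReal_bracket_ne_zero ξ
  rw [hξ]; push_cast; field_simp

lemma IsScale.norm_le_succ (hf : IsScale f) (k : ℕ) (t : ℝ) : ‖f k t‖ ≤ ‖f (k + 1) t‖ := by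
  refine Lp.norm_le_norm_of_ae_le ?_
  filter_upwards [hf.ae_eq k 1 t] with ξ hξ
  rw [hξ, pow_one, norm_mul, Complex.norm_real, Real.norm_of_nonneg (bracket_pos ξ).le]
  exact le_mul_of_one_le_left (norm_nonneg _) (one_le_bracket ξ)

lemma IsScale.inner_shift (hf : IsScale f) (hg : IsScale g) (i j k : ℕ) (t : ℝ) :
    inner ℂ (f i t) (g (j + k) t) = inner ℂ (f (i + k) t) (g j t) := by
  rw [L2.inner_def, L2.inner_def]
  refine integral_congr_ae ?_
  filter_upwards [hf.ae_eq i k t, hg.ae_eq j k t] with ξ hfξ hgξ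
  rw [hfξ, hgξ, RCLike.inner_apply, RCLike.inner_apply]
  simp only [map_mul, map_pow, Complex.conj_ofReal]
  ring

end IsScale

namespace GevreyParams

variable {θ : ℝ} (p : GevreyParams d θ)

/-- Multiplication by `⟨ξ⟩^{-θ}`. -/
def fractional : Multiplier d where
  toFun ξ := bracket ξ ^ (-θ)
  measurable := by fun_prop
  const := 1
  bound ξ := by
    rw [abs_of_pos (Real.rpow_pos_of_pos (bracket_pos ξ) _)]
    exact rpow_neg_bracket_le_one ξ p.θ_pos.le

lemma norm_fractional_conjReflect (f : L2 d) :
    ‖p.fractional.op (conjReflect f)‖ = ‖p.fractional.op f‖ := by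
  rw [← p.fractional.conjReflect_op_of_even fun ξ => by simp only [fractional, bracket_neg],
    norm_conjReflect]

lemma abs_weightedKernel_le (ξ η : Space d) :
    |p.weightedKernel.toFun ξ η| ≤ (bracket η ^ 2)⁻¹ := by
  have := p.ratio_pos ξ η
  have := bracket_pos η
  rw [weightedKernel, abs_of_pos (by positivity)]
  exact mul_le_of_le_one_left (by positivity) (p.ratio_le_one ξ η)

variable {f g : ℕ → ℝ → L2 d}

lemma ae_eq_fractional (hf : IsScale f) (k : ℕ) (t : ℝ) :
    (p.fractional.op (f k t) : Space d → ℂ) =ᵐ[volume]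
      fun ξ => ((bracket ξ ^ (k - θ) : ℝ) : ℂ) * f 0 t ξ := by
  filter_upwards [hf k t, p.fractional.coeFn_op (f k t)] with ξ hfξ op_ξ
  rw [op_ξ, hfξ, ← Complex.ofReal_pow, ← mul_assoc, ← Complex.ofReal_mul, fractional,
    sub_eq_neg_add, Real.rpow_add (bracket_pos ξ), Real.rpow_natCast]

lemma norm_weighted_le (hf : IsScale f) (hg : IsScale g) (t : ℝ) :
    ‖p.weightedKernel.op (f 0 t) (g 2 t)‖ ≤ convConst d (2 - θ) * ‖f 1 t‖ * ‖g 1 t‖ := by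
  have kernel_bound (ξ η : Space d) : |p.weightedKernel.toFun ξ η| ≤
      1 * decayKernel (2 - θ) ξ η * bracket (ξ - η) * (bracket η)⁻¹ := by
    have difference_pos := bracket_pos (ξ - η)
    have η_pos := bracket_pos η
    have decay := rpow_mul_rpow_le_decayKernel (s := 2 - θ) zero_le_one zero_le_one
      (by linarith [p.θ_pos]) ξ η
    simp only [Real.rpow_neg_one] at decay
    calc |p.weightedKernel.toFun ξ η| ≤ (bracket η ^ 2)⁻¹ := p.abs_weightedKernel_le ξ η
      _ = 1 * ((bracket (ξ - η))⁻¹ * (bracket η)⁻¹) * bracket (ξ - η) * (bracket η)⁻¹ := by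
          field_simp
      _ ≤ 1 * decayKernel (2 - θ) ξ η * bracket (ξ - η) * (bracket η)⁻¹ := by gcongr
  simpa only [mul_one] using p.weightedKernel.norm_op_le_of_weights (by fun_prop) (by fun_prop)
    bracket_pos (fun ξ => inv_pos.2 (bracket_pos ξ)) (by simpa using hf 1 t) (hg.ae_eq_inv_one t)
    zero_le_one kernel_bound

lemma norm_error_le (hf : IsScale f) (hg : IsScale g) (t : ℝ) :
    ‖p.errorKernel.op (f 0 t) (g 2 t)‖ ≤
      convConst d (2 - θ) * p.gain * ‖f 1 t‖ * ‖g 1 t‖ := by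
  refine p.errorKernel.norm_op_le_of_weights (χ := bracket) (ψ := fun ξ => (bracket ξ)⁻¹)
    (by fun_prop) (by fun_prop) bracket_pos (fun ξ => inv_pos.2 (bracket_pos ξ))
    (by simpa using hf 1 t) (hg.ae_eq_inv_one t) p.gain_nonneg fun ξ η => ?_
  have difference_pos := bracket_pos (ξ - η)
  have η_pos := bracket_pos η
  have gain_nonneg := p.gain_nonneg
  have one_sub_nonneg : 0 ≤ 1 - p.ratio ξ η := by linarith [p.ratio_le_one ξ η]
  have decay := rpow_mul_rpow_le_decayKernel (q := 1 - θ) (s := 2 - θ)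
    (by linarith [p.θ_le_one]) zero_le_one (by linarith) ξ η
  rw [Real.rpow_neg_one, neg_sub, Real.rpow_sub difference_pos, Real.rpow_one] at decay
  rw [errorKernel, abs_of_nonneg (by positivity)]
  calc (1 - p.ratio ξ η) * (bracket η ^ 2)⁻¹
      ≤ p.gain * bracket (ξ - η) ^ θ * (bracket η ^ 2)⁻¹ := by
        gcongr; exact p.one_sub_ratio_le_left ξ η
    _ = p.gain * (bracket (ξ - η) ^ θ / bracket (ξ - η) * (bracket η)⁻¹) * bracket (ξ - η) *
          (bracket η)⁻¹ := by field_simp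
    _ ≤ p.gain * decayKernel (2 - θ) ξ η * bracket (ξ - η) * (bracket η)⁻¹ := by gcongr

lemma norm_weighted_le_fractional (hf : IsScale f) (hg : IsScale g) (t : ℝ) :
    ‖p.weightedKernel.op (f 0 t) (g 2 t)‖ ≤
      convConst d (2 - θ) * ‖p.fractional.op (f 2 t)‖ * ‖g 0 t‖ := by
  have kernel_bound (ξ η : Space d) : |p.weightedKernel.toFun ξ η| ≤
      1 * decayKernel (2 - θ) ξ η * bracket (ξ - η) ^ (2 - θ) * (bracket η ^ 2)⁻¹ := by
    have difference_pos := bracket_pos (ξ - η)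
    have η_pos := bracket_pos η
    have decay : bracket (ξ - η) ^ (-(2 - θ)) ≤ decayKernel (2 - θ) ξ η :=
      le_add_of_nonneg_right (Real.rpow_nonneg η_pos.le _)
    have cancel : bracket (ξ - η) ^ (-(2 - θ)) * bracket (ξ - η) ^ (2 - θ) = 1 := by
      rw [← Real.rpow_add difference_pos, neg_add_cancel, Real.rpow_zero]
    calc |p.weightedKernel.toFun ξ η| ≤ (bracket η ^ 2)⁻¹ := p.abs_weightedKernel_le ξ η
      _ = 1 * bracket (ξ - η) ^ (-(2 - θ)) * bracket (ξ - η) ^ (2 - θ) * (bracket η ^ 2)⁻¹ := by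
          rw [one_mul, cancel, one_mul]
      _ ≤ 1 * decayKernel (2 - θ) ξ η * bracket (ξ - η) ^ (2 - θ) * (bracket η ^ 2)⁻¹ := by
          gcongr
  simpa only [mul_one] using p.weightedKernel.norm_op_le_of_weights
    (χ := fun ξ => bracket ξ ^ (2 - θ)) (by fun_prop) (by fun_prop)
    (fun ξ => Real.rpow_pos_of_pos (bracket_pos ξ) _)
    (fun ξ => inv_pos.2 (pow_pos (bracket_pos ξ) 2)) (by simpa using p.ae_eq_fractional hf 2 t)
    (hg.ae_eq_inv_zero t) zero_le_one kernel_bound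

lemma abs_bracket_mul_weightedKernel_le (ξ η : Space d) :
    |bracket ξ * p.weightedKernel.toFun ξ η| ≤
      2 * decayKernel (2 - θ) ξ η * bracket (ξ - η) * bracket η ^ (-θ) := by
  have difference_pos := bracket_pos (ξ - η)
  have η_pos := bracket_pos η
  have decay_mixed := rpow_mul_rpow_le_decayKernel (r := 1 - θ) (s := 2 - θ) zero_le_one
    (by linarith [p.θ_le_one]) (by linarith) ξ η
  rw [Real.rpow_neg_one] at decay_mixed
  have decay_η : bracket η ^ (-(2 - θ)) ≤ decayKernel (2 - θ) ξ η :=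
    le_add_of_nonneg_left (Real.rpow_nonneg difference_pos.le _)
  have split_two : bracket η ^ (-(2 - θ)) * bracket η ^ (-θ) = (bracket η ^ 2)⁻¹ := by
    rw [← Real.rpow_add η_pos, inv_sq_eq_rpow η_pos]; ring_nf
  have split_one : bracket η ^ (-(1 - θ)) * bracket η ^ (-θ) = (bracket η)⁻¹ := by
    rw [← Real.rpow_add η_pos, ← Real.rpow_neg_one]; ring_nf
  rw [abs_mul, abs_of_pos (bracket_pos ξ)]
  calc bracket ξ * |p.weightedKernel.toFun ξ η|
      ≤ (bracket (ξ - η) + bracket η) * (bracket η ^ 2)⁻¹ := by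
        gcongr
        · exact bracket_le_add ξ η
        · exact p.abs_weightedKernel_le ξ η
    _ = bracket (ξ - η) * (bracket η ^ 2)⁻¹ + (bracket η)⁻¹ := by field_simp
    _ = bracket η ^ (-(2 - θ)) * (bracket (ξ - η) * bracket η ^ (-θ)) +
        (bracket (ξ - η))⁻¹ * bracket η ^ (-(1 - θ)) *
          (bracket (ξ - η) * bracket η ^ (-θ)) := by
        rw [← split_two, ← split_one]; field_simp
    _ ≤ decayKernel (2 - θ) ξ η * (bracket (ξ - η) * bracket η ^ (-θ)) +
        decayKernel (2 - θ) ξ η * (bracket (ξ - η) * bracket η ^ (-θ)) := by gcongr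
    _ = 2 * decayKernel (2 - θ) ξ η * bracket (ξ - η) * bracket η ^ (-θ) := by ring

lemma norm_bracket_weighted_le (hf : IsScale f) (t : ℝ) {g q : L2 d}
    (hq : (q : Space d → ℂ) =ᵐ[volume]
      fun ξ => (bracket ξ : ℂ) * p.weightedKernel.op (f 0 t) g ξ) :
    ‖q‖ ≤ convConst d (2 - θ) * 2 * ‖f 1 t‖ * ‖p.fractional.op g‖ :=
  p.weightedKernel.norm_le_of_weights (ψ := fun ξ => bracket ξ ^ (-θ)) (by fun_prop)
    (by fun_prop) (by fun_prop) bracket_pos (fun ξ => Real.rpow_pos_of_pos (bracket_pos ξ) _)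
    (by simpa using hf 1 t) (p.fractional.coeFn_op g) hq zero_le_two
    p.abs_bracket_mul_weightedKernel_le

lemma norm_plain_le (hf : IsScale f) (hg : IsScale g) (t : ℝ) :
    ‖p.plainKernel.op (f 0 t) (g 2 t)‖ ≤
      convConst d (2 - θ) * ‖p.fractional.op (f 1 t)‖ * ‖g 1 t‖ := by
  have kernel_bound (ξ η : Space d) : |p.plainKernel.toFun ξ η| ≤
      1 * decayKernel (2 - θ) ξ η * bracket (ξ - η) ^ (1 - θ) * (bracket η)⁻¹ := by
    have difference_pos := bracket_pos (ξ - η)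
    have η_pos := bracket_pos η
    have decay := rpow_mul_rpow_le_decayKernel (q := 1 - θ) (s := 2 - θ)
      (by linarith [p.θ_le_one]) zero_le_one (by linarith) ξ η
    rw [Real.rpow_neg_one] at decay
    have cancel : bracket (ξ - η) ^ (-(1 - θ)) * bracket (ξ - η) ^ (1 - θ) = 1 := by
      rw [← Real.rpow_add difference_pos, neg_add_cancel, Real.rpow_zero]
    rw [plainKernel, abs_of_pos (by positivity)]
    calc (bracket η ^ 2)⁻¹ = 1 * (bracket (ξ - η) ^ (-(1 - θ)) * (bracket η)⁻¹) *
          bracket (ξ - η) ^ (1 - θ) * (bracket η)⁻¹ := by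
          rw [one_mul, mul_right_comm _ (bracket η)⁻¹, cancel]; field_simp
      _ ≤ 1 * decayKernel (2 - θ) ξ η * bracket (ξ - η) ^ (1 - θ) * (bracket η)⁻¹ := by gcongr
  simpa only [mul_one] using p.plainKernel.norm_op_le_of_weights
    (χ := fun ξ => bracket ξ ^ (1 - θ)) (by fun_prop) (by fun_prop)
    (fun ξ => Real.rpow_pos_of_pos (bracket_pos ξ) _) (fun ξ => inv_pos.2 (bracket_pos ξ))
    (by simpa using p.ae_eq_fractional hf 1 t) (hg.ae_eq_inv_one t) zero_le_one kernel_bound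

lemma norm_fractional_le (hf : IsScale f) (k : ℕ) (t : ℝ) {L : ℝ} (hL : 0 < L) :
    ‖p.fractional.op (f (k + 1) t)‖ ≤ L ^ (1 - θ) * ‖f k t‖ + L ^ (-θ) * ‖f (k + 1) t‖ := by
  set low : L2 d := ((L ^ (1 - θ) : ℝ) : ℂ) • f k t with low_def
  set high : L2 d := ((L ^ (-θ) : ℝ) : ℂ) • f (k + 1) t with high_def
  have pointwise : ∀ᵐ ξ, ‖p.fractional.op (f (k + 1) t) ξ‖ ≤ ‖(low + high : L2 d) ξ‖ := by
    filter_upwards [p.fractional.coeFn_op (f (k + 1) t), hf.ae_eq k 1 t, Lp.coeFn_add low high,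
      Lp.coeFn_smul ((L ^ (1 - θ) : ℝ) : ℂ) (f k t),
      Lp.coeFn_smul ((L ^ (-θ) : ℝ) : ℂ) (f (k + 1) t)] with ξ op_ξ succ_ξ add_ξ low_ξ high_ξ
    have ξ_pos := bracket_pos ξ
    have sum_eq : (low + high : L2 d) ξ =
        ((L ^ (1 - θ) + L ^ (-θ) * bracket ξ : ℝ) : ℂ) * f k t ξ := by
      rw [add_ξ, Pi.add_apply, low_ξ, high_ξ, Pi.smul_apply, Pi.smul_apply, succ_ξ]
      push_cast [smul_eq_mul]
      ring
    rw [sum_eq, op_ξ, succ_ξ, fractional, pow_one, ← mul_assoc, ← Complex.ofReal_mul, norm_mul,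
      norm_mul, Complex.norm_real, Complex.norm_real, Real.norm_of_nonneg (by positivity),
      Real.norm_of_nonneg (by positivity)]
    gcongr
    exact rpow_neg_mul_self_le ξ_pos hL p.θ_pos.le p.θ_le_one
  refine (Lp.norm_le_norm_of_ae_le pointwise).trans ((norm_add_le _ _).trans_eq ?_)
  rw [low_def, high_def, norm_smul, norm_smul, Complex.norm_real, Complex.norm_real,
    Real.norm_of_nonneg (by positivity), Real.norm_of_nonneg (by positivity)]

end GevreyParams

/-! ### Energy identities -/

section InnerProduct

variable {F : Type*} [NormedAddCommGroup F] [InnerProductSpace ℂ F]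

lemma re_inner_comm (f g : F) : (inner ℂ f g).re = (inner ℂ g f).re := inner_re_symm (𝕜 := ℂ) f g

lemma abs_re_inner_le (f g : F) : |(inner ℂ f g).re| ≤ ‖f‖ * ‖g‖ :=
  (Complex.abs_re_le_norm _).trans (norm_inner_le_norm f g)

lemma abs_im_inner_le (f g : F) : |(inner ℂ f g).im| ≤ ‖f‖ * ‖g‖ :=
  (Complex.abs_im_le_norm _).trans (norm_inner_le_norm f g)

lemma re_inner_I_smul_self (f : F) : (inner ℂ (Complex.I • f) f).re = 0 := by
  rw [← inner_conj_symm, inner_smul_right, Complex.conj_re, Complex.I_mul_re]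
  exact neg_eq_zero.2 (inner_self_im (𝕜 := ℂ) f)

lemma hasDerivAt_re_inner {f g : ℝ → F} {f' g' : F} {t : ℝ} (hf : HasDerivAt f f' t)
    (hg : HasDerivAt g g' t) :
    HasDerivAt (fun τ => (inner ℂ (f τ) (g τ)).re)
      ((inner ℂ (f t) g').re + (inner ℂ f' (g t)).re) t :=
  Complex.reCLM.hasFDerivAt.comp_hasDerivAt t (hf.inner ℂ hg)

lemma hasDerivAt_norm_sq {f : ℝ → F} {f' : F} {t : ℝ} (hf : HasDerivAt f f' t) :
    HasDerivAt (fun τ => ‖f τ‖ ^ 2) (2 * (inner ℂ (f t) f').re) t := by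
  have deriv_inner := hasDerivAt_re_inner hf hf
  rw [re_inner_comm f', ← two_mul] at deriv_inner
  exact deriv_inner.congr_of_eventuallyEq (.of_forall fun τ => norm_sq_eq_re_inner (𝕜 := ℂ) (f τ))

lemma re_inner_schrodinger {f₀ f₂ : F} (h : (inner ℂ f₀ f₂).im = 0) (q : F) :
    (inner ℂ f₀ (-Complex.I • (f₂ - f₀) + Complex.I • q)).re = -(inner ℂ f₀ q).im := by
  have im_self : (inner ℂ f₀ f₀).im = 0 := inner_self_im (𝕜 := ℂ) f₀
  rw [inner_add_right, inner_smul_right, inner_smul_right, inner_sub_right, neg_mul,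
    Complex.add_re, Complex.neg_re, Complex.I_mul_re, Complex.I_mul_re, Complex.sub_im, h,
    im_self]
  ring

end InnerProduct

lemma I_smul_schrodinger {F : Type*} [AddCommGroup F] [Module ℂ F] (f₀ f₂ q : F) :
    Complex.I • (-Complex.I • (f₂ - f₀) + Complex.I • q) = f₂ - f₀ - q := by
  rw [smul_add, smul_smul, smul_smul, mul_neg, Complex.I_mul_I, neg_neg, one_smul,
    neg_smul, one_smul, sub_eq_add_neg (f₂ - f₀)]

lemma SmoothingKernel.hasDerivAt_op {s : ℝ} (K : SmoothingKernel d s) {f g : ℝ → L2 d}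
    {f' g' : L2 d} {t : ℝ} (hf : HasDerivAt f f' t) (hg : HasDerivAt g g' t) :
    HasDerivAt (fun τ => K.op (f τ) (g τ)) (K.op (f t) g' + K.op f' (g t)) t :=
  (K.op.bilinearRestrictScalars ℝ).hasDerivAt_of_bilinear (fun _ => hf) (fun _ => hg)

lemma IsScale.im_inner_two {f : ℕ → ℝ → L2 d} (hf : IsScale f) (t : ℝ) :
    (inner ℂ (f 0 t) (f 2 t)).im = 0 := by
  rw [hf.inner_shift hf 0 1 1 t]
  exact inner_self_im (𝕜 := ℂ) (f 1 t)

namespace GevreyParams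

variable {θ : ℝ} (p : GevreyParams d θ)

lemma inner_plain_left {b : L2 d} (hb : ∀ᵐ ξ, b (-ξ) = conj (b ξ)) (f g : L2 d) :
    inner ℂ (p.plainKernel.op g b) f = inner ℂ g (p.plainKernel.op f b) :=
  p.plainKernel.inner_op_left_of_hermitian f g b (k := fun η => (bracket η ^ 2)⁻¹)
    (fun _ _ => rfl) (fun η => by rw [bracket_neg]) hb

lemma im_inner_plain_self {b : L2 d} (hb : ∀ᵐ ξ, b (-ξ) = conj (b ξ)) (f : L2 d) :
    (inner ℂ f (p.plainKernel.op f b)).im = 0 := by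
  rw [← Complex.conj_eq_iff_im, inner_conj_symm, p.inner_plain_left hb]

lemma re_inner_plain_left (f g q : L2 d) :
    (inner ℂ (p.plainKernel.op f g) q).re =
      (inner ℂ (p.weightedKernel.op f g) q).re + (inner ℂ (p.errorKernel.op f g) q).re := by
  rw [p.plainKernel_op_eq, inner_add_left, Complex.add_re]

lemma re_inner_plain_right (f g q : L2 d) :
    (inner ℂ q (p.plainKernel.op f g)).re =
      (inner ℂ q (p.weightedKernel.op f g)).re + (inner ℂ q (p.errorKernel.op f g)).re := by
  rw [p.plainKernel_op_eq, inner_add_right, Complex.add_re]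

/-- The Schrödinger flow of a real potential conserves the mass, so that only the commutator of
the weight with the potential contributes. -/
lemma re_inner_schrodinger_weighted {f₀ f₂ b : L2 d} (hb : ∀ᵐ ξ, b (-ξ) = conj (b ξ))
    (h : (inner ℂ f₀ f₂).im = 0) :
    (inner ℂ f₀ (-Complex.I • (f₂ - f₀) + Complex.I • p.weightedKernel.op f₀ b)).re =
      (inner ℂ f₀ (p.errorKernel.op f₀ b)).im := by
  rw [re_inner_schrodinger h, eq_sub_of_add_eq (p.plainKernel_op_eq f₀ b).symm, inner_sub_right,
    Complex.sub_im, p.im_inner_plain_self hb]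
  ring

lemma re_inner_plain_conjReflect {f g : ℕ → ℝ → L2 d} (hf : IsScale f) (hg : IsScale g) (t : ℝ) :
    (inner ℂ (f 0 t) (p.plainKernel.op (f 0 t) (g 2 t))).re =
      (inner ℂ (g 0 t) (p.plainKernel.op (f 0 t) (conjReflect (f 2 t)))).re := by
  rw [re_inner_comm (g 0 t), p.plainKernel.inner_op_eq_inner_op_corr (f 0 t) (f 0 t) (g 2 t)
    (k := fun η => (bracket η ^ 2)⁻¹) (fun _ _ => rfl) (g 0 t) (conjReflect (f 2 t))
    (hg.ae_eq_inv_zero t)]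
  filter_upwards [coeFn_conjReflect (f 2 t), ae_comp_neg (hf 2 t)] with ξ conjReflect_ξ f_two
  have := ofReal_bracket_ne_zero ξ
  rw [conjReflect_ξ, f_two, bracket_neg]
  simp only [map_mul, map_pow, Complex.conj_ofReal]
  push_cast
  field_simp

end GevreyParams

namespace WeightedSolution

variable {θ : ℝ} {p : GevreyParams d θ} {A B D V W : ℕ → ℝ → L2 d}

lemma I_smul_V (h : WeightedSolution p A B D V W) (t : ℝ) :
    Complex.I • V 0 t = A 2 t - A 0 t - p.weightedKernel.op (A 0 t) (B 2 t) := by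
  rw [h.V_eq, I_smul_schrodinger]

lemma hasDerivAt_V (h : WeightedSolution p A B D V W) (t : ℝ) :
    HasDerivAt (V 0) (-Complex.I • (V 2 t - V 0 t) + Complex.I • p.weightedKernel.op (V 0 t) (B 2 t)
      + Complex.I • p.weightedKernel.op (A 0 t) (D 2 t)) t := by
  have linear := ((h.deriv_A 2 t).sub (h.deriv_A 0 t)).const_smul (-Complex.I)
  have nonlinear := (p.weightedKernel.hasDerivAt_op (h.deriv_A 0 t) (h.deriv_B 2 t)).const_smul
    Complex.I
  refine ((linear.add nonlinear).congr_of_eventuallyEq (.of_forall h.V_eq)).congr_deriv ?_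
  rw [smul_add, add_assoc, add_comm (Complex.I • _) (Complex.I • _)]

lemma hasDerivAt_mass (h : WeightedSolution p A B D V W) (t : ℝ) :
    HasDerivAt (fun τ => ‖A 0 τ‖ ^ 2)
      (2 * (inner ℂ (A 0 t) (p.errorKernel.op (A 0 t) (B 2 t))).im) t := by
  rw [← p.re_inner_schrodinger_weighted (h.hermitian_B 2 t) (h.scale_A.im_inner_two t), ← h.V_eq]
  exact hasDerivAt_norm_sq (h.deriv_A 0 t)

lemma hasDerivAt_norm_V (h : WeightedSolution p A B D V W) (t : ℝ) :
    HasDerivAt (fun τ => ‖V 0 τ‖ ^ 2)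
      (2 * ((inner ℂ (V 0 t) (p.errorKernel.op (V 0 t) (B 2 t))).im +
        (inner ℂ (V 0 t) (Complex.I • p.weightedKernel.op (A 0 t) (D 2 t))).re)) t := by
  rw [← p.re_inner_schrodinger_weighted (h.hermitian_B 2 t) (h.scale_V.im_inner_two t),
    ← Complex.add_re, ← inner_add_right]
  exact hasDerivAt_norm_sq (h.hasDerivAt_V t)

lemma hasDerivAt_wave (h : WeightedSolution p A B D V W) (t : ℝ) :
    HasDerivAt (fun τ => ‖B 2 τ‖ ^ 2 + ‖D 1 τ‖ ^ 2)
      (2 * (inner ℂ (D 1 t) (W 1 t + B 3 t)).re) t := by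
  refine ((hasDerivAt_norm_sq (h.deriv_B 2 t)).add
    (hasDerivAt_norm_sq (h.deriv_D 1 t))).congr_deriv ?_
  rw [inner_add_right, Complex.add_re, h.scale_D.inner_shift h.scale_B 1 2 1 t,
    re_inner_comm (D 2 t)]
  ring

lemma wave_source_ae (h : WeightedSolution p A B D V W) (t : ℝ) :
    ((W 1 t + B 3 t : L2 d) : Space d → ℂ) =ᵐ[volume]
      fun ξ => (bracket ξ : ℂ) * p.weightedKernel.op (A 0 t) (conjReflect (A 2 t)) ξ := by
  have source_eq : p.weightedKernel.op (A 0 t) (conjReflect (A 2 t)) = W 0 t + B 2 t := by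
    rw [h.W_eq]; abel
  rw [source_eq]
  filter_upwards [Lp.coeFn_add (W 1 t) (B 3 t), Lp.coeFn_add (W 0 t) (B 2 t),
    h.scale_W 1 t, h.scale_B.ae_eq 2 1 t] with ξ add_one add_zero W_one B_three
  rw [add_one, add_zero, Pi.add_apply, Pi.add_apply, W_one, B_three]
  ring

/-- The energy of the weighted solution: the conserved Hamiltonian of the system, in which the
interaction term `∫ |u|² n` is written through the kernel without weights. -/
def energy (p : GevreyParams d θ) (A B D : ℕ → ℝ → L2 d) (t : ℝ) : ℝ :=
  ‖A 1 t‖ ^ 2 - ‖A 0 t‖ ^ 2 + (‖B 1 t‖ ^ 2 + ‖D 0 t‖ ^ 2) / 2 -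
    (inner ℂ (A 0 t) (p.plainKernel.op (A 0 t) (B 2 t))).re

lemma hasDerivAt_interaction (h : WeightedSolution p A B D V W) (t : ℝ) :
    HasDerivAt (fun τ => (inner ℂ (A 0 τ) (p.plainKernel.op (A 0 τ) (B 2 τ))).re)
      (2 * (inner ℂ (p.plainKernel.op (A 0 t) (B 2 t)) (V 0 t)).re +
        (inner ℂ (D 0 t) (p.plainKernel.op (A 0 t) (conjReflect (A 2 t)))).re) t := by
  refine (hasDerivAt_re_inner (h.deriv_A 0 t)
    (p.plainKernel.hasDerivAt_op (h.deriv_A 0 t) (h.deriv_B 2 t))).congr_deriv ?_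
  rw [inner_add_right, Complex.add_re,
    p.re_inner_plain_conjReflect h.scale_A h.scale_D, ← p.inner_plain_left (h.hermitian_B 2 t),
    re_inner_comm (V 0 t)]
  ring

lemma re_inner_V_eq (h : WeightedSolution p A B D V W) (t : ℝ) :
    (inner ℂ (A 2 t) (V 0 t)).re - (inner ℂ (A 0 t) (V 0 t)).re =
      (inner ℂ (p.weightedKernel.op (A 0 t) (B 2 t)) (V 0 t)).re := by
  have orthogonal := re_inner_I_smul_self (V 0 t)
  rw [h.I_smul_V, inner_sub_left, inner_sub_left, Complex.sub_re, Complex.sub_re] at orthogonal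
  linarith

lemma hasDerivAt_quadratic (h : WeightedSolution p A B D V W) (t : ℝ) :
    HasDerivAt (fun τ => ‖A 1 τ‖ ^ 2 - ‖A 0 τ‖ ^ 2 + (‖B 1 τ‖ ^ 2 + ‖D 0 τ‖ ^ 2) / 2)
      (2 * (inner ℂ (p.weightedKernel.op (A 0 t) (B 2 t)) (V 0 t)).re +
        (inner ℂ (D 0 t) (p.weightedKernel.op (A 0 t) (conjReflect (A 2 t)))).re) t := by
  have deriv_A := (hasDerivAt_norm_sq (h.deriv_A 1 t)).sub (hasDerivAt_norm_sq (h.deriv_A 0 t))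
  have deriv_BD :=
    ((hasDerivAt_norm_sq (h.deriv_B 1 t)).add (hasDerivAt_norm_sq (h.deriv_D 0 t))).div_const 2
  refine (deriv_A.add deriv_BD).congr_deriv ?_
  rw [← h.re_inner_V_eq, h.scale_A.inner_shift h.scale_V 1 0 1 t,
    h.scale_B.inner_shift h.scale_D 1 0 1 t, h.W_eq, inner_add_right, inner_neg_right,
    Complex.add_re, Complex.neg_re, re_inner_comm (D 0 t) (B 2 t)]
  ring

/-- Without weights the energy is conserved; with them only the commutators survive. -/
lemma hasDerivAt_energy (h : WeightedSolution p A B D V W) (t : ℝ) :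
    HasDerivAt (energy p A B D)
      (-(2 * (inner ℂ (p.errorKernel.op (A 0 t) (B 2 t)) (V 0 t)).re +
        (inner ℂ (D 0 t) (p.errorKernel.op (A 0 t) (conjReflect (A 2 t)))).re)) t := by
  refine ((h.hasDerivAt_quadratic t).sub (h.hasDerivAt_interaction t)).congr_deriv ?_
  have split_potential := p.re_inner_plain_left (A 0 t) (B 2 t) (V 0 t)
  have split_source := p.re_inner_plain_right (A 0 t) (conjReflect (A 2 t)) (D 0 t)
  linarith

lemma norm_A_two_le (h : WeightedSolution p A B D V W) (t : ℝ) :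
    ‖A 2 t‖ ≤ ‖A 0 t‖ + ‖V 0 t‖ + convConst d (2 - θ) * ‖A 1 t‖ * ‖B 1 t‖ := by
  have A_two_eq : A 2 t = A 0 t + Complex.I • V 0 t + p.weightedKernel.op (A 0 t) (B 2 t) := by
    rw [h.I_smul_V]; abel
  have norm_I_smul : ‖Complex.I • V 0 t‖ = ‖V 0 t‖ := by rw [norm_smul, Complex.norm_I, one_mul]
  rw [A_two_eq, ← norm_I_smul]
  exact norm_add₃_le.trans (by gcongr; exact p.norm_weighted_le h.scale_A h.scale_B t)

end WeightedSolution

/-! ### The continuity argument -/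

lemma nonpos_of_bootstrap_of_nonneg {φ : ℝ → ℝ} (hφ : Continuous φ) (h0 : φ 0 < 0) {T : ℝ}
    (improve : ∀ t, 0 ≤ t → t ≤ T → (∀ τ ∈ Set.Icc 0 t, φ τ ≤ 0) → φ t < 0) {t : ℝ}
    (ht0 : 0 ≤ t) (htT : t ≤ T) : φ t ≤ 0 := by
  by_contra! pos
  have compact : IsCompact (Set.Icc 0 T ∩ φ ⁻¹' Set.Ici 0) :=
    isCompact_Icc.inter_right (isClosed_Ici.preimage hφ)
  obtain ⟨r, ⟨⟨r_nonneg, r_le⟩, φ_r_nonneg⟩, r_least⟩ :=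
    compact.exists_isLeast ⟨t, ⟨ht0, htT⟩, pos.le⟩
  have neg_before (τ : ℝ) (τ_nonneg : 0 ≤ τ) (τ_lt : τ < r) : φ τ < 0 := by
    by_contra! φ_τ_nonneg
    exact absurd (r_least ⟨⟨τ_nonneg, τ_lt.le.trans r_le⟩, φ_τ_nonneg⟩) (not_le.2 τ_lt)
  have r_pos : 0 < r := r_nonneg.lt_of_ne (by rintro rfl; exact absurd φ_r_nonneg (not_le.2 h0))
  have φ_r_nonpos : φ r ≤ 0 := by
    refine le_of_tendsto (hφ.continuousAt.mono_left (nhdsWithin_le_nhds (s := Set.Iio r))) ?_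
    filter_upwards [Ioo_mem_nhdsLT r_pos] with τ hτ
    exact (neg_before τ hτ.1.le hτ.2).le
  refine absurd (improve r r_nonneg r_le fun τ hτ => ?_) (not_lt.2 φ_r_nonneg)
  rcases hτ.2.eq_or_lt with rfl | τ_lt
  · exact φ_r_nonpos
  · exact (neg_before τ hτ.1 τ_lt).le

lemma nonpos_of_bootstrap {φ : ℝ → ℝ} (hφ : Continuous φ) (h0 : φ 0 < 0) {T : ℝ}
    (improve : ∀ t, |t| ≤ T → (∀ τ ∈ Set.uIcc 0 t, φ τ ≤ 0) → φ t < 0) {t : ℝ} (ht : |t| ≤ T) :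
    φ t ≤ 0 := by
  rcases le_total 0 t with t_nonneg | t_nonpos
  · refine nonpos_of_bootstrap_of_nonneg hφ h0 (fun r r_nonneg r_le bound => ?_) t_nonneg
      ((le_abs_self t).trans ht)
    refine improve r (by rwa [abs_of_nonneg r_nonneg]) ?_
    rwa [Set.uIcc_of_le r_nonneg]
  · rw [← neg_neg t]
    refine nonpos_of_bootstrap_of_nonneg (φ := fun r => φ (-r)) (T := T) (by fun_prop)
      (by simpa only [neg_zero] using h0) (fun r r_nonneg r_le bound => ?_)
      (neg_nonneg.2 t_nonpos) (by rwa [← abs_of_nonpos t_nonpos])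
    refine improve (-r) (by rwa [abs_neg, abs_of_nonneg r_nonneg]) fun τ hτ => ?_
    rw [Set.uIcc_of_ge (neg_nonpos.2 r_nonneg)] at hτ
    simpa only [neg_neg] using bound (-τ) ⟨by linarith [hτ.2], by linarith [hτ.1]⟩

lemma abs_sub_le_of_hasDerivAt {f f' : ℝ → ℝ} {C t : ℝ} (hf : ∀ τ, HasDerivAt f (f' τ) τ)
    (bound : ∀ τ ∈ Set.uIcc 0 t, |f' τ| ≤ C) : |f t - f 0| ≤ C * |t| := by
  simpa only [Real.norm_eq_abs, sub_zero] using
    (convex_uIcc 0 t).norm_image_sub_le_of_norm_hasDerivWithin_le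
      (fun τ _ => (hf τ).hasDerivWithinAt) bound Set.left_mem_uIcc Set.right_mem_uIcc

/-! ### A priori bounds -/

/-- The bounds propagated by the continuity argument: `K` on the norms controlled by mass and
energy, and the larger, time-dependent `L` on the norms that are one order higher. -/
structure NormBounds (A B D V : ℕ → ℝ → L2 d) (K L t : ℝ) : Prop where
  A_one : ‖A 1 t‖ ≤ K
  B_one : ‖B 1 t‖ ≤ K
  D_zero : ‖D 0 t‖ ≤ K
  V_zero : ‖V 0 t‖ ≤ L
  B_two : ‖B 2 t‖ ≤ L
  D_one : ‖D 1 t‖ ≤ L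

/-- The quantity whose sign the continuity argument propagates: it is nonpositive when the first
order norms are bounded by `K` and the second order norms by `L`. -/
def excess (A B D V : ℕ → ℝ → L2 d) (K L t : ℝ) : ℝ :=
  max (‖A 1 t‖ ^ 2 + ‖B 1 t‖ ^ 2 + ‖D 0 t‖ ^ 2 - K ^ 2)
    (max (‖V 0 t‖ ^ 2 - L ^ 2) (‖B 2 t‖ ^ 2 + ‖D 1 t‖ ^ 2 - L ^ 2))

lemma NormBounds.of_excess_nonpos {A B D V : ℕ → ℝ → L2 d} {K L t : ℝ} (hK : 0 ≤ K) (hL : 0 ≤ L)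
    (h : excess A B D V K L t ≤ 0) : NormBounds A B D V K L t := by
  obtain ⟨first, V_sq, wave⟩ : _ ∧ _ ∧ _ := by
    simpa only [excess, max_le_iff, sub_nonpos] using h
  have := sq_nonneg ‖A 1 t‖
  have := sq_nonneg ‖B 1 t‖
  have := sq_nonneg ‖D 0 t‖
  have := sq_nonneg ‖B 2 t‖
  have := sq_nonneg ‖D 1 t‖
  constructor <;> refine (sq_le_sq₀ (norm_nonneg _) (by assumption)).1 ?_ <;> linarith

/-- The constant in the growth rate of the second order norms, see `abs_norm_V_sub_le` and
`abs_wave_sub_le`. -/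
def growthConst (d : ℕ) (θ K : ℝ) : ℝ :=
  2 * convConst d (2 - θ) * K * (2 * K + 1 + convConst d (2 - θ) * K ^ 2)

/-- A constant dominating all contributions of the commutator. -/
def errorConst (d : ℕ) (θ K : ℝ) : ℝ := convConst d (2 - θ) * (8 + 2 * K ^ 2 + 3 * K ^ 3)

namespace WeightedSolution

variable {θ : ℝ} {p : GevreyParams d θ} {A B D V W : ℕ → ℝ → L2 d} {K L t : ℝ}

lemma norm_error_A_le (h : WeightedSolution p A B D V W) (hb : NormBounds A B D V K L t) :
    ‖p.errorKernel.op (A 0 t) (B 2 t)‖ ≤ convConst d (2 - θ) * p.gain * K * K := by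
  have := convConst_nonneg d (2 - θ)
  have := p.gain_nonneg
  have := (norm_nonneg _).trans hb.A_one
  refine (p.norm_error_le h.scale_A h.scale_B t).trans ?_
  gcongr
  exacts [hb.A_one, hb.B_one]

lemma norm_fractional_A_le (h : WeightedSolution p A B D V W) (hb : NormBounds A B D V K L t)
    (hL : 1 ≤ L) : ‖p.fractional.op (A 2 t)‖ ≤
      L ^ (1 - θ) * (2 * K + 1 + convConst d (2 - θ) * K ^ 2) := by
  have C_nonneg := convConst_nonneg d (2 - θ)
  have L_pos : 0 < L := by linarith
  have K_nonneg : 0 ≤ K := (norm_nonneg _).trans hb.A_one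
  have A_two_le : ‖A 2 t‖ ≤ L * (K + 1 + convConst d (2 - θ) * K ^ 2) :=
    calc ‖A 2 t‖ ≤ ‖A 0 t‖ + ‖V 0 t‖ + convConst d (2 - θ) * ‖A 1 t‖ * ‖B 1 t‖ := h.norm_A_two_le t
      _ ≤ 1 * K + L + 1 * (convConst d (2 - θ) * K * K) := by
          rw [one_mul, one_mul]
          gcongr
          exacts [(h.scale_A.norm_le_succ 0 t).trans hb.A_one, hb.V_zero, hb.A_one, hb.B_one]
      _ ≤ L * K + L + L * (convConst d (2 - θ) * K * K) := by gcongr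
      _ = L * (K + 1 + convConst d (2 - θ) * K ^ 2) := by ring
  have absorb : L ^ (-θ) * L = L ^ (1 - θ) := by
    rw [sub_eq_neg_add, Real.rpow_add L_pos, Real.rpow_one]
  calc ‖p.fractional.op (A 2 t)‖ ≤ L ^ (1 - θ) * ‖A 1 t‖ + L ^ (-θ) * ‖A 2 t‖ :=
        p.norm_fractional_le h.scale_A 1 t L_pos
    _ ≤ L ^ (1 - θ) * K + L ^ (-θ) * (L * (K + 1 + convConst d (2 - θ) * K ^ 2)) := by
        gcongr
        exact hb.A_one
    _ = L ^ (1 - θ) * (2 * K + 1 + convConst d (2 - θ) * K ^ 2) := by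
        rw [← mul_assoc, absorb]; ring

lemma abs_mass_sub_le (h : WeightedSolution p A B D V W)
    (hb : ∀ τ ∈ Set.uIcc 0 t, NormBounds A B D V K L τ) :
    |‖A 0 t‖ ^ 2 - ‖A 0 0‖ ^ 2| ≤ p.gain * (2 * convConst d (2 - θ) * K ^ 3) * |t| := by
  refine abs_sub_le_of_hasDerivAt h.hasDerivAt_mass fun τ hτ => ?_
  have A_zero_le := (h.scale_A.norm_le_succ 0 τ).trans (hb τ hτ).A_one
  have K_nonneg := (norm_nonneg _).trans A_zero_le
  rw [abs_mul, abs_two]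
  calc 2 * |(inner ℂ (A 0 τ) (p.errorKernel.op (A 0 τ) (B 2 τ))).im|
      ≤ 2 * (‖A 0 τ‖ * ‖p.errorKernel.op (A 0 τ) (B 2 τ)‖) := by
        gcongr; exact abs_im_inner_le _ _
    _ ≤ 2 * (K * (convConst d (2 - θ) * p.gain * K * K)) := by
        gcongr; exact h.norm_error_A_le (hb τ hτ)
    _ = p.gain * (2 * convConst d (2 - θ) * K ^ 3) := by ring

lemma abs_energy_sub_le (h : WeightedSolution p A B D V W) (hL : 1 ≤ L)
    (hb : ∀ τ ∈ Set.uIcc 0 t, NormBounds A B D V K L τ) :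
    |energy p A B D t - energy p A B D 0| ≤
      p.gain * L * (convConst d (2 - θ) * (2 * K ^ 2 + K ^ 3)) * |t| := by
  refine abs_sub_le_of_hasDerivAt h.hasDerivAt_energy fun τ hτ => ?_
  have bounds := hb τ hτ
  have C_nonneg := convConst_nonneg d (2 - θ)
  have gain_nonneg := p.gain_nonneg
  have K_nonneg := (norm_nonneg _).trans bounds.A_one
  have error_source : ‖p.errorKernel.op (A 0 τ) (conjReflect (A 2 τ))‖ ≤
      convConst d (2 - θ) * p.gain * K * K := by
    refine (p.norm_error_le h.scale_A h.scale_A.conjReflect τ).trans ?_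
    rw [norm_conjReflect]
    gcongr
    exacts [bounds.A_one, bounds.A_one]
  have source_le : ‖D 0 τ‖ * ‖p.errorKernel.op (A 0 τ) (conjReflect (A 2 τ))‖ ≤
      K * (convConst d (2 - θ) * p.gain * K * K) * L :=
    (mul_le_mul bounds.D_zero error_source (norm_nonneg _) K_nonneg).trans
      (le_mul_of_one_le_right (by positivity) hL)
  have potential_le : ‖p.errorKernel.op (A 0 τ) (B 2 τ)‖ * ‖V 0 τ‖ ≤
      convConst d (2 - θ) * p.gain * K * K * L :=
    mul_le_mul (h.norm_error_A_le bounds) bounds.V_zero (norm_nonneg _) (by positivity)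
  rw [abs_neg]
  refine (abs_add_le _ _).trans ?_
  rw [abs_mul, abs_two]
  linarith [abs_re_inner_le (p.errorKernel.op (A 0 τ) (B 2 τ)) (V 0 τ),
    abs_re_inner_le (D 0 τ) (p.errorKernel.op (A 0 τ) (conjReflect (A 2 τ)))]

lemma abs_norm_V_sub_le (h : WeightedSolution p A B D V W) (hL : 1 ≤ L)
    (hb : ∀ τ ∈ Set.uIcc 0 t, NormBounds A B D V K L τ) :
    |‖V 0 t‖ ^ 2 - ‖V 0 0‖ ^ 2| ≤ (p.gain * L * (2 * convConst d (2 - θ) * L ^ 2) +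
      L * L ^ (1 - θ) * growthConst d θ K) * |t| := by
  refine abs_sub_le_of_hasDerivAt h.hasDerivAt_norm_V fun τ hτ => ?_
  have bounds := hb τ hτ
  have C_nonneg := convConst_nonneg d (2 - θ)
  have gain_nonneg := p.gain_nonneg
  have : 0 < L := by linarith
  have K_nonneg := (norm_nonneg _).trans bounds.A_one
  have error_le : |(inner ℂ (V 0 τ) (p.errorKernel.op (V 0 τ) (B 2 τ))).im| ≤
      L * (convConst d (2 - θ) * p.gain * L * L) := by
    refine (abs_im_inner_le _ _).trans ?_
    gcongr
    · exact bounds.V_zero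
    · refine (p.errorKernel.norm_op_le (V 0 τ) (B 2 τ)).trans ?_
      gcongr
      exacts [le_rfl, bounds.V_zero, bounds.B_two]
  have source_le : |(inner ℂ (V 0 τ) (Complex.I • p.weightedKernel.op (A 0 τ) (D 2 τ))).re| ≤
      L * (convConst d (2 - θ) *
        (L ^ (1 - θ) * (2 * K + 1 + convConst d (2 - θ) * K ^ 2)) * K) := by
    refine (abs_re_inner_le _ _).trans ?_
    rw [norm_smul, Complex.norm_I, one_mul]
    gcongr
    · exact bounds.V_zero
    · refine (p.norm_weighted_le_fractional h.scale_A h.scale_D τ).trans ?_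
      gcongr
      exacts [h.norm_fractional_A_le bounds hL, bounds.D_zero]
  rw [abs_mul, abs_two]
  calc 2 * |_ + _| ≤ 2 * (L * (convConst d (2 - θ) * p.gain * L * L) +
        L * (convConst d (2 - θ) *
          (L ^ (1 - θ) * (2 * K + 1 + convConst d (2 - θ) * K ^ 2)) * K)) := by
        gcongr
        exact (abs_add_le _ _).trans (add_le_add error_le source_le)
    _ = _ := by rw [growthConst]; ring

lemma abs_wave_sub_le (h : WeightedSolution p A B D V W) (hL : 1 ≤ L)
    (hb : ∀ τ ∈ Set.uIcc 0 t, NormBounds A B D V K L τ) :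
    |(‖B 2 t‖ ^ 2 + ‖D 1 t‖ ^ 2) - (‖B 2 0‖ ^ 2 + ‖D 1 0‖ ^ 2)| ≤
      L * L ^ (1 - θ) * (2 * growthConst d θ K) * |t| := by
  refine abs_sub_le_of_hasDerivAt h.hasDerivAt_wave fun τ hτ => ?_
  have bounds := hb τ hτ
  have C_nonneg := convConst_nonneg d (2 - θ)
  have : 0 < L := by linarith
  have K_nonneg := (norm_nonneg _).trans bounds.A_one
  have source_le : ‖W 1 τ + B 3 τ‖ ≤ convConst d (2 - θ) * 2 * K *
      (L ^ (1 - θ) * (2 * K + 1 + convConst d (2 - θ) * K ^ 2)) := by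
    refine (p.norm_bracket_weighted_le h.scale_A τ (h.wave_source_ae τ)).trans ?_
    rw [p.norm_fractional_conjReflect]
    gcongr
    exacts [bounds.A_one, h.norm_fractional_A_le bounds hL]
  rw [abs_mul, abs_two]
  calc 2 * |(inner ℂ (D 1 τ) (W 1 τ + B 3 τ)).re| ≤ 2 * (‖D 1 τ‖ * ‖W 1 τ + B 3 τ‖) := by
        gcongr; exact abs_re_inner_le _ _
    _ ≤ 2 * (L * (convConst d (2 - θ) * 2 * K *
          (L ^ (1 - θ) * (2 * K + 1 + convConst d (2 - θ) * K ^ 2)))) := by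
        gcongr; exact bounds.D_one
    _ = L * L ^ (1 - θ) * (2 * growthConst d θ K) := by rw [growthConst]; ring

lemma abs_interaction_le (h : WeightedSolution p A B D V W) (t : ℝ) {l : ℝ} (hl : 0 < l) :
    |(inner ℂ (A 0 t) (p.plainKernel.op (A 0 t) (B 2 t))).re| ≤ ‖A 0 t‖ *
      (convConst d (2 - θ) * (l ^ (1 - θ) * ‖A 0 t‖ + l ^ (-θ) * ‖A 1 t‖) * ‖B 1 t‖) := by
  have := convConst_nonneg d (2 - θ)
  refine (abs_re_inner_le _ _).trans ?_
  gcongr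
  refine (p.norm_plain_le h.scale_A h.scale_B t).trans ?_
  gcongr
  exact p.norm_fractional_le h.scale_A 0 t hl

-- The choice of `l` makes half of `‖A 1 t‖ * ‖B 1 t‖` absorb the top order part of the interaction.
lemma sum_sq_le (h : WeightedSolution p A B D V W) (t : ℝ) {m l e : ℝ} (hl : 0 < l)
    (hm : ‖A 0 t‖ ≤ m) (absorb : convConst d (2 - θ) * m * l ^ (-θ) ≤ 1 / 2)
    (he : energy p A B D t + ‖A 0 t‖ ^ 2 ≤ e) :
    ‖A 1 t‖ ^ 2 + ‖B 1 t‖ ^ 2 + ‖D 0 t‖ ^ 2 ≤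
      8 * (e + 2 * (convConst d (2 - θ) * m ^ 2 * l ^ (1 - θ)) ^ 2) := by
  set C := convConst d (2 - θ)
  have C_nonneg : 0 ≤ C := convConst_nonneg d (2 - θ)
  have m_nonneg : 0 ≤ m := (norm_nonneg _).trans hm
  have interaction_le : (inner ℂ (A 0 t) (p.plainKernel.op (A 0 t) (B 2 t))).re ≤
      C * m ^ 2 * l ^ (1 - θ) * ‖B 1 t‖ + 1 / 2 * (‖A 1 t‖ * ‖B 1 t‖) :=
    calc (inner ℂ (A 0 t) (p.plainKernel.op (A 0 t) (B 2 t))).re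
      ≤ ‖A 0 t‖ * (C * (l ^ (1 - θ) * ‖A 0 t‖ + l ^ (-θ) * ‖A 1 t‖) * ‖B 1 t‖) :=
          le_of_abs_le (h.abs_interaction_le t hl)
      _ ≤ m * (C * (l ^ (1 - θ) * m + l ^ (-θ) * ‖A 1 t‖) * ‖B 1 t‖) := by gcongr
      _ = C * m ^ 2 * l ^ (1 - θ) * ‖B 1 t‖ + C * m * l ^ (-θ) * (‖A 1 t‖ * ‖B 1 t‖) := by ring
      _ ≤ C * m ^ 2 * l ^ (1 - θ) * ‖B 1 t‖ + 1 / 2 * (‖A 1 t‖ * ‖B 1 t‖) := by gcongr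
  rw [energy] at he
  set x := ‖A 1 t‖
  set y := ‖B 1 t‖
  set c := C * m ^ 2 * l ^ (1 - θ)
  linarith [sq_nonneg (x - y), sq_nonneg (y - 4 * c), sq_nonneg x, sq_nonneg ‖D 0 t‖, sub_sq x y,
    sub_sq y (4 * c), sq_nonneg y]

/-- Mass and energy at time `t` below the initial ones plus `1` force the first order norms at
time `t` below `K`. -/
def Coercive (p : GevreyParams d θ) (A B D : ℕ → ℝ → L2 d) (K : ℝ) : Prop :=
  ∀ t, ‖A 0 t‖ ^ 2 ≤ ‖A 0 0‖ ^ 2 + 1 → energy p A B D t ≤ energy p A B D 0 + 1 →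
    ‖A 1 t‖ ^ 2 + ‖B 1 t‖ ^ 2 + ‖D 0 t‖ ^ 2 < K ^ 2

lemma energy_zero_add_mass_le (h : WeightedSolution p A B D V W) {N : ℝ}
    (hN : NormBounds A B D V N N 0) :
    energy p A B D 0 + ‖A 0 0‖ ^ 2 ≤ 2 * N ^ 2 + 2 * convConst d (2 - θ) * N ^ 3 := by
  set C := convConst d (2 - θ)
  have C_nonneg : 0 ≤ C := convConst_nonneg d (2 - θ)
  have A_zero_le : ‖A 0 0‖ ≤ N := (h.scale_A.norm_le_succ 0 0).trans hN.A_one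
  have interaction_ge : -(2 * C * N ^ 3) ≤
      (inner ℂ (A 0 0) (p.plainKernel.op (A 0 0) (B 2 0))).re := by
    refine neg_le_of_abs_le ((h.abs_interaction_le 0 one_pos).trans ?_)
    rw [Real.one_rpow, Real.one_rpow, one_mul, one_mul]
    calc ‖A 0 0‖ * (C * (‖A 0 0‖ + ‖A 1 0‖) * ‖B 1 0‖) ≤ N * (C * (N + N) * N) := by
          have N_nonneg := (norm_nonneg _).trans hN.A_one
          gcongr
          exacts [hN.A_one, hN.B_one]
      _ = 2 * C * N ^ 3 := by ring
  have A_sq := pow_le_pow_left₀ (norm_nonneg _) hN.A_one 2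
  have B_sq := pow_le_pow_left₀ (norm_nonneg _) hN.B_one 2
  have D_sq := pow_le_pow_left₀ (norm_nonneg _) hN.D_zero 2
  rw [energy]
  linarith

lemma exists_coercive (d : ℕ) {θ : ℝ} (hθ : 0 < θ) {N : ℝ} (hN : 0 ≤ N) :
    ∃ K, 0 ≤ K ∧ ∀ (p : GevreyParams d θ) (A B D V W : ℕ → ℝ → L2 d),
      WeightedSolution p A B D V W → NormBounds A B D V N N 0 → Coercive p A B D K := by
  set C := convConst d (2 - θ)
  have C_nonneg : 0 ≤ C := convConst_nonneg d (2 - θ)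
  set m := N + 1
  set e := 2 * N ^ 2 + 2 * C * N ^ 3 + 2
  set l := (2 * (C * m + 1)) ^ (1 / θ) with l_def
  have absorb : C * m * l ^ (-θ) ≤ 1 / 2 := by
    rw [l_def, ← Real.rpow_mul (by positivity), mul_neg, one_div_mul_cancel hθ.ne',
      Real.rpow_neg_one, ← div_eq_mul_inv, div_le_iff₀ (by positivity)]
    linarith
  set X := 8 * (e + 2 * (C * m ^ 2 * l ^ (1 - θ)) ^ 2)
  refine ⟨√(X + 1), Real.sqrt_nonneg _, fun p A B D V W h bounds t mass_le energy_le => ?_⟩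
  have A_zero_le : ‖A 0 0‖ ≤ N := (h.scale_A.norm_le_succ 0 0).trans bounds.A_one
  have A_le : ‖A 0 t‖ ≤ m := by
    refine (abs_le_of_sq_le_sq' (mass_le.trans ?_) (by positivity)).2
    linarith [pow_le_pow_left₀ (norm_nonneg _) A_zero_le 2, add_sq N 1]
  have energy_add_mass_le : energy p A B D t + ‖A 0 t‖ ^ 2 ≤ e := by
    linarith [h.energy_zero_add_mass_le bounds]
  rw [Real.sq_sqrt (by positivity)]
  linarith [h.sum_sq_le t (by positivity) A_le absorb energy_add_mass_le]

lemma continuous_excess (h : WeightedSolution p A B D V W) : Continuous (excess A B D V K L) := by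
  have continuous_A (k) : Continuous (A k) :=
    continuous_iff_continuousAt.2 fun t => (h.deriv_A k t).continuousAt
  have continuous_B (k) : Continuous (B k) :=
    continuous_iff_continuousAt.2 fun t => (h.deriv_B k t).continuousAt
  have continuous_D (k) : Continuous (D k) :=
    continuous_iff_continuousAt.2 fun t => (h.deriv_D k t).continuousAt
  have continuous_V_sq : Continuous fun t => ‖V 0 t‖ ^ 2 :=
    continuous_iff_continuousAt.2 fun t => (h.hasDerivAt_norm_V t).continuousAt
  unfold excess
  fun_prop

lemma excess_neg (h : WeightedSolution p A B D V W) (coercive : Coercive p A B D K) (hL : 1 ≤ L)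
    {t : ℝ} (error_small : p.gain * L * |t| * errorConst d θ K ≤ 1)
    (growth_small : L ^ (1 - θ) * |t| * growthConst d θ K ≤ L / 4)
    (V_zero : ‖V 0 0‖ ^ 2 < L ^ 2 / 2) (wave_zero : ‖B 2 0‖ ^ 2 + ‖D 1 0‖ ^ 2 < L ^ 2 / 2)
    (bounds : ∀ τ ∈ Set.uIcc 0 t, NormBounds A B D V K L τ) : excess A B D V K L t < 0 := by
  have C_nonneg := convConst_nonneg d (2 - θ)
  have gain_nonneg := p.gain_nonneg
  have K_nonneg := (norm_nonneg _).trans (bounds t Set.right_mem_uIcc).A_one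
  set y := p.gain * L * |t| * convConst d (2 - θ)
  have y_nonneg : 0 ≤ y := by positivity
  rw [errorConst, ← mul_assoc] at error_small
  have growth_le : L * L ^ (1 - θ) * growthConst d θ K * |t| ≤ L ^ 2 / 4 :=
    calc L * L ^ (1 - θ) * growthConst d θ K * |t|
      = L * (L ^ (1 - θ) * |t| * growthConst d θ K) := by ring
      _ ≤ L * (L / 4) := by gcongr
      _ = L ^ 2 / 4 := by ring
  have K_sq : 0 ≤ y * K ^ 2 := by positivity
  have K_cube : 0 ≤ y * K ^ 3 := by positivity
  refine max_lt (sub_neg.2 (coercive t ?_ ?_)) (max_lt ?_ ?_)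
  · have : p.gain * (2 * convConst d (2 - θ) * K ^ 3) * |t| ≤ 2 * (y * K ^ 3) :=
      calc p.gain * (2 * convConst d (2 - θ) * K ^ 3) * |t|
        ≤ p.gain * (2 * convConst d (2 - θ) * K ^ 3) * |t| * L :=
            le_mul_of_one_le_right (by positivity) hL
        _ = 2 * (y * K ^ 3) := by ring
    linarith [le_of_abs_le (h.abs_mass_sub_le bounds)]
  · linarith [le_of_abs_le (h.abs_energy_sub_le hL bounds)]
  · have : p.gain * L * (2 * convConst d (2 - θ) * L ^ 2) * |t| ≤ 1 / 4 * L ^ 2 :=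
      calc p.gain * L * (2 * convConst d (2 - θ) * L ^ 2) * |t| = 2 * y * L ^ 2 := by ring
        _ ≤ 1 / 4 * L ^ 2 := by gcongr; linarith
    linarith [le_of_abs_le (h.abs_norm_V_sub_le hL bounds)]
  · linarith [le_of_abs_le (h.abs_wave_sub_le hL bounds)]

lemma normBounds_of_small (h : WeightedSolution p A B D V W) (coercive : Coercive p A B D K)
    (hK : 0 ≤ K) (hL : 1 ≤ L) {T : ℝ} (error_small : p.gain * L * T * errorConst d θ K ≤ 1)
    (growth_small : L ^ (1 - θ) * T * growthConst d θ K ≤ L / 4)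
    (V_zero : ‖V 0 0‖ ^ 2 < L ^ 2 / 2) (wave_zero : ‖B 2 0‖ ^ 2 + ‖D 1 0‖ ^ 2 < L ^ 2 / 2)
    {t : ℝ} (ht : |t| ≤ T) : NormBounds A B D V K L t := by
  have C_nonneg := convConst_nonneg d (2 - θ)
  have gain_nonneg := p.gain_nonneg
  have errorConst_nonneg : 0 ≤ errorConst d θ K := by unfold errorConst; positivity
  have growthConst_nonneg : 0 ≤ growthConst d θ K := by unfold growthConst; positivity
  refine .of_excess_nonpos hK (by linarith)
    (nonpos_of_bootstrap h.continuous_excess ?_ (fun r hr nonpos => ?_) ht)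
  · exact max_lt (by linarith [coercive 0 (by linarith) (by linarith)])
      (max_lt (by linarith [sq_nonneg L]) (by linarith [sq_nonneg L]))
  · exact h.excess_neg coercive hL (error_small.trans' (by gcongr))
      (growth_small.trans' (by gcongr)) V_zero wave_zero
      fun τ hτ => .of_excess_nonpos hK (by linarith) (nonpos τ hτ)

end WeightedSolution

lemma exists_scale {θ : ℝ} (hθ : 0 < θ) (hθ₁ : θ ≤ 1) {E S N : ℝ} (hE : 0 ≤ E) (hS : 0 ≤ S)
    (hN : 0 ≤ N) : ∃ c > 0, ∀ g T : ℝ, 1 ≤ T → g * T ^ (1 + 1 / θ) ≤ c →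
      ∃ L, 1 ≤ L ∧ N ≤ L ∧ g * L * T * E ≤ 1 ∧ L ^ (1 - θ) * T * S ≤ L / 4 := by
  set b := 1 + N + 4 * S
  have b_pos : 0 < b := by positivity
  refine ⟨1 / ((E + 1) * b ^ (1 / θ)), by positivity, fun g T hT small => ?_⟩
  have T_pos : 0 < T := by linarith
  set L := (b * T) ^ (1 / θ) with L_def
  have L_pos : 0 < L := by positivity
  have b_le : b ≤ b * T := le_mul_of_one_le_right b_pos.le hT
  have le_L : b * T ≤ L := by
    refine Real.self_le_rpow_of_one_le ?_ ((one_le_div hθ).2 hθ₁)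
    linarith
  refine ⟨L, by linarith, by linarith, ?_, ?_⟩
  · have LT_eq : L * T = b ^ (1 / θ) * T ^ (1 + 1 / θ) := by
      rw [L_def, Real.mul_rpow b_pos.le T_pos.le, Real.rpow_add T_pos, Real.rpow_one]
      ring
    calc g * L * T * E = g * T ^ (1 + 1 / θ) * b ^ (1 / θ) * E := by rw [mul_assoc g, LT_eq]; ring
      _ ≤ 1 / ((E + 1) * b ^ (1 / θ)) * b ^ (1 / θ) * E := by gcongr
      _ = E / (E + 1) := by field_simp
      _ ≤ 1 := div_le_one_of_le₀ (by linarith) (by positivity)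
  · have L_rpow : L ^ θ = b * T := by
      rw [L_def, ← Real.rpow_mul (by positivity), one_div_mul_cancel hθ.ne', Real.rpow_one]
    rw [Real.rpow_sub L_pos, Real.rpow_one, L_rpow]
    calc L / (b * T) * T * S = L * (S / b) := by field_simp
      _ ≤ L * (1 / 4) :=
          mul_le_mul_of_nonneg_left ((div_le_iff₀ b_pos).2 (by linarith)) L_pos.le
      _ = L / 4 := by ring

theorem exists_uniform_bound (d : ℕ) {θ : ℝ} (hθ : 0 < θ) (hθ₁ : θ ≤ 1) {N : ℝ} (hN : 0 ≤ N) :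
    ∃ K, ∃ c > 0, ∀ (p : GevreyParams d θ) (A B D V W : ℕ → ℝ → L2 d),
      WeightedSolution p A B D V W → NormBounds A B D V N N 0 →
      ∀ T : ℝ, 1 ≤ T → p.gain * T ^ (1 + 1 / θ) ≤ c →
      ∀ t : ℝ, |t| ≤ T → ‖A 1 t‖ ≤ K ∧ ‖B 1 t‖ ≤ K ∧ ‖D 0 t‖ ≤ K := by
  obtain ⟨K, K_nonneg, coercive⟩ := WeightedSolution.exists_coercive d hθ hN
  have C_nonneg := convConst_nonneg d (2 - θ)
  obtain ⟨c, c_pos, scale⟩ := exists_scale hθ hθ₁ (E := errorConst d θ K)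
    (S := growthConst d θ K) (N := 2 * N + 1) (by unfold errorConst; positivity)
    (by unfold growthConst; positivity) (by positivity)
  refine ⟨K, c, c_pos, fun p A B D V W h bounds T hT small t ht => ?_⟩
  obtain ⟨L, one_le_L, le_L, error_small, growth_small⟩ := scale _ T hT small
  have L_sq : (2 * N + 1) ^ 2 ≤ L ^ 2 := pow_le_pow_left₀ (by positivity) le_L 2
  have N_sq := sq_nonneg N
  have V_sq := pow_le_pow_left₀ (norm_nonneg _) bounds.V_zero 2
  have B_sq := pow_le_pow_left₀ (norm_nonneg _) bounds.B_two 2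
  have D_sq := pow_le_pow_left₀ (norm_nonneg _) bounds.D_one 2
  have later := h.normBounds_of_small (coercive p A B D V W h bounds) K_nonneg one_le_L error_small
    growth_small (by linarith) (by linarith) ht
  exact ⟨later.A_one, later.B_one, later.D_zero⟩

/-! ### Weighted norms and Gevrey norms -/

lemma gevreyNorm_congr_ae {f g : Space d → ℂ} (h : f =ᵐ[volume] g) (σ r : ℝ) :
    gevreyNorm σ r f = gevreyNorm σ r g := by
  by_cases hg : MemLp g 2 volume
  · have hf : MemLp f 2 volume := hg.ae_eq h.symm
    rw [gevreyNorm, gevreyNorm, dif_pos hf, dif_pos hg, (MemLp.toLp_eq_toLp_iff hf hg).2 h]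
  · have hf : ¬MemLp f 2 volume := fun hf => hg (hf.ae_eq h)
    rw [gevreyNorm, gevreyNorm, dif_neg hf, dif_neg hg]

lemma IsProfile.gevreyNorm_eq {f : ℝ → Space d → ℂ} {a : ℕ → ℝ → L2 d} (h : IsProfile f a)
    (σ r t : ℝ) : gevreyNorm σ r (f t) =
      eLpNorm (fun ξ => ((Real.exp (σ * taxicab ξ) * bracket ξ ^ r : ℝ) : ℂ) * a 0 t ξ) 2
        volume := by
  obtain ⟨hf, a_eq⟩ := h.fourier t
  rw [gevreyNorm, dif_pos hf, ← a_eq]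
  rfl

lemma bracket_le_one_add_taxicab (ξ : Space d) : bracket ξ ≤ 1 + taxicab ξ := by
  have taxicab_nonneg := taxicab_nonneg ξ
  have norm_sq_le : ‖(2 * Real.pi) • ξ‖ ^ 2 ≤ taxicab ξ ^ 2 := by
    rw [EuclideanSpace.norm_sq_eq]
    exact Finset.sum_sq_le_sq_sum_of_nonneg fun i _ => abs_nonneg _
  rw [bracket]
  refine (Real.sqrt_le_left (by linarith)).2 ?_
  linarith [add_sq 1 (taxicab ξ)]

lemma exists_bracket_rpow_le_exp (d : ℕ) {δ : ℝ} (hδ : 0 < δ) (q : ℝ) :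
    ∃ C, 0 ≤ C ∧ ∀ ξ : Space d, bracket ξ ^ q ≤ C * Real.exp (δ * taxicab ξ) := by
  set k := ⌈q⌉₊
  refine ⟨k.factorial / δ ^ k * Real.exp δ, by positivity, fun ξ => ?_⟩
  have bracket_nonneg := (bracket_pos ξ).le
  have taxicab_nonneg := taxicab_nonneg ξ
  calc bracket ξ ^ q ≤ bracket ξ ^ (k : ℝ) :=
        Real.rpow_le_rpow_of_exponent_le (one_le_bracket ξ) (Nat.le_ceil q)
    _ = bracket ξ ^ k := Real.rpow_natCast _ _
    _ ≤ (1 + taxicab ξ) ^ k := by gcongr; exact bracket_le_one_add_taxicab ξ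
    _ = k.factorial / δ ^ k * ((δ * (1 + taxicab ξ)) ^ k / k.factorial) := by
        rw [mul_pow]; field_simp
    _ ≤ k.factorial / δ ^ k * Real.exp (δ * (1 + taxicab ξ)) := by
        gcongr
        exact Real.pow_div_factorial_le_exp _ (by positivity) k
    _ = k.factorial / δ ^ k * Real.exp δ * Real.exp (δ * taxicab ξ) := by
        rw [mul_add, Real.exp_add, mul_one, mul_assoc]

-- A loss of derivatives is absorbed by an arbitrarily small loss of the radius.
lemma exists_exp_mul_rpow_le (d : ℕ) {δ : ℝ} (hδ : 0 < δ) (q r : ℝ) :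
    ∃ C, 0 ≤ C ∧ ∀ (σ : ℝ) (ξ : Space d), Real.exp (σ * taxicab ξ) * bracket ξ ^ q ≤
      C * (Real.exp ((σ + δ) * taxicab ξ) * bracket ξ ^ r) := by
  obtain ⟨C, C_nonneg, rpow_le⟩ := exists_bracket_rpow_le_exp d hδ (q - r)
  refine ⟨C, C_nonneg, fun σ ξ => ?_⟩
  have bracket_pos := bracket_pos ξ
  calc Real.exp (σ * taxicab ξ) * bracket ξ ^ q
      = Real.exp (σ * taxicab ξ) * (bracket ξ ^ (q - r) * bracket ξ ^ r) := by
        rw [← Real.rpow_add bracket_pos, sub_add_cancel]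
    _ ≤ Real.exp (σ * taxicab ξ) * (C * Real.exp (δ * taxicab ξ) * bracket ξ ^ r) := by
        gcongr
        exact rpow_le ξ
    _ = C * (Real.exp ((σ + δ) * taxicab ξ) * bracket ξ ^ r) := by
        rw [add_mul, Real.exp_add]; ring

lemma exists_norm_weight_op_le (d : ℕ) {σ₀ : ℝ} (hσ₀ : 0 < σ₀) (r : ℝ) (k : ℕ) :
    ∃ C, 0 ≤ C ∧ ∀ {θ : ℝ} (p : GevreyParams d θ) {f : ℝ → Space d → ℂ} {a : ℕ → ℝ → L2 d}
      {R : ℝ≥0} {t : ℝ}, p.σ ≤ σ₀ / 2 → IsProfile f a → gevreyNorm σ₀ r (f t) ≤ R →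
      ‖p.weight.op (a k t)‖ ≤ C * R := by
  obtain ⟨C, C_nonneg, exp_mul_le⟩ := exists_exp_mul_rpow_le d (half_pos hσ₀) k r
  refine ⟨C, C_nonneg, fun {θ} p f a R t σ_le ha norm_le => ?_⟩
  have symbol_le (ξ : Space d) :
      p.weight.toFun ξ * bracket ξ ^ k ≤ C * (Real.exp (σ₀ * taxicab ξ) * bracket ξ ^ r) := by
    have bracket_pos := bracket_pos ξ
    have exp_mul_le := exp_mul_le (σ₀ / 2) ξ
    rw [add_halves, Real.rpow_natCast] at exp_mul_le
    refine le_trans ?_ exp_mul_le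
    gcongr
    exact Real.exp_le_exp.2 ((min_le_left _ _).trans
      (mul_le_mul_of_nonneg_right σ_le (taxicab_nonneg ξ)))
  rw [ha.gevreyNorm_eq] at norm_le
  have weighted_le : eLpNorm (p.weight.op (a k t)) 2 volume ≤ ENNReal.ofReal C * R := by
    refine (eLpNorm_le_mul_eLpNorm_of_ae_le_mul ?_ 2).trans (mul_le_mul_right norm_le _)
    filter_upwards [p.weight.coeFn_op (a k t), ha.scale k t] with ξ op_ξ a_ξ
    have bracket_pos := bracket_pos ξ
    have weight_nonneg : 0 ≤ p.weight.toFun ξ := (Real.exp_pos _).le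
    rw [op_ξ, a_ξ, norm_mul, norm_mul, norm_mul, ← mul_assoc, ← mul_assoc, norm_pow,
      Complex.norm_of_nonneg weight_nonneg, Complex.norm_of_nonneg bracket_pos.le,
      Complex.norm_of_nonneg (by positivity)]
    exact mul_le_mul_of_nonneg_right (symbol_le ξ) (norm_nonneg _)
  rw [Lp.norm_def]
  refine (ENNReal.toReal_mono (by finiteness) weighted_le).trans_eq ?_
  rw [ENNReal.toReal_mul, ENNReal.toReal_ofReal C_nonneg, ENNReal.coe_toReal]

lemma GevreyParams.eLpNorm_exp_mul_le {θ : ℝ} (p : GevreyParams d θ) {g : L2 d} {K : ℝ}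
    (bound : ∀ q : GevreyParams d θ, q.σ = p.σ → ‖q.weight.op g‖ ≤ K) :
    eLpNorm (fun ξ => (Real.exp (p.σ * taxicab ξ) : ℂ) * g ξ) 2 volume ≤ ENNReal.ofReal K := by
  set q : ℕ → GevreyParams d θ := fun M => { p with M := M, M_nonneg := M.cast_nonneg }
  have weighted_le (M : ℕ) :
      eLpNorm (fun ξ => (q M).weight.op g ξ) 2 volume ≤ ENNReal.ofReal K := by
    rw [← ENNReal.ofReal_toReal (Lp.eLpNorm_ne_top ((q M).weight.op g)), ← Lp.norm_def]
    exact ENNReal.ofReal_le_ofReal (bound (q M) rfl)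
  refine (Lp.eLpNorm_lim_le_liminf_eLpNorm (fun M => (Lp.memLp ((q M).weight.op g)).1) _ ?_).trans
    (liminf_le_of_frequently_le' (.of_forall weighted_le))
  filter_upwards [ae_all_iff.2 fun M => (q M).weight.coeFn_op g] with ξ op_ξ
  refine tendsto_const_nhds.congr' ?_
  filter_upwards [eventually_ge_atTop ⌈p.σ * taxicab ξ⌉₊] with M hM
  have weight_eq : (q M).weight.toFun ξ = Real.exp (p.σ * taxicab ξ) :=
    congrArg Real.exp (min_eq_left (Nat.ceil_le.1 hM))
  rw [op_ξ M, weight_eq]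

lemma GevreyParams.memGevrey_half {θ : ℝ} (p : GevreyParams d θ) (hσ : 0 < p.σ) (r : ℝ) {k : ℕ}
    {t K : ℝ} {f : ℝ → Space d → ℂ} {a : ℕ → ℝ → L2 d} (ha : IsProfile f a)
    (bound : ∀ q : GevreyParams d θ, q.σ = p.σ → ‖q.weight.op (a k t)‖ ≤ K) :
    MemGevrey (p.σ / 2) r (f t) := by
  obtain ⟨C, -, exp_mul_le⟩ := exists_exp_mul_rpow_le d (half_pos hσ) r k
  rw [MemGevrey, ha.gevreyNorm_eq]
  refine lt_of_le_of_lt (eLpNorm_le_mul_eLpNorm_of_ae_le_mul (c := C) ?_ 2)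
    (ENNReal.mul_lt_top ENNReal.ofReal_lt_top
      ((p.eLpNorm_exp_mul_le bound).trans_lt ENNReal.ofReal_lt_top))
  filter_upwards [ha.scale k t] with ξ a_ξ
  have bracket_pos := bracket_pos ξ
  have symbol_le := exp_mul_le (p.σ / 2) ξ
  rw [add_halves, Real.rpow_natCast] at symbol_le
  rw [a_ξ, norm_mul, norm_mul, norm_mul, ← mul_assoc, ← mul_assoc, norm_pow,
    Complex.norm_of_nonneg bracket_pos.le, Complex.norm_of_nonneg (by positivity),
    Complex.norm_of_nonneg (Real.exp_pos _).le, mul_assoc C]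
  gcongr

/-! ### The radius of analyticity -/

lemma WeightedSolution.norm_V_le {θ : ℝ} {p : GevreyParams d θ} {A B D V W : ℕ → ℝ → L2 d}
    (h : WeightedSolution p A B D V W) (t : ℝ) :
    ‖V 0 t‖ ≤ ‖A 2 t‖ + ‖A 0 t‖ + convConst d (2 - θ) * ‖A 1 t‖ * ‖B 1 t‖ := by
  rw [h.V_eq]
  refine (norm_add_le _ _).trans (add_le_add ?_ ?_)
  · rw [norm_smul, norm_neg, Complex.norm_I, one_mul]
    exact norm_sub_le _ _
  · rw [norm_smul, Complex.norm_I, one_mul]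
    exact p.norm_weighted_le h.scale_A h.scale_B t

lemma exists_normBounds (d : ℕ) (θ : ℝ) {σ₀ : ℝ} (hσ₀ : 0 < σ₀) (r s : ℝ) (R : ℝ≥0) :
    ∃ N, 0 ≤ N ∧ ∀ (p : GevreyParams d θ) {f g h : ℝ → Space d → ℂ} {a b c V W : ℕ → ℝ → L2 d}
      {t : ℝ}, p.σ ≤ σ₀ / 2 → IsProfile f a → IsProfile g b → IsProfile h c →
      WeightedSolution p (fun k τ => p.weight.op (a k τ)) (fun k τ => p.weight.op (b k τ))
        (fun k τ => p.weight.op (c k τ)) V W →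
      gevreyNorm σ₀ r (f t) + gevreyNorm σ₀ s (g t) + gevreyNorm σ₀ (s - 1) (h t) ≤ R →
      NormBounds (fun k τ => p.weight.op (a k τ)) (fun k τ => p.weight.op (b k τ))
        (fun k τ => p.weight.op (c k τ)) V N N t := by
  obtain ⟨Ca, Ca_nonneg, a_le⟩ := exists_norm_weight_op_le d hσ₀ r 2
  obtain ⟨Cb, Cb_nonneg, b_le⟩ := exists_norm_weight_op_le d hσ₀ s 2
  obtain ⟨Cc, Cc_nonneg, c_le⟩ := exists_norm_weight_op_le d hσ₀ (s - 1) 1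
  have C_nonneg := convConst_nonneg d (2 - θ)
  have Ra_nonneg : 0 ≤ Ca * R := by positivity
  have Rb_nonneg : 0 ≤ Cb * R := by positivity
  have Rc_nonneg : 0 ≤ Cc * R := by positivity
  have product_nonneg : 0 ≤ convConst d (2 - θ) * (Ca * R) * (Cb * R) := by positivity
  refine ⟨2 * (Ca * R) + Cb * R + Cc * R + convConst d (2 - θ) * (Ca * R) * (Cb * R),
    by positivity, fun p f g h a b c V W t σ_le ha hb hc hw data_le => ?_⟩
  have a_two := a_le p σ_le ha (le_self_add.trans (le_self_add.trans data_le))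
  have b_two := b_le p σ_le hb (le_add_self.trans (le_self_add.trans data_le))
  have c_one := c_le p σ_le hc (le_add_self.trans data_le)
  have a_one := (hw.scale_A.norm_le_succ 1 t).trans a_two
  have a_zero := (hw.scale_A.norm_le_succ 0 t).trans a_one
  have b_one := (hw.scale_B.norm_le_succ 1 t).trans b_two
  have c_zero := (hw.scale_D.norm_le_succ 0 t).trans c_one
  have product_le : convConst d (2 - θ) * ‖p.weight.op (a 1 t)‖ * ‖p.weight.op (b 1 t)‖ ≤
      convConst d (2 - θ) * (Ca * R) * (Cb * R) := by gcongr
  have V_zero := hw.norm_V_le t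
  constructor <;> linarith

lemma exists_radius_le (d : ℕ) {θ c σ₀ : ℝ} (hθ : 0 < θ) (hc : 0 < c) (hσ₀ : 0 < σ₀) :
    ∃ σ > 0, σ ≤ σ₀ ∧ (2 * d * σ) ^ θ ≤ c := by
  refine ⟨min σ₀ (c ^ (1 / θ) / (2 * d + 1)), by positivity, min_le_left _ _, ?_⟩
  have base_le : 2 * d * min σ₀ (c ^ (1 / θ) / (2 * d + 1)) ≤ c ^ (1 / θ) :=
    calc 2 * d * min σ₀ (c ^ (1 / θ) / (2 * d + 1))
        ≤ (2 * d + 1) * (c ^ (1 / θ) / (2 * d + 1)) := by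
          gcongr
          · linarith
          · exact min_le_right _ _
      _ = c ^ (1 / θ) := mul_div_cancel₀ _ (by positivity)
  calc (2 * d * min σ₀ (c ^ (1 / θ) / (2 * d + 1))) ^ θ ≤ (c ^ (1 / θ)) ^ θ := by gcongr
    _ = c := by rw [← Real.rpow_mul hc.le, one_div_mul_cancel hθ.ne', Real.rpow_one]

lemma rpow_mul_decay_mul_rpow {x T θ : ℝ} (hx : 0 ≤ x) (hT : 0 < T) (hθ : 0 < θ) :
    (x * T ^ (-((1 + 1 / θ) / θ))) ^ θ * T ^ (1 + 1 / θ) = x ^ θ := by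
  rw [Real.mul_rpow hx (by positivity), ← Real.rpow_mul hT.le, mul_assoc, ← Real.rpow_add hT,
    neg_mul, div_mul_cancel₀ _ hθ.ne', neg_add_cancel, Real.rpow_zero, mul_one]

theorem exists_radius (d : ℕ) {θ : ℝ} (hθ : 0 < θ) (hθ₁ : θ ≤ 1) (hdθ : (d : ℝ) < 2 * (2 - θ))
    {σ₀ : ℝ} (hσ₀ : 0 < σ₀) (r s : ℝ) (R : ℝ≥0) :
    ∃ c > (0 : ℝ), ∀ (u₀ : Space d → ℂ) (n₀ n₁ : Space d → ℝ),
      gevreyNorm σ₀ r u₀ + gevreyNorm σ₀ s (fun x => (n₀ x : ℂ)) +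
        gevreyNorm σ₀ (s - 1) (fun x => (n₁ x : ℂ)) ≤ R →
      ∀ (u : ℝ → Space d → ℂ) (n : ℝ → Space d → ℝ), IsGlobalSmoothSolution u₀ n₀ n₁ u n →
      ∀ t : ℝ, MemGevrey (c * max 1 |t| ^ (-((1 + 1 / θ) / θ))) r (u t) ∧
        MemGevrey (c * max 1 |t| ^ (-((1 + 1 / θ) / θ))) s (fun x => (n t x : ℂ)) ∧
        MemGevrey (c * max 1 |t| ^ (-((1 + 1 / θ) / θ))) (s - 1)
          (fun x => ((deriv (fun τ => n τ x) t : ℝ) : ℂ)) := by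
  obtain ⟨N, N_nonneg, normBounds⟩ := exists_normBounds d θ hσ₀ r s R
  obtain ⟨K, κ, κ_pos, uniform_bound⟩ := exists_uniform_bound d hθ hθ₁ N_nonneg
  obtain ⟨σ₁, σ₁_pos, σ₁_le, gain_le⟩ := exists_radius_le d hθ κ_pos (half_pos hσ₀)
  refine ⟨σ₁ / 2, half_pos σ₁_pos, fun u₀ n₀ n₁ data_le u n hsol t => ?_⟩
  set T := max 1 |t|
  have one_le_T : 1 ≤ T := le_max_left _ _
  set p : GevreyParams d θ :=
    { θ_pos := hθ, θ_le_one := hθ₁, decay := hdθ, σ := σ₁ * T ^ (-((1 + 1 / θ) / θ)),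
      σ_nonneg := by positivity, M := 0, M_nonneg := le_rfl }
  have σ_pos : 0 < p.σ := by positivity
  have σ_le : p.σ ≤ σ₀ / 2 :=
    (mul_le_of_le_one_right σ₁_pos.le (Real.rpow_le_one_of_one_le_of_nonpos one_le_T
      (neg_nonpos.2 (by positivity)))).trans σ₁_le
  have half_eq : σ₁ / 2 * T ^ (-((1 + 1 / θ) / θ)) = p.σ / 2 := div_mul_eq_mul_div _ _ _
  have init_n : (fun x => (n 0 x : ℂ)) =ᵐ[volume] fun x => (n₀ x : ℂ) :=
    hsol.init_n.fun_comp Complex.ofReal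
  have init_dn : (fun x => ((deriv (fun τ => n τ x) 0 : ℝ) : ℂ)) =ᵐ[volume] fun x => (n₁ x : ℂ) :=
    hsol.init_dn.fun_comp Complex.ofReal
  rw [← gevreyNorm_congr_ae hsol.init_u, ← gevreyNorm_congr_ae init_n,
    ← gevreyNorm_congr_ae init_dn] at data_le
  obtain ⟨a, b, c, hfreq, ha, hb, hc⟩ := hsol.exists_frequencySolution p.dim_le
  have bound (q : GevreyParams d θ) (hq : q.σ = p.σ) :
      ‖q.weight.op (a 1 t)‖ ≤ K ∧ ‖q.weight.op (b 1 t)‖ ≤ K ∧ ‖q.weight.op (c 0 t)‖ ≤ K := by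
    obtain ⟨V, W, hw⟩ := hfreq.weighted q
    refine uniform_bound q _ _ _ V W hw (normBounds q (hq.trans_le σ_le) ha hb hc hw data_le)
      T one_le_T ?_ t (le_max_right _ _)
    rw [GevreyParams.gain, hq, ← mul_assoc, rpow_mul_decay_mul_rpow (by positivity) (by positivity)
      hθ]
    exact gain_le
  rw [half_eq]
  exact ⟨p.memGevrey_half σ_pos r ha fun q hq => (bound q hq).1,
    p.memGevrey_half σ_pos s hb fun q hq => (bound q hq).2.1,
    p.memGevrey_half σ_pos (s - 1) hc fun q hq => (bound q hq).2.2⟩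

-- The exponent is continuous and decreasing in `θ`, and the supremum of the admissible `θ` is
-- `min 1 ((4 - d) / 2)`.
lemma exists_admissible_smoothing {d : ℕ} (hd : d ≤ 3) {q : ℝ}
    (hq : max 2 (2 * (6 - (d : ℝ)) / (4 - d) ^ 2) < q) :
    ∃ θ : ℝ, 0 < θ ∧ θ ≤ 1 ∧ (d : ℝ) < 2 * (2 - θ) ∧ (1 + 1 / θ) / θ ≤ q := by
  have cast_le : (d : ℝ) ≤ 3 := by exact_mod_cast hd
  set τ := min 1 ((4 - (d : ℝ)) / 2)
  have τ_pos : 0 < τ := lt_min one_pos (by linarith)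
  have exponent_lt : (1 + 1 / τ) / τ < q := by
    rcases min_choice 1 ((4 - (d : ℝ)) / 2) with τ_eq | τ_eq
    · refine lt_of_eq_of_lt ?_ ((le_max_left _ _).trans_lt hq)
      rw [show τ = 1 from τ_eq]
      norm_num
    · refine lt_of_eq_of_lt ?_ ((le_max_right _ _).trans_lt hq)
      have : 4 - (d : ℝ) ≠ 0 := by linarith
      rw [show τ = (4 - (d : ℝ)) / 2 from τ_eq]
      field_simp
      ring
  have continuousAt_exponent : ContinuousAt (fun θ : ℝ => (1 + 1 / θ) / θ) τ := by
    fun_prop (disch := exact τ_pos.ne')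
  have near_τ : ∀ᶠ θ in 𝓝[<] τ, 0 < θ ∧ (1 + 1 / θ) / θ < q :=
    nhdsWithin_le_nhds ((lt_mem_nhds τ_pos).and
      (continuousAt_exponent.eventually_lt_const exponent_lt))
  obtain ⟨θ, ⟨θ_pos, lt_q⟩, θ_lt⟩ := (near_τ.and self_mem_nhdsWithin).exists
  have θ_lt_half : θ < (4 - (d : ℝ)) / 2 := (Set.mem_Iio.1 θ_lt).trans_le (min_le_right _ _)
  exact ⟨θ, θ_pos, (Set.mem_Iio.1 θ_lt).le.trans (min_le_left _ _), by linarith, lt_q.le⟩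

lemma max_exponent_le {d : ℕ} (hd : d ≤ 3) :
    max 2 (2 * (6 - (d : ℝ)) / (4 - d) ^ 2) ≤ max (8 / (4 - (d : ℝ))) 4 := by
  have cast_le : (d : ℝ) ≤ 3 := by exact_mod_cast hd
  have sub_pos : 0 < 4 - (d : ℝ) := by linarith
  refine max_le (le_max_of_le_right (by norm_num)) (le_max_of_le_left ?_)
  rw [div_le_div_iff₀ (by positivity) sub_pos]
  nlinarith

end

end KGS

theorem theorem1p1_general (d : ℕ) (hd : d ≤ 3) (σ₀ : ℝ) (hσ₀ : 0 < σ₀) (r s q : ℝ)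
    (hq : max 2 (2 * (6 - (d : ℝ)) / (4 - d) ^ 2) < q) (R : ℝ≥0) :
    ∃ c > (0 : ℝ), ∃ T > (0 : ℝ),
      ∀ (u₀ : EuclideanSpace ℝ (Fin d) → ℂ) (n₀ n₁ : EuclideanSpace ℝ (Fin d) → ℝ),
        KGS.gevreyNorm σ₀ r u₀ + KGS.gevreyNorm σ₀ s (fun x => (n₀ x : ℂ)) +
            KGS.gevreyNorm σ₀ (s - 1) (fun x => (n₁ x : ℂ)) ≤ R →
        ∀ (u : ℝ → EuclideanSpace ℝ (Fin d) → ℂ) (n : ℝ → EuclideanSpace ℝ (Fin d) → ℝ),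
          KGS.IsGlobalSmoothSolution u₀ n₀ n₁ u n →
          ∃ σ : ℝ → ℝ,
            (∀ t, 0 < σ t ∧
              KGS.MemGevrey (σ t) r (u t) ∧
              KGS.MemGevrey (σ t) s (fun x => (n t x : ℂ)) ∧
              KGS.MemGevrey (σ t) (s - 1) (fun x => ((deriv (fun τ => n τ x) t : ℝ) : ℂ))) ∧
            ∀ t, T ≤ |t| → c * |t| ^ (-q) ≤ σ t := by
  obtain ⟨θ, hθ, hθ₁, hdθ, exponent_le⟩ := KGS.exists_admissible_smoothing hd hq
  obtain ⟨c, c_pos, mem_gevrey⟩ := KGS.exists_radius d hθ hθ₁ hdθ hσ₀ r s R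
  refine ⟨c, c_pos, 1, one_pos, fun u₀ n₀ n₁ data_le u n hsol =>
    ⟨fun t => c * max 1 |t| ^ (-((1 + 1 / θ) / θ)),
      fun t => ⟨by positivity, mem_gevrey u₀ n₀ n₁ data_le u n hsol t⟩, fun t ht => ?_⟩⟩
  simp only [max_eq_right ht]
  gcongr

theorem theorem1p1 (d : ℕ) (hd₁ : 1 ≤ d) (hd₃ : d ≤ 3)
    (σ₀ : ℝ) (hσ₀ : 0 < σ₀) (r s : ℝ) (ε : ℝ) (hε : 0 < ε) (R : ℝ≥0) :
    ∃ c > (0 : ℝ), ∃ T > (0 : ℝ),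
      ∀ (u₀ : EuclideanSpace ℝ (Fin d) → ℂ) (n₀ n₁ : EuclideanSpace ℝ (Fin d) → ℝ),
        KGS.gevreyNorm σ₀ r u₀ + KGS.gevreyNorm σ₀ s (fun x => (n₀ x : ℂ)) +
            KGS.gevreyNorm σ₀ (s - 1) (fun x => (n₁ x : ℂ)) ≤ R →
        ∀ (u : ℝ → EuclideanSpace ℝ (Fin d) → ℂ) (n : ℝ → EuclideanSpace ℝ (Fin d) → ℝ),
          KGS.IsGlobalSmoothSolution u₀ n₀ n₁ u n →
          ∃ σ : ℝ → ℝ,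
            (∀ t, 0 < σ t ∧
              KGS.MemGevrey (σ t) r (u t) ∧
              KGS.MemGevrey (σ t) s (fun x => (n t x : ℂ)) ∧
              KGS.MemGevrey (σ t) (s - 1) (fun x => ((deriv (fun τ => n τ x) t : ℝ) : ℂ))) ∧
            ∀ t, T ≤ |t| → c * |t| ^ (-(max (8 / (4 - (d : ℝ))) 4 + ε)) ≤ σ t :=
  theorem1p1_general d hd₃ σ₀ hσ₀ r s _
    ((KGS.max_exponent_le hd₃).trans_lt (lt_add_of_pos_right _ hε)) R
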